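/- **Theorem 5.** Let $M$ be an asymptotically flat $3$-manifold: a smooth Hausdorff, second countable $3$-manifold without boundary, together with a compact set $C\subset M$ and diffeomorphisms $\Phi_i\colon U_i\to\mathbb R^3\setminus B_i$ $(1\le i\le n)$, where $M\setminus C$ is the disjoint union of the open sets $U_1,\dots,U_n$, each $B_i$ is a closed ball centred at the origin, the function $|\Phi_i|$ is bounded on $K\cap U_i$ for every compact $K\subset M$, and $C\cup\bigcup_i\{x\in U_i : |\Phi_i(x)|\le r\}$ is compact for every $r$ (the infinities of the copies of $\mathbb R^3\setminus B_i$ are exactly the infinities of $M$). Then $M$ carries physically reasonable, asymptotically flat initial data with $J^a=0$ and $\rho\ge 0$. That is, there are a smooth Riemannian metric $g_{ab}$, a smooth symmetric tensor $p_{ab}$ and a smooth function $\rho\ge 0$ on $M$ which, with the vector field $J^a=0$, satisfy the constraints $$R-p_{ab}p^{ab}+p^2=16\pi\rho,\qquad D_b(p^{ab}-p\,g^{ab})=8\pi J^a$$ (where $R$ is the scalar curvature and $D$ the Levi-Civita connection of $g_{ab}$, and $p=p_a{}^a$), such that $g_{ab}$ is geodesically complete, $\rho\ge\sqrt{J_aJ^a}$,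 and on each end the components $\hat g_{ab},\hat p_{ab}$ of the pullbacks of $g_{ab},p_{ab}$ by $\Phi_i^{-1}$ satisfy, as $r=|y|\to\infty$, $$\hat g_{ab}-\delta_{ab}=O(1/r),\quad \partial_c\hat g_{ab}=O(1/r^2),\quad \partial_d\partial_c\hat g_{ab}=O(1/r^3),\quad \hat p_{ab}=O(1/r^2),\quad \partial_c\hat p_{ab}=O(1/r^3).$$ -/

import Mathlib

open scoped Manifold ContDiff Topology

noncomputable section

namespace GRData

/-- The model space `ℝ³` with its Euclidean norm. -/
abbrev E3 : Type := EuclideanSpace ℝ (Fin 3)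

/-- The `a`-th standard basis vector of `ℝ³`. -/
def basisVec (a : Fin 3) : E3 := EuclideanSpace.single a (1 : ℝ)

/-- The partial derivative `∂_a f` of a real function on (an open subset of) `ℝ³`. -/
def pd (a : Fin 3) (f : E3 → ℝ) (y : E3) : ℝ := fderiv ℝ f y (basisVec a)

/-! ### Local formulas

`G : E3 → Matrix (Fin 3) (Fin 3) ℝ` is the matrix field `g_ab` of a metric in a coordinate system,
and `P` that of a symmetric 2-tensor `p_ab`. -/

/-- Christoffel symbols `Γ^k_ij = ½ g^{kl} (∂_i g_jl + ∂_j g_il - ∂_l g_ij)`. -/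
def christoffel (G : E3 → Matrix (Fin 3) (Fin 3) ℝ) (k i j : Fin 3) (y : E3) : ℝ :=
  (1 / 2) * ∑ l, (G y)⁻¹ k l *
    (pd i (fun z => G z j l) y + pd j (fun z => G z i l) y - pd l (fun z => G z i j) y)

/-- Ricci tensor
`R_ij = ∂_k Γ^k_ij - ∂_j Γ^k_ik + Γ^k_kl Γ^l_ij - Γ^k_jl Γ^l_ik`. -/
def ricci (G : E3 → Matrix (Fin 3) (Fin 3) ℝ) (i j : Fin 3) (y : E3) : ℝ :=
  ∑ k, (pd k (christoffel G k i j) y - pd j (christoffel G k i k) y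
    + ∑ l, (christoffel G k k l y * christoffel G l i j y
      - christoffel G k j l y * christoffel G l i k y))

/-- Scalar curvature `R = g^{ij} R_ij`. -/
def scalarCurv (G : E3 → Matrix (Fin 3) (Fin 3) ℝ) (y : E3) : ℝ :=
  ∑ i, ∑ j, (G y)⁻¹ i j * ricci G i j y

/-- The trace `p = p_a^a = g^{ab} p_ab`. -/
def trLocal (G P : E3 → Matrix (Fin 3) (Fin 3) ℝ) (y : E3) : ℝ :=
  ∑ a, ∑ b, (G y)⁻¹ a b * P y a b

/-- The tensor with both indices raised, `p^{ab} = g^{ac} g^{bd} p_cd`. -/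
def raised (G P : E3 → Matrix (Fin 3) (Fin 3) ℝ) (a b : Fin 3) (y : E3) : ℝ :=
  ∑ c, ∑ d, (G y)⁻¹ a c * (G y)⁻¹ b d * P y c d

/-- The square `p_ab p^ab`. -/
def sqLocal (G P : E3 → Matrix (Fin 3) (Fin 3) ℝ) (y : E3) : ℝ :=
  ∑ a, ∑ b, P y a b * raised G P a b y

/-- The contravariant tensor `p^{ab} - p g^{ab}`. -/
def momentumTensor (G P : E3 → Matrix (Fin 3) (Fin 3) ℝ) (a b : Fin 3) (y : E3) : ℝ :=
  raised G P a b y - trLocal G P y * (G y)⁻¹ a b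

/-- The covariant divergence `D_b T^{ab} = ∂_b T^{ab} + Γ^a_bc T^{cb} + Γ^b_bc T^{ac}` of the tensor
`T^{ab} = p^{ab} - p g^{ab}`. -/
def divMomentum (G P : E3 → Matrix (Fin 3) (Fin 3) ℝ) (a : Fin 3) (y : E3) : ℝ :=
  ∑ b, (pd b (momentumTensor G P a b) y
    + ∑ c, (christoffel G a b c y * momentumTensor G P c b y
      + christoffel G b b c y * momentumTensor G P a c y))

/-! ### Tensors on a 3-manifold -/

variable (M : Type*) [TopologicalSpace M] [ChartedSpace E3 M]

/-- Fields of covariant 2-tensors (not assumed smooth or symmetric). -/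
abbrev TwoTensor : Type _ :=
  ∀ x : M, TangentSpace (𝓡 3) x →L[ℝ] TangentSpace (𝓡 3) x →L[ℝ] ℝ

variable {M}

/-- The coordinate vector field `∂/∂x^a` of the chart `e`, at the point with coordinates `y`. -/
def coordVec (e : OpenPartialHomeomorph M E3) (a : Fin 3) (y : E3) :
    TangentSpace (𝓡 3) (e.symm y) :=
  mfderiv (𝓡 3) (𝓡 3) e.symm y (basisVec a)

/-- The matrix of components `T_ab` of a 2-tensor in the chart `e`, as a function of the
coordinates: the pullback of `T` to `e.target ⊆ ℝ³`. -/
def components (e : OpenPartialHomeomorph M E3) (T : TwoTensor M) (y : E3) :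
    Matrix (Fin 3) (Fin 3) ℝ :=
  Matrix.of fun a b => T (e.symm y) (coordVec e a y) (coordVec e b y)

/-- The component `V^a` at `x` of a vector in the chart `e`. -/
def vecComponent (e : OpenPartialHomeomorph M E3) (x : M) (v : TangentSpace (𝓡 3) x) (a : Fin 3) :
    ℝ :=
  (show E3 from mfderiv (𝓡 3) (𝓡 3) e x v) a

/-- A smooth curve `γ : ℝ → M` is a geodesic of `g` if it satisfies
`γ''^k + Γ^k_ij γ'^i γ'^j = 0`. -/
def IsGeodesic (g : TwoTensor M) (γ : ℝ → M) : Prop :=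
  ContMDiff 𝓘(ℝ, ℝ) (𝓡 3) ∞ γ ∧
  ∀ t : ℝ, ∀ k : Fin 3,
    deriv (deriv fun s => (chartAt E3 (γ t) (γ s)) k) t
      + ∑ i, ∑ j, christoffel (components (chartAt E3 (γ t)) g) k i j (chartAt E3 (γ t) (γ t))
          * deriv (fun s => (chartAt E3 (γ t) (γ s)) i) t
          * deriv (fun s => (chartAt E3 (γ t) (γ s)) j) t = 0

/-- Geodesic completeness: every tangent vector is the initial velocity of a geodesic defined on
all of `ℝ`. -/
def GeodesicallyComplete (g : TwoTensor M) : Prop :=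
  ∀ w : TangentBundle (𝓡 3) M, ∃ γ : ℝ → M, IsGeodesic g γ ∧
    (⟨γ 0, mfderiv 𝓘(ℝ, ℝ) (𝓡 3) γ 0 (1 : ℝ)⟩ : TangentBundle (𝓡 3) M) = w

variable (M)

/-- A smooth initial data set on the 3-manifold `M`: a Riemannian metric `g_ab`, a symmetric tensor
`p_ab`, an energy density `ρ` and a momentum density `J^a`, all smooth, which satisfy
`R - p_ab p^ab + p² = 16πρ` and `D_b (p^ab - p g^ab) = 8π J^a`. The constraints are written at each
point `x` in the preferred chart at `x`. -/
structure InitialDataSet [IsManifold (𝓡 3) ∞ M] where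
  /-- the metric `g_ab` -/
  g : Bundle.ContMDiffRiemannianMetric (𝓡 3) ∞ E3 (fun x : M => TangentSpace (𝓡 3) x)
  /-- the extrinsic curvature `p_ab` -/
  p : TwoTensor M
  p_symm : ∀ (x : M) (v w : TangentSpace (𝓡 3) x), p x v w = p x w v
  p_smooth : ContMDiff (𝓡 3) ((𝓡 3).prod 𝓘(ℝ, E3 →L[ℝ] E3 →L[ℝ] ℝ)) ∞
    (fun x : M => Bundle.TotalSpace.mk' (E3 →L[ℝ] E3 →L[ℝ] ℝ)
      (E := fun x : M => TangentSpace (𝓡 3) x →L[ℝ] TangentSpace (𝓡 3) x →L[ℝ] ℝ) x (p x))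
  /-- the energy density `ρ` -/
  ρ : M → ℝ
  ρ_smooth : ContMDiff (𝓡 3) 𝓘(ℝ, ℝ) ∞ ρ
  /-- the momentum density `J^a` -/
  J : ∀ x : M, TangentSpace (𝓡 3) x
  J_smooth : ContMDiff (𝓡 3) ((𝓡 3).prod (𝓡 3)) ∞
    (fun x : M => (⟨x, J x⟩ : TangentBundle (𝓡 3) M))
  hamiltonian : ∀ x : M,
    scalarCurv (components (chartAt E3 x) g.inner) (chartAt E3 x x)
      - sqLocal (components (chartAt E3 x) g.inner) (components (chartAt E3 x) p) (chartAt E3 x x)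
      + trLocal (components (chartAt E3 x) g.inner) (components (chartAt E3 x) p)
          (chartAt E3 x x) ^ 2
      = 16 * Real.pi * ρ x
  momentum : ∀ (x : M) (a : Fin 3),
    divMomentum (components (chartAt E3 x) g.inner) (components (chartAt E3 x) p) a
        (chartAt E3 x x)
      = 8 * Real.pi * vecComponent (chartAt E3 x) x (J x) a

/-- The structure of an asymptotically flat 3-manifold: a compact set `core` whose complement is the
disjoint union of finitely many open sets, each of them diffeomorphic to `ℝ³` minus a closed ball
by a chart `chart i` of the maximal smooth atlas. The infinity of each copy of `ℝ³` minus a ball is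
at infinity in `M` (`‖y‖` is bounded on the part of the end in a compact set), and there is no other
infinity: what remains of `M` when the parts `‖y‖ > r` of all the ends are cut off is compact. -/
structure AsymptoticEnds where
  /-- the compact set `C` -/
  core : Set M
  isCompact_core : IsCompact core
  /-- the number of ends -/
  n : ℕ
  /-- the diffeomorphisms of the ends onto `ℝ³` minus a ball -/
  chart : Fin n → OpenPartialHomeomorph M E3
  chart_mem : ∀ i, chart i ∈ IsManifold.maximalAtlas (𝓡 3) ∞ M
  /-- the radii of the balls -/
  radius : Fin n → ℝ
  radius_pos : ∀ i, 0 < radius i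
  target_eq : ∀ i, (chart i).target = (Metric.closedBall (0 : E3) (radius i))ᶜ
  compl_core : coreᶜ = ⋃ i, (chart i).source
  disjoint : Pairwise fun i j => Disjoint (chart i).source (chart j).source
  bounded_on_compact : ∀ (i : Fin n) (K : Set M), IsCompact K →
    ∃ r : ℝ, ∀ x ∈ K, x ∈ (chart i).source → ‖chart i x‖ ≤ r
  isCompact_truncation : ∀ r : ℝ,
    IsCompact (core ∪ ⋃ i, {x | x ∈ (chart i).source ∧ ‖chart i x‖ ≤ r})

variable {M}

namespace InitialDataSet

variable [IsManifold (𝓡 3) ∞ M]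

/-- Physically reasonable data: smooth (which is part of `InitialDataSet`), geodesically complete,
and with `ρ ≥ √(J_a J^a)`. -/
def PhysicallyReasonable (D : InitialDataSet M) : Prop :=
  GeodesicallyComplete D.g.inner ∧ ∀ x, Real.sqrt (D.g.inner x (D.J x) (D.J x)) ≤ D.ρ x

/-- Asymptotically flat data, with respect to the given coordinates on the ends: as `r = ‖y‖ → ∞` in
each end, `g_ab - δ_ab = O(1/r)`, `∂_c g_ab = O(1/r²)`, `∂_d ∂_c g_ab = O(1/r³)`,
`p_ab = O(1/r²)` and `∂_c p_ab = O(1/r³)`. -/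
def IsAsymptoticallyFlat (D : InitialDataSet M) (E : AsymptoticEnds M) : Prop :=
  ∀ (i : Fin E.n) (a b : Fin 3),
    ((fun y => components (E.chart i) D.g.inner y a b - (1 : Matrix (Fin 3) (Fin 3) ℝ) a b)
        =O[Bornology.cobounded E3] fun y => 1 / ‖y‖) ∧
    (∀ c, (pd c fun y => components (E.chart i) D.g.inner y a b)
        =O[Bornology.cobounded E3] fun y => 1 / ‖y‖ ^ 2) ∧
    (∀ c d, (pd d (pd c fun y => components (E.chart i) D.g.inner y a b))
        =O[Bornology.cobounded E3] fun y => 1 / ‖y‖ ^ 3) ∧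
    ((fun y => components (E.chart i) D.p y a b)
        =O[Bornology.cobounded E3] fun y => 1 / ‖y‖ ^ 2) ∧
    (∀ c, (pd c fun y => components (E.chart i) D.p y a b)
        =O[Bornology.cobounded E3] fun y => 1 / ‖y‖ ^ 3)

end InitialDataSet

end GRData

end

/-!
There is no obstruction to nonnegative energy density because the extrinsic curvature is free: with
`p = c g` for a constant `c`, the momentum density vanishes and the left-hand side of the
Hamiltonian constraint is `R + 6c²` (`hamDensity_smul`, `divMomentum_smul`). On a compact set this
is nonnegative for large `c` (`AsymptoticEnds.exists_curvature_bound`), whatever the topology and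
the metric are. Gluing local flat metrics by a partition of unity gives a metric that is Euclidean
far out in every end (`AsymptoticEnds.exists_flat_metric`), so it remains to continue the data
`g = δ`, `p = cδ` along an end to asymptotically flat data, with zero momentum density and
nonnegative energy density.

This is done with rotational symmetry. Let `s = |y|²/2`, and take the metric `g` with inverse
`δ - β(s) y yᵀ` and the tensor `p` with mixed components `b(s) δ + b'(s) y yᵀ`. Such data have zero
momentum density (`IsProfile.divMomentum_radial`), and their Hamiltonian density is
`6w + 4s w'` with `w = β + b²` (`IsProfile.hamiltonian_radial`), which is nonnegative exactly if
`s^(3/2) w` is nondecreasing. Start from `β = 0`, `b = c`. With `β = 0` take `w = b²` from `c²` to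
`K s^(-3/2)`, which is the flat slice of the Schwarzschild spacetime of mass proportional to `K`;
then, at a radius large compared with that mass, pass from `β = 0` to `b = 0` keeping `w` fixed,
which bends the slice to the time-symmetric one (`exists_profile`). The resulting end is spatial
Schwarzschild space, so `g` is asymptotically flat (`radMat_decay`) and `p` vanishes near infinity.

The constraints are defined by formulas in charts, while the data are known on the ends in the
asymptotic coordinates. The passage between charts is the tensoriality of the scalar curvature and
of the divergence (`IsTransition.scalarCurv_eq`, `IsTransition.divMomentum_law`); both follow from
the transformation law of the Christoffel symbols, `IsTransition.connMat_law`, which in turn follows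
from the uniqueness of the torsion-free metric connection.

For completeness, `g ≥ δ` far out in the ends because `β ≥ 0`. Hence a logarithmically growing
proper function (`AsymptoticEnds.growth`) changes at a bounded rate along unit speed geodesics, a
geodesic stays in a compact set for a bounded time, and there it can be extended by a uniform amount
(`exists_uniform_geodesic`, `geodesicallyComplete_of_proper`).
-/

noncomputable section

namespace GRData

open scoped Matrix
open Filter

/-! ### Calculus of matrix-valued functions on `ℝ³` -/

/-- A matrix field on `ℝ³`. -/
abbrev MatField : Type := E3 → Matrix (Fin 3) (Fin 3) ℝ

/-- The entrywise partial derivative `∂_k A` of a matrix field. -/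
def pdMat (k : Fin 3) (A : MatField) (y : E3) : Matrix (Fin 3) (Fin 3) ℝ :=
  Matrix.of fun i j => pd k (fun z => A z i j) y

/-- Entrywise smoothness of a matrix field at a point. -/
def SmoothMat (A : MatField) (y : E3) : Prop :=
  ∀ i j, ContDiffAt ℝ ∞ (fun z => A z i j) y

/-- The Jacobian matrix `∂φ^m/∂y^k` of a map of `ℝ³`. -/
def jac (φ : E3 → E3) (y : E3) : Matrix (Fin 3) (Fin 3) ℝ :=
  Matrix.of fun m k => pd k (fun z => φ z m) y

lemma pd_congr {f g : E3 → ℝ} {y : E3} (h : f =ᶠ[𝓝 y] g) (a : Fin 3) : pd a f y = pd a g y := by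
  simp only [pd, h.fderiv_eq]

lemma pd_contDiffAt {f : E3 → ℝ} {y : E3} (h : ContDiffAt ℝ ∞ f y) (a : Fin 3) :
    ContDiffAt ℝ ∞ (pd a f) y :=
  (h.fderiv_right (m := ∞) (by simp)).clm_apply contDiffAt_const

lemma differentiableAt_of_smooth {f : E3 → ℝ} {y : E3} (h : ContDiffAt ℝ ∞ f y) :
    DifferentiableAt ℝ f y := h.differentiableAt (by simp)

lemma pd_add {f g : E3 → ℝ} {y : E3} (hf : DifferentiableAt ℝ f y) (hg : DifferentiableAt ℝ g y)
    (a : Fin 3) : pd a (fun z => f z + g z) y = pd a f y + pd a g y := by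
  simp [pd, fderiv_fun_add hf hg]

lemma pd_mul {f g : E3 → ℝ} {y : E3} (hf : DifferentiableAt ℝ f y) (hg : DifferentiableAt ℝ g y)
    (a : Fin 3) : pd a (fun z => f z * g z) y = pd a f y * g y + f y * pd a g y := by
  simp [pd, fderiv_fun_mul hf hg]; ring

lemma pd_sum {ι : Type*} {s : Finset ι} {f : ι → E3 → ℝ} {y : E3}
    (hf : ∀ i ∈ s, DifferentiableAt ℝ (f i) y) (a : Fin 3) :
    pd a (fun z => ∑ i ∈ s, f i z) y = ∑ i ∈ s, pd a (f i) y := by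
  simp [pd, fderiv_fun_sum hf]

lemma pd_const_mul {f : E3 → ℝ} {y : E3} (c : ℝ) (a : Fin 3) (hf : DifferentiableAt ℝ f y) :
    pd a (fun z => c * f z) y = c * pd a f y := by
  simp [pd, fderiv_const_mul hf]

lemma fderiv_eq_sum_pd (f : E3 → ℝ) (y v : E3) : fderiv ℝ f y v = ∑ m, v m * pd m f y := by
  have hv : v = ∑ m, v m • basisVec m := by
    ext i; simp [basisVec, Pi.single_apply]
  conv_lhs => rw [hv]
  simp [pd]

lemma pd_coord (a b : Fin 3) (y : E3) :
    pd a (fun z : E3 => z b) y = (1 : Matrix (Fin 3) (Fin 3) ℝ) b a := by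
  have : (fun z : E3 => z b) = (EuclideanSpace.proj b : E3 →L[ℝ] ℝ) := by ext; simp
  rw [pd, this, ContinuousLinearMap.fderiv]
  simp [basisVec, Matrix.one_apply]

lemma contDiffAt_coord {φ : E3 → E3} {y : E3} (h : ContDiffAt ℝ ∞ φ y) (m : Fin 3) :
    ContDiffAt ℝ ∞ (fun z => φ z m) y :=
  (EuclideanSpace.proj m : E3 →L[ℝ] ℝ).contDiff.contDiffAt.comp y h

lemma fderiv_coord {φ : E3 → E3} {y : E3} (h : DifferentiableAt ℝ φ y) (v : E3) (m : Fin 3) :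
    fderiv ℝ φ y v m = fderiv ℝ (fun z => φ z m) y v := by
  have := ((EuclideanSpace.proj m : E3 →L[ℝ] ℝ).hasFDerivAt.comp y h.hasFDerivAt).fderiv
  have h2 : (fun z => φ z m) = (EuclideanSpace.proj m : E3 →L[ℝ] ℝ) ∘ φ := by ext; simp
  rw [h2, this]; simp

lemma pd_comp {f : E3 → ℝ} {φ : E3 → E3} {y : E3} (hf : DifferentiableAt ℝ f (φ y))
    (hφ : DifferentiableAt ℝ φ y) (k : Fin 3) :
    pd k (fun z => f (φ z)) y = ∑ m, jac φ y m k * pd m f (φ y) := by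
  have : fderiv ℝ (fun z => f (φ z)) y = (fderiv ℝ f (φ y)).comp (fderiv ℝ φ y) :=
    fderiv_comp y hf hφ
  rw [pd, this, ContinuousLinearMap.comp_apply, fderiv_eq_sum_pd]
  refine Finset.sum_congr rfl fun m _ => ?_
  rw [fderiv_coord hφ]; rfl

lemma pd_comm {f : E3 → ℝ} {y : E3} (hf : ContDiffAt ℝ ∞ f y) (i j : Fin 3) :
    pd i (pd j f) y = pd j (pd i f) y := by
  have hs : IsSymmSndFDerivAt ℝ f y := hf.isSymmSndFDerivAt (by
    simpa using WithTop.coe_le_coe.2 (le_top : (2 : ℕ∞) ≤ ⊤))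
  have hd : DifferentiableAt ℝ (fderiv ℝ f) y :=
    (hf.fderiv_right (m := ∞) (by simp)).differentiableAt (by simp)
  have h (a b : Fin 3) : pd a (pd b f) y = fderiv ℝ (fderiv ℝ f) y (basisVec a) (basisVec b) := by
    have : fderiv ℝ (fun z => fderiv ℝ f z (basisVec b)) y =
        (fderiv ℝ (fderiv ℝ f) y).flip (basisVec b) := by
      rw [fderiv_clm_apply hd (differentiableAt_const _)]; simp
    change fderiv ℝ (fun z => fderiv ℝ f z (basisVec b)) y (basisVec a) = _
    rw [this]; rfl
  rw [h, h]; exact hs _ _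

lemma pdMat_congr {A B : MatField} {y : E3} (h : A =ᶠ[𝓝 y] B) (k : Fin 3) :
    pdMat k A y = pdMat k B y := by
  ext i j
  exact pd_congr (h.mono fun z hz => by rw [hz]) k

lemma SmoothMat.congr {A B : MatField} {y : E3} (hA : SmoothMat A y) (h : B =ᶠ[𝓝 y] A) :
    SmoothMat B y := fun i j =>
  (hA i j).congr_of_eventuallyEq (h.mono fun _ hz => congrFun (congrFun hz i) j)

lemma SmoothMat.pdMat {A : MatField} {y : E3} (h : SmoothMat A y) (k : Fin 3) :
    SmoothMat (pdMat k A) y := fun i j => pd_contDiffAt (h i j) k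

lemma SmoothMat.mul {A B : MatField} {y : E3} (hA : SmoothMat A y) (hB : SmoothMat B y) :
    SmoothMat (fun z => A z * B z) y := fun i j => by
  simp only [Matrix.mul_apply]
  exact ContDiffAt.sum fun k _ => (hA i k).mul (hB k j)

lemma SmoothMat.add {A B : MatField} {y : E3} (hA : SmoothMat A y) (hB : SmoothMat B y) :
    SmoothMat (fun z => A z + B z) y := fun i j => (hA i j).add (hB i j)

lemma SmoothMat.sum {f : Fin 3 → MatField} {y : E3} (hA : ∀ a, SmoothMat (f a) y) :
    SmoothMat (fun z => ∑ a, f a z) y := fun i j => by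
  simp only [Matrix.sum_apply]
  exact ContDiffAt.sum fun a _ => hA a i j

lemma SmoothMat.smul {f : E3 → ℝ} {A : MatField} {y : E3} (hf : ContDiffAt ℝ ∞ f y)
    (hA : SmoothMat A y) : SmoothMat (fun z => f z • A z) y := fun i j => hf.mul (hA i j)

lemma SmoothMat.transpose {A : MatField} {y : E3} (hA : SmoothMat A y) :
    SmoothMat (fun z => (A z)ᵀ) y := fun i j => hA j i

lemma SmoothMat.comp {A : MatField} {φ : E3 → E3} {y : E3} (hA : SmoothMat A (φ y))
    (hφ : ContDiffAt ℝ ∞ φ y) : SmoothMat (fun z => A (φ z)) y :=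
  fun i j => (hA i j).comp y hφ

lemma smoothMat_jac {φ : E3 → E3} {y : E3} (hφ : ContDiffAt ℝ ∞ φ y) : SmoothMat (jac φ) y :=
  fun m k => pd_contDiffAt (contDiffAt_coord hφ m) k

lemma SmoothMat.det {A : MatField} {y : E3} (hA : SmoothMat A y) :
    ContDiffAt ℝ ∞ (fun z => (A z).det) y := by
  simp only [Matrix.det_fin_three]
  have := hA
  simp only [SmoothMat] at this
  fun_prop

lemma SmoothMat.inv {A : MatField} {y : E3} (hA : SmoothMat A y) (h : (A y).det ≠ 0) :
    SmoothMat (fun z => (A z)⁻¹) y := fun i j => by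
  simp only [Matrix.inv_def, Matrix.smul_apply, Ring.inverse_eq_inv', smul_eq_mul]
  refine (hA.det.inv h).mul ?_
  simp only [Matrix.adjugate_fin_three]
  have := hA
  simp only [SmoothMat] at this
  fin_cases i <;> fin_cases j <;> simp <;> fun_prop

lemma pdMat_mul {A B : MatField} {y : E3} (hA : SmoothMat A y) (hB : SmoothMat B y) (k : Fin 3) :
    pdMat k (fun z => A z * B z) y = pdMat k A y * B y + A y * pdMat k B y := by
  ext i j
  simp only [pdMat, Matrix.mul_apply, Matrix.of_apply, Matrix.add_apply]
  rw [pd_sum (fun l _ => differentiableAt_of_smooth ((hA i l).mul (hB l j))),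
    ← Finset.sum_add_distrib]
  exact Finset.sum_congr rfl fun l _ =>
    pd_mul (differentiableAt_of_smooth (hA i l)) (differentiableAt_of_smooth (hB l j)) k

lemma pdMat_add {A B : MatField} {y : E3} (hA : SmoothMat A y) (hB : SmoothMat B y) (k : Fin 3) :
    pdMat k (fun z => A z + B z) y = pdMat k A y + pdMat k B y := by
  ext i j
  exact pd_add (differentiableAt_of_smooth (hA i j)) (differentiableAt_of_smooth (hB i j)) k

lemma pdMat_smul {f : E3 → ℝ} {A : MatField} {y : E3} (hf : ContDiffAt ℝ ∞ f y)
    (hA : SmoothMat A y) (k : Fin 3) :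
    pdMat k (fun z => f z • A z) y = pd k f y • A y + f y • pdMat k A y := by
  ext i j
  exact pd_mul (differentiableAt_of_smooth hf) (differentiableAt_of_smooth (hA i j)) k

lemma pdMat_sum {f : Fin 3 → MatField} {y : E3} (hf : ∀ a, SmoothMat (f a) y) (k : Fin 3) :
    pdMat k (fun z => ∑ a, f a z) y = ∑ a, pdMat k (f a) y := by
  ext i j
  simp only [pdMat, Matrix.sum_apply, Matrix.of_apply]
  exact pd_sum (fun a _ => (differentiableAt_of_smooth (hf a i j))) k

lemma pdMat_transpose (A : MatField) (y : E3) (k : Fin 3) :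
    pdMat k (fun z => (A z)ᵀ) y = (pdMat k A y)ᵀ := rfl

lemma pdMat_comp {A : MatField} {φ : E3 → E3} {y : E3} (hA : SmoothMat A (φ y))
    (hφ : ContDiffAt ℝ ∞ φ y) (k : Fin 3) :
    pdMat k (fun z => A (φ z)) y = ∑ m, jac φ y m k • pdMat m A (φ y) := by
  ext i j
  simp only [pdMat, Matrix.sum_apply, Matrix.of_apply, Matrix.smul_apply, smul_eq_mul]
  exact pd_comp (differentiableAt_of_smooth (hA i j)) (hφ.differentiableAt (by simp)) k

lemma pdMat_jac_comm {φ : E3 → E3} {y : E3} (hφ : ContDiffAt ℝ ∞ φ y) (k i m : Fin 3) :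
    pdMat k (jac φ) y m i = pdMat i (jac φ) y m k :=
  pd_comm (contDiffAt_coord hφ m) k i

lemma pdMat_pdMat_comm {A : MatField} {y : E3} (hA : SmoothMat A y) (i k : Fin 3) :
    pdMat k (pdMat i A) y = pdMat i (pdMat k A) y := by
  ext a b; exact pd_comm (hA a b) k i

/-! ### The Levi-Civita connection in matrix form and its change of coordinates -/

/-- The connection matrix `(Γ_k)^a_c = Γ^a_kc`. -/
def connMat (G : MatField) (k : Fin 3) : MatField := fun y =>
  Matrix.of fun a c => christoffel G a k c y

/-- The curvature matrix `∂_k Γ_j - ∂_j Γ_k + [Γ_k, Γ_j]` of a family of connection matrices. -/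
def curvMat (A : Fin 3 → MatField) (k j : Fin 3) (y : E3) : Matrix (Fin 3) (Fin 3) ℝ :=
  pdMat k (A j) y - pdMat j (A k) y + (A k y * A j y - A j y * A k y)

lemma connMat_smooth {G : MatField} {y : E3} (hG : SmoothMat G y) (hdet : (G y).det ≠ 0)
    (k : Fin 3) : SmoothMat (connMat G k) y := fun a c => by
  have h (p q r) : ContDiffAt ℝ ∞ (fun z => pd p (fun w => G w q r) z) y := pd_contDiffAt (hG q r) p
  exact contDiffAt_const.mul (ContDiffAt.sum fun l _ => (hG.inv hdet a l).mul
    (((h _ _ _).add (h _ _ _)).sub (h _ _ _)))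

lemma christoffel_symm {G : MatField} (hG : ∀ z, (G z).IsSymm) (k i j : Fin 3) (y : E3) :
    christoffel G k i j y = christoffel G k j i y := by
  have : (fun z => G z i j) = fun z => G z j i := funext fun z => (hG z).apply j i
  simp only [christoffel, this]
  congr 1; refine Finset.sum_congr rfl fun l _ => ?_
  ring

lemma christoffel_congr {G H : MatField} {y : E3} (h : G =ᶠ[𝓝 y] H) (k i j : Fin 3) :
    christoffel G k i j y = christoffel H k i j y := by
  have hp (p q r) : pd p (fun w => G w q r) y = pd p (fun w => H w q r) y :=
    pd_congr (h.mono fun z hz => by simp only [hz]) p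
  simp only [christoffel, hp, h.eq_of_nhds]

lemma connMat_eventuallyEq {G H : MatField} {y : E3} (h : G =ᶠ[𝓝 y] H) (k : Fin 3) :
    connMat G k =ᶠ[𝓝 y] connMat H k := by
  filter_upwards [h.eventuallyEq_nhds] with z hz
  ext a c; exact christoffel_congr hz a k c

/-- The lowered connection: `g_al Γ^l_kj = ½ (∂_k g_ja + ∂_j g_ka - ∂_a g_kj)`. -/
lemma mul_connMat {G : MatField} {y : E3} (hdet : (G y).det ≠ 0) (k a j : Fin 3) :
    (G y * connMat G k y) a j = (1 / 2) * (pd k (fun z => G z j a) y + pd j (fun z => G z k a) y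
      - pd a (fun z => G z k j) y) := by
  set C : Matrix (Fin 3) (Fin 3) ℝ := Matrix.of fun a j => (1 / 2) *
    (pd k (fun z => G z j a) y + pd j (fun z => G z k a) y - pd a (fun z => G z k j) y) with hC
  have h : connMat G k y = (G y)⁻¹ * C := by
    ext p q
    simp only [connMat, christoffel, Matrix.of_apply, Matrix.mul_apply, hC, Finset.mul_sum]
    exact Finset.sum_congr rfl fun l _ => by ring
  rw [h, Matrix.mul_nonsing_inv_cancel_left _ _ (isUnit_iff_ne_zero.2 hdet)]
  rfl

/-- Metric compatibility: `∂_k g = Γ_kᵀ g + g Γ_k`. -/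
lemma pdMat_metric {G : MatField} {y : E3} (hG : ∀ z, (G z).IsSymm) (hdet : (G y).det ≠ 0)
    (k : Fin 3) : pdMat k G y = (connMat G k y)ᵀ * G y + G y * connMat G k y := by
  have hs (i j : Fin 3) : (fun z => G z i j) = fun z => G z j i := funext fun z => (hG z).apply j i
  have ht : (connMat G k y)ᵀ * G y = (G y * connMat G k y)ᵀ := by
    rw [Matrix.transpose_mul, hG y]
  ext i j
  rw [ht, Matrix.add_apply, Matrix.transpose_apply, mul_connMat hdet, mul_connMat hdet, hs j i]
  simp only [pdMat, Matrix.of_apply]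
  ring

/-- A torsion-free connection compatible with the metric is the Levi-Civita connection. -/
lemma connMat_unique {G : MatField} {y : E3} (hG : ∀ z, (G z).IsSymm) (hdet : (G y).det ≠ 0)
    (A : Fin 3 → Matrix (Fin 3) (Fin 3) ℝ) (hA : ∀ k a c, A k a c = A c a k)
    (hc : ∀ k, pdMat k G y = (A k)ᵀ * G y + G y * A k) (k : Fin 3) : connMat G k y = A k := by
  have h : G y * connMat G k y = G y * A k := by
    have hp (k i j) : pd k (fun z => G z i j) y = (G y * A k) j i + (G y * A k) i j := by
      have := congrFun (congrFun (hc k) i) j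
      have ht : (A k)ᵀ * G y = (G y * A k)ᵀ := by
        rw [Matrix.transpose_mul, hG y]
      rw [ht] at this
      exact this
    have hB (k a c) : (G y * A k) a c = (G y * A c) a k := by
      simp only [Matrix.mul_apply]
      exact Finset.sum_congr rfl fun l _ => by rw [hA]
    ext a j
    rw [mul_connMat hdet, hp, hp, hp, hB j a k, hB k j a, hB a k j, hB j k a]
    ring
  have h2 := congrArg (fun X => (G y)⁻¹ * X) h
  simpa only [Matrix.nonsing_inv_mul_cancel_left _ _ (isUnit_iff_ne_zero.2 hdet)] using h2

/-- `IsTransition φ G H y`: near `y`, the smooth local change of coordinates `φ` pulls back the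
metric components `G` to the metric components `H`. -/
structure IsTransition (φ : E3 → E3) (G H : MatField) (y : E3) : Prop where
  smooth : ContDiffAt ℝ ∞ φ y
  det_jac : (jac φ y).det ≠ 0
  smooth_metric : SmoothMat G (φ y)
  det_metric : (G (φ y)).det ≠ 0
  symm : ∀ z, (G z).IsSymm
  symm' : ∀ z, (H z).IsSymm
  pullback : H =ᶠ[𝓝 y] fun z => (jac φ z)ᵀ * G (φ z) * jac φ z

namespace IsTransition

variable {φ : E3 → E3} {G H : MatField} {y : E3}

lemma det_ne (h : IsTransition φ G H y) : (H y).det ≠ 0 := by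
  rw [h.pullback.eq_of_nhds]
  simp [h.det_jac, h.det_metric]

lemma smooth_pullback (h : IsTransition φ G H y) : SmoothMat H y :=
  (((smoothMat_jac h.smooth).transpose.mul (h.smooth_metric.comp h.smooth)).mul
    (smoothMat_jac h.smooth)).congr h.pullback

/-- The pulled-back connection matrix `Σ_a J^a_i Γ_a ∘ φ`. -/
def pullConn (φ : E3 → E3) (G : MatField) (i : Fin 3) : MatField := fun z =>
  ∑ a, jac φ z a i • connMat G a (φ z)

lemma smooth_pullConn (h : IsTransition φ G H y) (i : Fin 3) : SmoothMat (pullConn φ G i) y :=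
  SmoothMat.sum fun a => SmoothMat.smul (smoothMat_jac h.smooth a i)
    ((connMat_smooth h.smooth_metric h.det_metric a).comp h.smooth)

/-- The transformation law of the Christoffel symbols:
`J Γ'_i = ∂_i J + (Σ_a J^a_i Γ_a) J`. -/
lemma connMat_law (h : IsTransition φ G H y) (i : Fin 3) :
    jac φ y * connMat H i y = pdMat i (jac φ) y + pullConn φ G i y * jac φ y := by
  have hJ : IsUnit (jac φ y).det := isUnit_iff_ne_zero.2 h.det_jac
  have hsJ := smoothMat_jac h.smooth
  have hsG := h.smooth_metric.comp h.smooth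
  have key := connMat_unique h.symm' h.det_ne
    (fun i => (jac φ y)⁻¹ * (pdMat i (jac φ) y + pullConn φ G i y * jac φ y)) ?_ ?_ i
  · rw [key, Matrix.mul_nonsing_inv_cancel_left _ _ hJ]
  · intro k a c
    simp only [Matrix.mul_apply (M := (jac φ y)⁻¹)]
    refine Finset.sum_congr rfl fun m _ => ?_
    congr 1
    simp only [Matrix.add_apply, pdMat_jac_comm h.smooth k c m]
    congr 1
    simp only [pullConn, Matrix.mul_apply, Matrix.sum_apply, Matrix.smul_apply, smul_eq_mul,
      Finset.sum_mul]
    rw [Finset.sum_comm]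
    refine Finset.sum_congr rfl fun p _ => Finset.sum_congr rfl fun q _ => ?_
    have : connMat G q (φ y) m p = connMat G p (φ y) m q := christoffel_symm h.symm m q p _
    rw [this]; ring
  · intro k
    rw [pdMat_congr h.pullback, pdMat_mul (hsJ.transpose.mul hsG) hsJ, pdMat_mul hsJ.transpose hsG,
      pdMat_transpose, pdMat_comp h.smooth_metric h.smooth, h.pullback.eq_of_nhds]
    have hc : ∑ m, jac φ y m k • pdMat m G (φ y) =
        (pullConn φ G k y)ᵀ * G (φ y) + G (φ y) * pullConn φ G k y := by
      simp only [pullConn, Matrix.transpose_sum, Matrix.transpose_smul, Finset.sum_mul,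
        Finset.mul_sum, ← Finset.sum_add_distrib, Matrix.smul_mul, Matrix.mul_smul, ← smul_add]
      exact Finset.sum_congr rfl fun m _ => by rw [pdMat_metric h.symm h.det_metric]
    have h1 : ∀ X : Matrix (Fin 3) (Fin 3) ℝ, jac φ y * ((jac φ y)⁻¹ * X) = X := fun X =>
      Matrix.mul_nonsing_inv_cancel_left _ _ hJ
    have h2 : ∀ X : Matrix (Fin 3) (Fin 3) ℝ,
        ((jac φ y)⁻¹ * X)ᵀ * (jac φ y)ᵀ = Xᵀ := fun X => by
      rw [← Matrix.transpose_mul, h1]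
    rw [hc]
    simp only [← Matrix.mul_assoc, h2]
    simp only [Matrix.mul_assoc, h1]
    simp only [Matrix.transpose_add, Matrix.transpose_mul]
    noncomm_ring

/-- The transformation law of the curvature, obtained by differentiating `connMat_law` and using the
symmetry of the second derivatives of `J`. -/
lemma curvMat_law (h : ∀ᶠ z in 𝓝 y, IsTransition φ G H z) (k i : Fin 3) :
    jac φ y * curvMat (connMat H) k i y =
      (∑ b, ∑ a, (jac φ y b k * jac φ y a i) • curvMat (connMat G) b a (φ y)) * jac φ y := by
  have h0 := h.self_of_nhds
  have hsJ := smoothMat_jac h0.smooth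
  have hW := h0.smooth_pullConn
  have hX := connMat_smooth h0.smooth_pullback h0.det_ne
  have hcomm (i k : Fin 3) := pdMat_pdMat_comm hsJ i k
  have hd (k i : Fin 3) : pdMat k (jac φ) y * connMat H i y + jac φ y * pdMat k (connMat H i) y =
      pdMat k (pdMat i (jac φ)) y + (pdMat k (pullConn φ G i) y * jac φ y +
        pullConn φ G i y * pdMat k (jac φ) y) := by
    rw [← pdMat_mul hsJ (hX i), ← pdMat_mul (hW i) hsJ, ← pdMat_add (hsJ.pdMat i) ((hW i).mul hsJ)]
    exact pdMat_congr (h.mono fun z hz => hz.connMat_law i) k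
  have hl (k : Fin 3) : pdMat k (jac φ) y =
      jac φ y * connMat H k y - pullConn φ G k y * jac φ y := by
    rw [h0.connMat_law k]; abel
  have hWd (k i : Fin 3) : pdMat k (pullConn φ G i) y =
      ∑ a, (pdMat k (jac φ) y a i • connMat G a (φ y) +
        jac φ y a i • ∑ b, jac φ y b k • pdMat b (connMat G a) (φ y)) := by
    have hc (a) := (connMat_smooth h0.smooth_metric h0.det_metric a)
    unfold pullConn
    rw [pdMat_sum fun a => SmoothMat.smul (hsJ a i) ((hc a).comp h0.smooth)]
    refine Finset.sum_congr rfl fun a _ => ?_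
    rw [pdMat_smul (hsJ a i) ((hc a).comp h0.smooth), pdMat_comp (hc a) h0.smooth]
    rfl
  have hcurv : curvMat (pullConn φ G) k i y =
      ∑ b, ∑ a, (jac φ y b k * jac φ y a i) • curvMat (connMat G) b a (φ y) := by
    have e1 : pdMat k (pullConn φ G i) y - pdMat i (pullConn φ G k) y =
        ∑ b, ∑ a, (jac φ y b k * jac φ y a i) •
          (pdMat b (connMat G a) (φ y) - pdMat a (connMat G b) (φ y)) := by
      rw [hWd, hWd, Finset.sum_add_distrib, Finset.sum_add_distrib]
      simp only [pdMat_jac_comm h0.smooth k i]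
      rw [add_sub_add_left_eq_sub]
      simp only [smul_sub, Finset.sum_sub_distrib, Finset.smul_sum, smul_smul]
      rw [Finset.sum_comm]
      congr 1
      · exact Finset.sum_congr rfl fun a _ => Finset.sum_congr rfl fun b _ => by rw [mul_comm]
    have e2 (k i : Fin 3) : pullConn φ G k y * pullConn φ G i y =
        ∑ b, ∑ a, (jac φ y b k * jac φ y a i) • (connMat G b (φ y) * connMat G a (φ y)) := by
      simp only [pullConn, Finset.sum_mul_sum, Matrix.smul_mul, Matrix.mul_smul, smul_smul,
        mul_comm]
    rw [curvMat, e1, e2 k i, e2 i k, Finset.sum_comm (f := fun b a =>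
      (jac φ y b i * jac φ y a k) • (connMat G b (φ y) * connMat G a (φ y)))]
    simp only [← Finset.sum_sub_distrib, ← Finset.sum_add_distrib]
    refine Finset.sum_congr rfl fun b _ => Finset.sum_congr rfl fun a _ => ?_
    rw [curvMat, mul_comm (jac φ y a i), ← smul_sub, ← smul_add]
  rw [← hcurv]
  have a1 := hd k i
  have a2 := hd i k
  rw [hcomm k i] at a2
  have a3 : jac φ y * pdMat k (connMat H i) y - jac φ y * pdMat i (connMat H k) y =
      (pdMat k (pullConn φ G i) y * jac φ y + pullConn φ G i y * pdMat k (jac φ) y)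
      - (pdMat i (pullConn φ G k) y * jac φ y + pullConn φ G k y * pdMat i (jac φ) y)
      - pdMat k (jac φ) y * connMat H i y + pdMat i (jac φ) y * connMat H k y := by
    rw [eq_sub_of_add_eq' a1, eq_sub_of_add_eq' a2]; abel
  simp only [curvMat, mul_add, mul_sub, add_mul, sub_mul]
  rw [a3, hl k, hl i]
  noncomm_ring

end IsTransition

lemma ricci_eq_curvMat {G : MatField} (hG : ∀ z, (G z).IsSymm) (i j : Fin 3) (y : E3) :
    ricci G i j y = ∑ k, curvMat (connMat G) k j y k i := by
  have h1 (k : Fin 3) : christoffel G k i j = christoffel G k j i :=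
    funext fun z => christoffel_symm hG k i j z
  have h2 (k : Fin 3) : christoffel G k i k = christoffel G k k i :=
    funext fun z => christoffel_symm hG k i k z
  refine Finset.sum_congr rfl fun k _ => ?_
  simp only [curvMat, connMat, pdMat, Matrix.add_apply, Matrix.sub_apply, Matrix.mul_apply,
    Matrix.of_apply, h1, h2, Finset.sum_sub_distrib]
  congr 2
  exact Finset.sum_congr rfl fun l _ => by rw [christoffel_symm hG l i k]

namespace IsTransition

variable {φ : E3 → E3} {G H : MatField} {y : E3}

lemma inv_law (h : IsTransition φ G H y) :
    (H y)⁻¹ = (jac φ y)⁻¹ * (G (φ y))⁻¹ * ((jac φ y)⁻¹)ᵀ := by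
  rw [h.pullback.eq_of_nhds, Matrix.mul_inv_rev, Matrix.mul_inv_rev, Matrix.transpose_nonsing_inv,
    Matrix.mul_assoc]

lemma ricci_law (h : ∀ᶠ z in 𝓝 y, IsTransition φ G H z) :
    (Matrix.of fun i j => ricci H i j y) =
      (jac φ y)ᵀ * (Matrix.of fun i j => ricci G i j (φ y)) * jac φ y := by
  have h0 := h.self_of_nhds
  have hJ : IsUnit (jac φ y).det := isUnit_iff_ne_zero.2 h0.det_jac
  have hc (k j : Fin 3) : curvMat (connMat H) k j y = ∑ b, ∑ a, (jac φ y b k * jac φ y a j) •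
      ((jac φ y)⁻¹ * curvMat (connMat G) b a (φ y) * jac φ y) := by
    have := congrArg (fun X => (jac φ y)⁻¹ * X) (curvMat_law h k j)
    simp only [Matrix.nonsing_inv_mul_cancel_left _ _ hJ] at this
    rw [this]
    simp only [Finset.sum_mul, Finset.mul_sum, Matrix.smul_mul, Matrix.mul_smul, Matrix.mul_assoc]
  ext i j
  rw [Matrix.of_apply, ricci_eq_curvMat h0.symm']
  have hb (b a : Fin 3) : ∑ k, jac φ y b k *
      ((jac φ y)⁻¹ * curvMat (connMat G) b a (φ y) * jac φ y) k i =
      ∑ c, curvMat (connMat G) b a (φ y) b c * jac φ y c i := by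
    rw [← Matrix.mul_apply, ← Matrix.mul_apply, Matrix.mul_assoc,
      Matrix.mul_nonsing_inv_cancel_left _ _ hJ]
  calc ∑ k, curvMat (connMat H) k j y k i
      = ∑ a, jac φ y a j * ∑ b, ∑ k, jac φ y b k *
          ((jac φ y)⁻¹ * curvMat (connMat G) b a (φ y) * jac φ y) k i := by
        simp only [hc, Matrix.sum_apply, Matrix.smul_apply, smul_eq_mul, Finset.mul_sum]
        rw [Finset.sum_comm]
        conv_rhs => rw [Finset.sum_comm]
        refine Finset.sum_congr rfl fun b _ => ?_
        rw [Finset.sum_comm]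
        refine Finset.sum_congr rfl fun a _ => Finset.sum_congr rfl fun k _ => by ring
    _ = _ := by
        simp only [hb]
        simp only [Matrix.mul_apply, Matrix.transpose_apply, Matrix.of_apply,
          ricci_eq_curvMat h0.symm, Finset.sum_mul, Finset.mul_sum]
        refine Finset.sum_congr rfl fun a _ => ?_
        rw [Finset.sum_comm]
        refine Finset.sum_congr rfl fun b _ => Finset.sum_congr rfl fun k _ => by ring

/-- The scalar curvature does not depend on the coordinates. -/
lemma scalarCurv_eq (h : ∀ᶠ z in 𝓝 y, IsTransition φ G H z) :
    scalarCurv H y = scalarCurv G (φ y) := by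
  have h0 := h.self_of_nhds
  have hJ : IsUnit (jac φ y).det := isUnit_iff_ne_zero.2 h0.det_jac
  have htr (K : MatField) (z : E3) :
      scalarCurv K z = ((K z)⁻¹ * (Matrix.of fun i j => ricci K i j z)ᵀ).trace := by
    simp only [scalarCurv, Matrix.trace, Matrix.diag, Matrix.mul_apply, Matrix.transpose_apply,
      Matrix.of_apply]
  rw [htr, htr, ricci_law h, h0.inv_law]
  simp only [Matrix.transpose_mul, Matrix.transpose_transpose]
  have e : ((jac φ y)⁻¹)ᵀ * (jac φ y)ᵀ = 1 := by
    rw [← Matrix.transpose_mul, Matrix.mul_nonsing_inv _ hJ, Matrix.transpose_one]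
  rw [Matrix.mul_assoc, ← Matrix.mul_assoc ((jac φ y)⁻¹)ᵀ, e, Matrix.one_mul, Matrix.mul_assoc,
    Matrix.trace_mul_comm, Matrix.mul_assoc, Matrix.mul_assoc, Matrix.mul_nonsing_inv _ hJ,
    Matrix.mul_one]

end IsTransition

/-! ### Covariance of the momentum constraint and of the algebraic invariants -/

lemma raised_eq_mul {G P : MatField} (hG : ∀ z, (G z).IsSymm) (y : E3) :
    (Matrix.of fun a b => raised G P a b y) = (G y)⁻¹ * P y * (G y)⁻¹ := by
  ext a b
  have hs (b d) : (G y)⁻¹ b d = (G y)⁻¹ d b := (hG y).inv.apply d b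
  simp only [raised, Matrix.of_apply, Matrix.mul_apply, Finset.sum_mul]
  rw [Finset.sum_comm]
  exact Finset.sum_congr rfl fun c _ => Finset.sum_congr rfl fun d _ => by rw [hs b c]; ring

lemma trLocal_eq_trace {G P : MatField} (hP : ∀ z, (P z).IsSymm) (y : E3) :
    trLocal G P y = ((G y)⁻¹ * P y).trace := by
  simp only [trLocal, Matrix.trace, Matrix.diag, Matrix.mul_apply]
  exact Finset.sum_congr rfl fun c _ => Finset.sum_congr rfl fun d _ => by rw [(hP y).apply c d]

lemma sqLocal_eq_trace {G P : MatField} (hG : ∀ z, (G z).IsSymm) (hP : ∀ z, (P z).IsSymm) (y : E3) :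
    sqLocal G P y = ((G y)⁻¹ * P y * ((G y)⁻¹ * P y)).trace := by
  have : sqLocal G P y = (P y * (Matrix.of fun a b => raised G P a b y)ᵀ).trace := by
    simp only [sqLocal, Matrix.trace, Matrix.diag, Matrix.mul_apply, Matrix.transpose_apply,
      Matrix.of_apply]
  rw [this, raised_eq_mul hG]
  simp only [Matrix.transpose_mul, (hG y).inv.eq, (hP y).eq]
  rw [Matrix.trace_mul_comm]
  simp only [Matrix.mul_assoc]

/-- The contravariant tensor `p^ab - p g^ab` as a matrix field. -/
def momentumMat (G P : MatField) : MatField := fun y =>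
  Matrix.of fun a b => momentumTensor G P a b y

lemma momentumMat_eq {G P : MatField} (hG : ∀ z, (G z).IsSymm) (hP : ∀ z, (P z).IsSymm) (y : E3) :
    momentumMat G P y = (G y)⁻¹ * P y * (G y)⁻¹ - ((G y)⁻¹ * P y).trace • (G y)⁻¹ := by
  rw [← raised_eq_mul hG, ← trLocal_eq_trace hP]
  rfl

lemma momentumMat_smooth {G P : MatField} {y : E3} (hG : SmoothMat G y) (hdet : (G y).det ≠ 0)
    (hP : SmoothMat P y) : SmoothMat (momentumMat G P) y := fun a b => by
  have hi := hG.inv hdet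
  exact (ContDiffAt.sum fun c _ => ContDiffAt.sum fun d _ =>
    ((hi a c).mul (hi b d)).mul (hP c d)).sub
    ((ContDiffAt.sum fun c _ => ContDiffAt.sum fun d _ => (hi c d).mul (hP c d)).mul (hi a b))

/-- The covariant derivative `∂_k T + Γ_k T + T Γ_kᵀ` of a contravariant 2-tensor. -/
def covDeriv (G T : MatField) (k : Fin 3) (y : E3) : Matrix (Fin 3) (Fin 3) ℝ :=
  pdMat k T y + connMat G k y * T y + T y * (connMat G k y)ᵀ

lemma divMomentum_eq (G P : MatField) (a : Fin 3) (y : E3) :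
    divMomentum G P a y = ∑ b, covDeriv G (momentumMat G P) b y a b := by
  simp only [divMomentum, covDeriv, Matrix.add_apply, Matrix.mul_apply, Matrix.transpose_apply,
    Finset.sum_add_distrib, connMat, momentumMat, Matrix.of_apply, pdMat]
  rw [← add_assoc]
  congr 1
  exact Finset.sum_congr rfl fun b _ => Finset.sum_congr rfl fun c _ => mul_comm _ _

lemma covDeriv_congr {G G' T T' : MatField} {y : E3} (hG : G =ᶠ[𝓝 y] G') (hT : T =ᶠ[𝓝 y] T')
    (k : Fin 3) : covDeriv G T k y = covDeriv G' T' k y := by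
  rw [covDeriv, covDeriv, pdMat_congr hT, hT.eq_of_nhds, (connMat_eventuallyEq hG k).eq_of_nhds]

lemma covDeriv_metric_inv {G : MatField} {y : E3} (hG : ∀ z, (G z).IsSymm)
    (hsm : SmoothMat G y) (hdet : (G y).det ≠ 0) (k : Fin 3) :
    covDeriv G (fun z => (G z)⁻¹) k y = 0 := by
  have hu := isUnit_iff_ne_zero.2 hdet
  have hev : (fun z => G z * (G z)⁻¹) =ᶠ[𝓝 y] fun _ => 1 := by
    filter_upwards [hsm.det.continuousAt.eventually_ne hdet] with z hz
    exact Matrix.mul_nonsing_inv _ (isUnit_iff_ne_zero.2 hz)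
  have h1 : pdMat k (fun _ : E3 => (1 : Matrix (Fin 3) (Fin 3) ℝ)) y = 0 := by
    ext i j; simp [pdMat, pd]
  have h2 := pdMat_mul hsm (hsm.inv hdet) k
  rw [pdMat_congr hev, h1, pdMat_metric hG hdet] at h2
  have h3 := congrArg (fun X => (G y)⁻¹ * X) h2
  simp only [mul_add, add_mul, Matrix.mul_assoc, Matrix.mul_nonsing_inv _ hu, Matrix.mul_one,
    Matrix.nonsing_inv_mul_cancel_left _ _ hu, mul_zero] at h3
  rw [covDeriv, h3]
  abel

namespace IsTransition

variable {φ : E3 → E3} {G H : MatField} {y : E3}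

/-- The covariant derivative of a contravariant 2-tensor is a tensor. -/
lemma covDeriv_law (h : IsTransition φ G H y) {T T' : MatField} (hT' : SmoothMat T' y)
    (hT : SmoothMat T (φ y)) (hTT : (fun z => T (φ z)) =ᶠ[𝓝 y] fun z => jac φ z * T' z * (jac φ z)ᵀ)
    (k : Fin 3) :
    ∑ m, jac φ y m k • covDeriv G T m (φ y) = jac φ y * covDeriv H T' k y * (jac φ y)ᵀ := by
  have hJ := smoothMat_jac h.smooth
  have e1 : ∑ m, jac φ y m k • covDeriv G T m (φ y) = pdMat k (fun z => T (φ z)) y +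
      pullConn φ G k y * T (φ y) + T (φ y) * (pullConn φ G k y)ᵀ := by
    rw [pdMat_comp hT h.smooth]
    simp only [covDeriv, pullConn, smul_add, Finset.sum_add_distrib, Finset.sum_mul,
      Matrix.transpose_sum, Finset.mul_sum, Matrix.transpose_smul, Matrix.smul_mul, Matrix.mul_smul]
  have hl : pdMat k (jac φ) y = jac φ y * connMat H k y - pullConn φ G k y * jac φ y := by
    rw [h.connMat_law k]; abel
  have e2 : T (φ y) = _ := hTT.eq_of_nhds
  rw [e1, pdMat_congr hTT, pdMat_mul (hJ.mul hT') hJ.transpose, pdMat_mul hJ hT', pdMat_transpose,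
    hl, e2, covDeriv]
  simp only [Matrix.transpose_sub, Matrix.transpose_mul]
  noncomm_ring

lemma inv_comp (h : IsTransition φ G H y) :
    (G (φ y))⁻¹ = jac φ y * (H y)⁻¹ * (jac φ y)ᵀ := by
  have hJ : IsUnit (jac φ y).det := isUnit_iff_ne_zero.2 h.det_jac
  have e : ((jac φ y)⁻¹)ᵀ * (jac φ y)ᵀ = 1 := by
    rw [← Matrix.transpose_mul, Matrix.mul_nonsing_inv _ hJ, Matrix.transpose_one]
  rw [h.inv_law]
  simp only [Matrix.mul_assoc, e, Matrix.mul_one, Matrix.mul_nonsing_inv_cancel_left _ _ hJ]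

lemma inv_mul_law (h : IsTransition φ G H y) {P P' : MatField}
    (hpull : P' y = (jac φ y)ᵀ * P (φ y) * jac φ y) :
    (H y)⁻¹ * P' y = (jac φ y)⁻¹ * ((G (φ y))⁻¹ * P (φ y)) * jac φ y := by
  have hJ : IsUnit (jac φ y).det := isUnit_iff_ne_zero.2 h.det_jac
  have e (X : Matrix (Fin 3) (Fin 3) ℝ) : ((jac φ y)⁻¹)ᵀ * ((jac φ y)ᵀ * X) = X := by
    rw [← Matrix.mul_assoc, ← Matrix.transpose_mul, Matrix.mul_nonsing_inv _ hJ,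
      Matrix.transpose_one, Matrix.one_mul]
  rw [hpull, h.inv_law]
  simp only [Matrix.mul_assoc, e]

lemma trace_inv_mul (h : IsTransition φ G H y) {P P' : MatField}
    (hpull : P' y = (jac φ y)ᵀ * P (φ y) * jac φ y) :
    ((H y)⁻¹ * P' y).trace = ((G (φ y))⁻¹ * P (φ y)).trace := by
  have hJ : IsUnit (jac φ y).det := isUnit_iff_ne_zero.2 h.det_jac
  rw [h.inv_mul_law hpull, Matrix.mul_assoc, Matrix.trace_mul_comm, Matrix.mul_assoc,
    Matrix.mul_nonsing_inv _ hJ, Matrix.mul_one]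

lemma trLocal_eq (h : IsTransition φ G H y) {P P' : MatField} (hP : ∀ z, (P z).IsSymm)
    (hP' : ∀ z, (P' z).IsSymm) (hpull : P' y = (jac φ y)ᵀ * P (φ y) * jac φ y) :
    trLocal H P' y = trLocal G P (φ y) := by
  rw [trLocal_eq_trace hP, trLocal_eq_trace hP', h.trace_inv_mul hpull]

lemma sqLocal_eq (h : IsTransition φ G H y) {P P' : MatField} (hP : ∀ z, (P z).IsSymm)
    (hP' : ∀ z, (P' z).IsSymm) (hpull : P' y = (jac φ y)ᵀ * P (φ y) * jac φ y) :
    sqLocal H P' y = sqLocal G P (φ y) := by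
  have hJ : IsUnit (jac φ y).det := isUnit_iff_ne_zero.2 h.det_jac
  rw [sqLocal_eq_trace h.symm hP, sqLocal_eq_trace h.symm' hP', h.inv_mul_law hpull]
  simp only [Matrix.mul_assoc, Matrix.mul_nonsing_inv_cancel_left _ _ hJ]
  rw [Matrix.trace_mul_comm]
  simp only [Matrix.mul_assoc, Matrix.mul_nonsing_inv _ hJ, Matrix.mul_one]

lemma momentumMat_law (h : IsTransition φ G H y) {P P' : MatField} (hP : ∀ z, (P z).IsSymm)
    (hP' : ∀ z, (P' z).IsSymm) (hpull : P' y = (jac φ y)ᵀ * P (φ y) * jac φ y) :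
    momentumMat G P (φ y) = jac φ y * momentumMat H P' y * (jac φ y)ᵀ := by
  have hJ : IsUnit (jac φ y).det := isUnit_iff_ne_zero.2 h.det_jac
  rw [momentumMat_eq h.symm hP, momentumMat_eq h.symm' hP', h.trace_inv_mul hpull,
    h.inv_mul_law hpull, mul_sub, sub_mul, Matrix.mul_smul, Matrix.smul_mul, ← h.inv_comp]
  congr 1
  conv_lhs => rw [h.inv_comp]
  have e : (jac φ y)⁻¹ * ((G (φ y))⁻¹ * P (φ y)) * jac φ y =
      (jac φ y)⁻¹ * (jac φ y * (H y)⁻¹ * (jac φ y)ᵀ * P (φ y)) * jac φ y := by rw [← h.inv_comp]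
  rw [e]
  simp only [Matrix.mul_assoc, Matrix.mul_nonsing_inv_cancel_left _ _ hJ]

/-- The divergence of the momentum tensor is a vector field. -/
lemma divMomentum_law {P P' : MatField} (hP : ∀ z, (P z).IsSymm)
    (hP' : ∀ z, (P' z).IsSymm) (hsP : SmoothMat P (φ y)) (h : ∀ᶠ z in 𝓝 y, IsTransition φ G H z)
    (hpull : P' =ᶠ[𝓝 y] fun z => (jac φ z)ᵀ * P (φ z) * jac φ z) (a : Fin 3) :
    divMomentum G P a (φ y) = ∑ c, jac φ y a c * divMomentum H P' c y := by
  have h0 := h.self_of_nhds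
  have hJ : IsUnit (jac φ y).det := isUnit_iff_ne_zero.2 h0.det_jac
  have hsJ := smoothMat_jac h0.smooth
  have hsP' : SmoothMat P' y :=
    ((hsJ.transpose.mul (hsP.comp h0.smooth)).mul hsJ).congr hpull
  have key := h0.covDeriv_law (momentumMat_smooth h0.smooth_pullback h0.det_ne hsP')
    (momentumMat_smooth h0.smooth_metric h0.det_metric hsP)
    (by filter_upwards [h, hpull] with z hz hz' using hz.momentumMat_law hP hP' hz')
  set C := fun m => covDeriv G (momentumMat G P) m (φ y)
  set D := fun k => covDeriv H (momentumMat H P') k y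
  -- contract the law for `∇_m T^ab` with the inverse Jacobian
  have hC (b : Fin 3) : C b a b = ∑ k, (jac φ y)⁻¹ k b * (jac φ y * D k * (jac φ y)ᵀ) a b := by
    have : ∀ k, (jac φ y * D k * (jac φ y)ᵀ) a b = ∑ m, jac φ y m k * C m a b := fun k => by
      rw [← key k]; simp only [Matrix.sum_apply, Matrix.smul_apply, smul_eq_mul, C]
    simp only [this, Finset.mul_sum]
    rw [Finset.sum_comm]
    have hm (m : Fin 3) : ∑ k, (jac φ y)⁻¹ k b * (jac φ y m k * C m a b) =
        (jac φ y * (jac φ y)⁻¹) m b * C m a b := by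
      rw [Matrix.mul_apply, Finset.sum_mul]
      exact Finset.sum_congr rfl fun k _ => by ring
    simp only [hm, Matrix.mul_nonsing_inv _ hJ, Matrix.one_apply, ite_mul, one_mul, zero_mul,
      Finset.sum_ite_eq', Finset.mem_univ, if_true]
  rw [divMomentum_eq]
  calc ∑ b, C b a b = ∑ k, ∑ b, (jac φ y * D k * (jac φ y)ᵀ) a b * ((jac φ y)⁻¹)ᵀ b k := by
        simp only [hC]
        rw [Finset.sum_comm]
        exact Finset.sum_congr rfl fun k _ => Finset.sum_congr rfl fun b _ => mul_comm _ _
    _ = ∑ k, (jac φ y * D k) a k := by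
        refine Finset.sum_congr rfl fun k _ => ?_
        rw [← Matrix.mul_apply, Matrix.mul_assoc, ← Matrix.transpose_mul,
          Matrix.nonsing_inv_mul _ hJ, Matrix.transpose_one, Matrix.mul_one]
    _ = _ := by
        simp only [Matrix.mul_apply, divMomentum_eq, Finset.mul_sum]
        rw [Finset.sum_comm]

end IsTransition

/-! ### Rotationally symmetric data on `ℝ³` -/

/-- Half the squared radius, `s = |y|²/2`; its differential is `Σ y_a dy_a`. -/
def halfSq (y : E3) : ℝ := ‖y‖ ^ 2 / 2

lemma halfSq_eq (y : E3) : halfSq y = (y 0 ^ 2 + y 1 ^ 2 + y 2 ^ 2) / 2 := by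
  simp [halfSq, EuclideanSpace.norm_sq_eq, Fin.sum_univ_three]

lemma halfSq_contDiff : ContDiff ℝ ∞ halfSq := by
  unfold halfSq; exact (contDiff_norm_sq ℝ).div_const _

lemma contDiffAt_comp_halfSq {f : ℝ → ℝ} {y : E3} (hf : ContDiffAt ℝ ∞ f (halfSq y)) :
    ContDiffAt ℝ ∞ (fun z => f (halfSq z)) y := hf.comp y halfSq_contDiff.contDiffAt

lemma contDiffAt_coordinate (a : Fin 3) (y : E3) : ContDiffAt ℝ ∞ (fun z : E3 => z a) y :=
  contDiffAt_coord contDiffAt_id a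

lemma pd_halfSq (c : Fin 3) (y : E3) : pd c halfSq y = y c := by
  have h : halfSq = fun z : E3 => (1 / 2) * ∑ a, z a * z a := by
    funext z; rw [halfSq_eq, Fin.sum_univ_three]; ring
  have hd (a : Fin 3) : DifferentiableAt ℝ (fun z : E3 => z a) y :=
    differentiableAt_of_smooth (contDiffAt_coordinate a y)
  rw [h, pd_const_mul _ _ (DifferentiableAt.fun_sum fun a _ => (hd a).fun_mul (hd a)),
    pd_sum fun a _ => (hd a).fun_mul (hd a)]
  simp only [pd_mul (hd _) (hd _), pd_coord, Matrix.one_apply]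
  fin_cases c <;> simp [Fin.sum_univ_three] <;> ring

lemma pd_comp_halfSq {f : ℝ → ℝ} {f' : ℝ} {y : E3} (hf : HasDerivAt f f' (halfSq y)) (c : Fin 3) :
    pd c (fun z => f (halfSq z)) y = f' * y c := by
  have hs : DifferentiableAt ℝ halfSq y := differentiableAt_of_smooth halfSq_contDiff.contDiffAt
  have := (hf.comp_hasFDerivAt y hs.hasFDerivAt).fderiv
  rw [← pd_halfSq c y, pd, pd]
  change fderiv ℝ (f ∘ halfSq) y _ = _
  rw [this]; simp

/-- The rotationally symmetric matrix field `f(s) δ_ab + h(s) y_a y_b`. -/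
def radMat (f h : ℝ → ℝ) : MatField := fun y =>
  Matrix.of fun a b => f (halfSq y) * (1 : Matrix (Fin 3) (Fin 3) ℝ) a b + h (halfSq y) * (y a * y b)

lemma radMat_apply (f h : ℝ → ℝ) (y : E3) (a b : Fin 3) : radMat f h y a b =
    f (halfSq y) * (1 : Matrix (Fin 3) (Fin 3) ℝ) a b + h (halfSq y) * (y a * y b) := rfl

lemma one_matrix_comm (a b : Fin 3) : (1 : Matrix (Fin 3) (Fin 3) ℝ) a b =
    (1 : Matrix (Fin 3) (Fin 3) ℝ) b a := by
  by_cases h : a = b <;> simp [Matrix.one_apply, h, eq_comm]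

lemma radMat_isSymm (f h : ℝ → ℝ) (y : E3) : (radMat f h y).IsSymm := by
  ext a b
  rw [Matrix.transpose_apply, radMat_apply, radMat_apply, mul_comm (y a), one_matrix_comm]

lemma radMat_smooth {f h : ℝ → ℝ} {y : E3} (hf : ContDiffAt ℝ ∞ f (halfSq y))
    (hh : ContDiffAt ℝ ∞ h (halfSq y)) : SmoothMat (radMat f h) y := fun a b =>
  ((contDiffAt_comp_halfSq hf).mul contDiffAt_const).add
    ((contDiffAt_comp_halfSq hh).mul ((contDiffAt_coordinate a y).mul (contDiffAt_coordinate b y)))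

lemma pd_radMat {f h : ℝ → ℝ} {f' h' : ℝ} {y : E3} (hf : HasDerivAt f f' (halfSq y))
    (hh : HasDerivAt h h' (halfSq y)) (a b c : Fin 3) :
    pd c (fun z => radMat f h z a b) y = f' * y c * (1 : Matrix (Fin 3) (Fin 3) ℝ) a b
      + h' * y c * (y a * y b) + h (halfSq y) * ((1 : Matrix (Fin 3) (Fin 3) ℝ) a c * y b +
        y a * (1 : Matrix (Fin 3) (Fin 3) ℝ) b c) := by
  have hd (a : Fin 3) : DifferentiableAt ℝ (fun z : E3 => z a) y :=
    differentiableAt_of_smooth (contDiffAt_coordinate a y)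
  have hs : DifferentiableAt ℝ halfSq y := differentiableAt_of_smooth halfSq_contDiff.contDiffAt
  have hf2 : DifferentiableAt ℝ (fun z => f (halfSq z)) y := hf.differentiableAt.comp y hs
  have hh2 : DifferentiableAt ℝ (fun z => h (halfSq z)) y := hh.differentiableAt.comp y hs
  simp only [radMat_apply]
  rw [pd_add (hf2.fun_mul (differentiableAt_const _)) (hh2.fun_mul ((hd a).fun_mul (hd b))),
    pd_mul hf2 (differentiableAt_const _), pd_mul hh2 ((hd a).fun_mul (hd b)), pd_mul (hd a) (hd b),
    pd_comp_halfSq hf, pd_comp_halfSq hh, pd_coord, pd_coord]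
  simp [pd]
  ring

lemma radMat_mul (f h f₁ h₁ : ℝ → ℝ) (y : E3) : radMat f h y * radMat f₁ h₁ y =
    radMat (fun s => f s * f₁ s) (fun s => f s * h₁ s + h s * f₁ s + 2 * s * h s * h₁ s) y := by
  ext a b
  simp only [Matrix.mul_apply, Fin.sum_univ_three, radMat_apply, halfSq_eq]
  fin_cases a <;> fin_cases b <;> simp [Matrix.one_apply] <;> ring

lemma radMat_trace (f h : ℝ → ℝ) (y : E3) :
    (radMat f h y).trace = 3 * f (halfSq y) + 2 * halfSq y * h (halfSq y) := by
  simp only [Matrix.trace, Matrix.diag, Fin.sum_univ_three, radMat_apply, Matrix.one_apply_eq]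
  conv_rhs => enter [2, 1]; rw [halfSq_eq]
  ring

lemma radMat_sub_smul (f h f₁ h₁ : ℝ → ℝ) (c : ℝ) (y : E3) : radMat f h y - c • radMat f₁ h₁ y =
    radMat (fun s => f s - c * f₁ s) (fun s => h s - c * h₁ s) y := by
  ext a b
  simp only [Matrix.sub_apply, Matrix.smul_apply, radMat_apply, smul_eq_mul]
  ring

lemma radMat_one (y : E3) : radMat (fun _ => 1) (fun _ => 0) y = 1 := by
  ext a b; simp [radMat_apply]

/-- The coefficient `F = β/(1 - 2sβ)` of the metric `δ + F y yᵀ` whose inverse is `δ - β y yᵀ`. -/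
def metricCoeff (β : ℝ → ℝ) (s : ℝ) : ℝ := β s / (1 - 2 * s * β s)

/-- The rotationally symmetric metric with inverse `δ - β y yᵀ`. Its Hawking mass at radius
`r = |y|` is `β r³ / 2`. -/
def radMetric (β : ℝ → ℝ) : MatField := radMat (fun _ => 1) (metricCoeff β)

/-- The symmetric tensor with mixed components `b δ + b' y yᵀ` with respect to `radMetric β`. -/
def radTensor (β b : ℝ → ℝ) : MatField :=
  radMat b fun s => (b s * β s + deriv b s) / (1 - 2 * s * β s)

lemma radMetric_isSymm (β : ℝ → ℝ) (y : E3) : (radMetric β y).IsSymm := radMat_isSymm _ _ _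

lemma radTensor_isSymm (β b : ℝ → ℝ) (y : E3) : (radTensor β b y).IsSymm := radMat_isSymm _ _ _

/-- Conditions on the radial profiles `β` and `b` under which `radMetric β` is a smooth metric and
`radTensor β b` a smooth tensor off the origin. -/
structure IsProfile (β b : ℝ → ℝ) : Prop where
  smooth_metric : ∀ s, 0 < s → ContDiffAt ℝ ∞ β s
  smooth_tensor : ∀ s, 0 < s → ContDiffAt ℝ ∞ b s
  pos : ∀ s, 0 < s → 0 < 1 - 2 * s * β s

lemma deriv_smooth {f : ℝ → ℝ} {s : ℝ} (hf : ContDiffAt ℝ ∞ f s) : ContDiffAt ℝ ∞ (deriv f) s := by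
  have : deriv f = fun x => fderiv ℝ f x 1 := by ext; simp
  rw [this]
  exact (hf.fderiv_right (m := ∞) (by simp)).clm_apply contDiffAt_const

lemma hasDerivAt_of_smooth {f : ℝ → ℝ} {s : ℝ} (hf : ContDiffAt ℝ ∞ f s) :
    HasDerivAt f (deriv f s) s := (hf.differentiableAt (by simp)).hasDerivAt

namespace IsProfile

variable {β b : ℝ → ℝ} {y : E3}

lemma smooth_coeff (h : IsProfile β b) {s : ℝ} (hs : 0 < s) : ContDiffAt ℝ ∞ (metricCoeff β) s :=
  (h.smooth_metric s hs).div (contDiffAt_const.sub ((contDiffAt_const.mul contDiffAt_id).mul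
    (h.smooth_metric s hs))) (h.pos s hs).ne'

lemma smooth_radMetric (h : IsProfile β b) (hy : 0 < halfSq y) : SmoothMat (radMetric β) y :=
  radMat_smooth contDiffAt_const (h.smooth_coeff hy)

lemma smooth_radTensor (h : IsProfile β b) (hy : 0 < halfSq y) : SmoothMat (radTensor β b) y :=
  radMat_smooth (h.smooth_tensor _ hy) ((((h.smooth_tensor _ hy).mul (h.smooth_metric _ hy)).add
    (deriv_smooth (h.smooth_tensor _ hy))).div (contDiffAt_const.sub
      ((contDiffAt_const.mul contDiffAt_id).mul (h.smooth_metric _ hy))) (h.pos _ hy).ne')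

lemma radMetric_mul_inv (h : IsProfile β b) (hy : 0 < halfSq y) :
    radMetric β y * radMat (fun _ => 1) (fun s => -β s) y = 1 := by
  have hF : metricCoeff β (halfSq y) * (1 - 2 * halfSq y * β (halfSq y)) = β (halfSq y) :=
    div_mul_cancel₀ _ (h.pos _ hy).ne'
  rw [radMetric, radMat_mul, ← radMat_one y]
  ext a b
  simp only [radMat_apply]
  linear_combination (y a * y b) * hF

lemma inv_radMetric (h : IsProfile β b) (hy : 0 < halfSq y) :
    (radMetric β y)⁻¹ = radMat (fun _ => 1) (fun s => -β s) y :=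
  Matrix.inv_eq_right_inv (h.radMetric_mul_inv hy)

lemma eventually_pos (hy : 0 < halfSq y) : ∀ᶠ z in 𝓝 y, 0 < halfSq z :=
  halfSq_contDiff.continuous.continuousAt.eventually (lt_mem_nhds hy)

/-- The coefficient `α` in `Γ^k_ij = y_k (α y_i y_j + β δ_ij)`. -/
def connCoeff (β : ℝ → ℝ) (s : ℝ) : ℝ := (deriv β s + 2 * β s ^ 2) / (2 * (1 - 2 * s * β s))

lemma smooth_connCoeff (h : IsProfile β b) {s : ℝ} (hs : 0 < s) :
    ContDiffAt ℝ ∞ (connCoeff β) s :=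
  ((deriv_smooth (h.smooth_metric s hs)).add (contDiffAt_const.mul
    ((h.smooth_metric s hs).pow 2))).div (contDiffAt_const.mul (contDiffAt_const.sub
      ((contDiffAt_const.mul contDiffAt_id).mul (h.smooth_metric s hs))))
        (mul_ne_zero two_ne_zero (h.pos s hs).ne')

lemma christoffel_radMetric (h : IsProfile β b) (hy : 0 < halfSq y) (k i j : Fin 3) :
    christoffel (radMetric β) k i j y = y k * radMat β (connCoeff β) y i j := by
  have hp := (h.pos _ hy).ne'
  have hβ := hasDerivAt_of_smooth (h.smooth_metric _ hy)
  have hF : HasDerivAt (metricCoeff β)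
      ((deriv β (halfSq y) + 2 * β (halfSq y) ^ 2) / (1 - 2 * halfSq y * β (halfSq y)) ^ 2)
      (halfSq y) := by
    have h1 : HasDerivAt (fun s => 1 - 2 * s * β s)
        (-(2 * β (halfSq y) + 2 * halfSq y * deriv β (halfSq y))) (halfSq y) := by
      refine ((((hasDerivAt_id' (halfSq y)).const_mul 2).fun_mul hβ).const_sub 1).congr_deriv ?_
      simp
    refine (hβ.fun_div h1 hp).congr_deriv ?_
    ring
  have hp' (i j c : Fin 3) := pd_radMat (y := y) (hasDerivAt_const (halfSq y) (1 : ℝ)) hF i j c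
  rw [christoffel, h.inv_radMetric hy]
  have e (l : Fin 3) : pd i (fun z => radMetric β z j l) y + pd j (fun z => radMetric β z i l) y
      - pd l (fun z => radMetric β z i j) y = 2 * y l / (1 - 2 * halfSq y * β (halfSq y)) *
        radMat β (connCoeff β) y i j := by
    simp only [radMetric, hp']
    simp only [radMat_apply, connCoeff, metricCoeff]
    rw [one_matrix_comm j i, one_matrix_comm l i, one_matrix_comm l j]
    generalize 1 - 2 * halfSq y * β (halfSq y) = u at hp ⊢
    field_simp
    ring
  simp only [e]
  generalize radMat β (connCoeff β) y i j = X
  have e2 : ∑ l, radMat (fun _ => 1) (fun s => -β s) y k l * y l =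
      (1 - 2 * halfSq y * β (halfSq y)) * y k := by
    simp only [radMat_apply, Fin.sum_univ_three]
    rw [show 2 * halfSq y = y 0 ^ 2 + y 1 ^ 2 + y 2 ^ 2 by rw [halfSq_eq]; ring]
    fin_cases k <;> simp [Matrix.one_apply] <;> ring
  calc _ = (1 / (1 - 2 * halfSq y * β (halfSq y)) * X) *
        ∑ l, radMat (fun _ => 1) (fun s => -β s) y k l * y l := by
        simp only [Finset.mul_sum]
        exact Finset.sum_congr rfl fun l _ => by field_simp
    _ = _ := by rw [e2]; field_simp

lemma pd_christoffel (h : IsProfile β b) (hy : 0 < halfSq y) (k i j c : Fin 3) :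
    pd c (christoffel (radMetric β) k i j) y =
      (1 : Matrix (Fin 3) (Fin 3) ℝ) k c * radMat β (connCoeff β) y i j + y k *
      (deriv β (halfSq y) * y c * (1 : Matrix (Fin 3) (Fin 3) ℝ) i j
      + deriv (connCoeff β) (halfSq y) * y c * (y i * y j) + connCoeff β (halfSq y) *
      ((1 : Matrix (Fin 3) (Fin 3) ℝ) i c * y j + y i * (1 : Matrix (Fin 3) (Fin 3) ℝ) j c)) := by
  have hev : christoffel (radMetric β) k i j =ᶠ[𝓝 y]
      fun z => z k * radMat β (connCoeff β) z i j := by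
    filter_upwards [eventually_pos hy] with z hz using h.christoffel_radMetric hz k i j
  rw [pd_congr hev, pd_mul (differentiableAt_of_smooth (contDiffAt_coordinate k y))
    (differentiableAt_of_smooth (radMat_smooth (h.smooth_metric _ hy) (h.smooth_connCoeff hy) i j)),
    pd_coord, pd_radMat (hasDerivAt_of_smooth (h.smooth_metric _ hy))
      (hasDerivAt_of_smooth (h.smooth_connCoeff hy))]

/-- The Ricci tensor of a rotationally symmetric metric. -/
lemma ricci_radMetric (h : IsProfile β b) (hy : 0 < halfSq y) (i j : Fin 3) :
    ricci (radMetric β) i j y =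
      radMat (fun s => 2 * β s + 2 * s * deriv β s - 2 * s * connCoeff β s +
          2 * s * (2 * s * connCoeff β s + β s) * β s)
        (fun s => 3 * connCoeff β s - deriv β s + 2 * s * (2 * s * connCoeff β s + β s) *
          connCoeff β s - (2 * s * connCoeff β s + β s) ^ 2) y i j := by
  simp only [ricci, h.pd_christoffel hy, h.christoffel_radMetric hy, Fin.sum_univ_three,
    radMat_apply]
  rw [show 2 * halfSq y = y 0 ^ 2 + y 1 ^ 2 + y 2 ^ 2 by rw [halfSq_eq]; ring]
  generalize β (halfSq y) = B
  generalize deriv β (halfSq y) = B'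
  generalize connCoeff β (halfSq y) = A
  generalize deriv (connCoeff β) (halfSq y) = A'
  fin_cases i <;> fin_cases j <;> simp [Matrix.one_apply] <;> ring

/-- In terms of the Hawking mass `m = β r³/2` this is `R = 4 m'(r) / r²`. -/
lemma scalarCurv_radMetric (h : IsProfile β b) (hy : 0 < halfSq y) :
    scalarCurv (radMetric β) y = 6 * β (halfSq y) + 4 * halfSq y * deriv β (halfSq y) := by
  have hp := (h.pos _ hy).ne'
  have e : scalarCurv (radMetric β) y = ((radMetric β y)⁻¹ *
      (Matrix.of fun i j => ricci (radMetric β) i j y)ᵀ).trace := by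
    simp only [scalarCurv, Matrix.trace, Matrix.diag, Matrix.mul_apply, Matrix.transpose_apply,
      Matrix.of_apply]
  have e2 : (Matrix.of fun i j => ricci (radMetric β) i j y) = radMat _ _ y :=
    Matrix.ext fun i j => h.ricci_radMetric hy i j
  rw [e, e2, (radMat_isSymm _ _ _).eq, h.inv_radMetric hy, radMat_mul, radMat_trace]
  simp only [connCoeff]
  field_simp
  ring

/-- The mixed components of `radTensor β b` are `b δ + b' y yᵀ`. -/
lemma inv_mul_radTensor (h : IsProfile β b) (hy : 0 < halfSq y) :
    (radMetric β y)⁻¹ * radTensor β b y = radMat b (deriv b) y := by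
  have hQ := div_mul_cancel₀ (b (halfSq y) * β (halfSq y) + deriv b (halfSq y)) (h.pos _ hy).ne'
  rw [h.inv_radMetric hy, radTensor, radMat_mul]
  ext i j
  simp only [radMat_apply]
  linear_combination (y i * y j) * hQ

/-- The left-hand side of the Hamiltonian constraint, in terms of `w = β + b²`. -/
lemma hamiltonian_radial (h : IsProfile β b) (hy : 0 < halfSq y) :
    scalarCurv (radMetric β) y - sqLocal (radMetric β) (radTensor β b) y
      + trLocal (radMetric β) (radTensor β b) y ^ 2 =
    6 * (β (halfSq y) + b (halfSq y) ^ 2) +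
      4 * halfSq y * (deriv β (halfSq y) + 2 * b (halfSq y) * deriv b (halfSq y)) := by
  rw [h.scalarCurv_radMetric hy, sqLocal_eq_trace (radMetric_isSymm β) (radTensor_isSymm β b),
    trLocal_eq_trace (radTensor_isSymm β b), h.inv_mul_radTensor hy, radMat_mul, radMat_trace,
    radMat_trace]
  ring

lemma momentumMat_radial (h : IsProfile β b) (hy : 0 < halfSq y) :
    momentumMat (radMetric β) (radTensor β b) y =
      radMat (fun s => -(2 * b s + 2 * s * deriv b s)) (fun s => 2 * b s * β s + deriv b s) y := by
  rw [momentumMat_eq (radMetric_isSymm β) (radTensor_isSymm β b), h.inv_mul_radTensor hy,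
    h.inv_radMetric hy, radMat_mul, radMat_trace, radMat_sub_smul]
  ext i j
  simp only [radMat_apply]
  ring

/-- The radial ansatz solves the momentum constraint with zero momentum density. -/
lemma divMomentum_radial (h : IsProfile β b) (hy : 0 < halfSq y) (a : Fin 3) :
    divMomentum (radMetric β) (radTensor β b) a y = 0 := by
  have hp := (h.pos _ hy).ne'
  have hβ := hasDerivAt_of_smooth (h.smooth_metric _ hy)
  have hb := hasDerivAt_of_smooth (h.smooth_tensor _ hy)
  have hb' := hasDerivAt_of_smooth (deriv_smooth (h.smooth_tensor _ hy))
  set s := halfSq y with hs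
  set b'' := deriv (deriv b) s
  have hτ : HasDerivAt (fun s => -(2 * b s + 2 * s * deriv b s))
      (-(2 * deriv b s + (2 * deriv b s + 2 * s * b''))) s := by
    refine (((hb.const_mul 2).fun_add
      (((hasDerivAt_id' s).const_mul 2).fun_mul hb')).fun_neg).congr_deriv ?_
    simp
  have hσ : HasDerivAt (fun s => 2 * b s * β s + deriv b s)
      (2 * deriv b s * β s + 2 * b s * deriv β s + b'') s :=
    ((hb.const_mul 2).fun_mul hβ).fun_add hb'
  have hev (p q : Fin 3) : momentumTensor (radMetric β) (radTensor β b) p q =ᶠ[𝓝 y] fun z =>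
      radMat (fun s => -(2 * b s + 2 * s * deriv b s)) (fun s => 2 * b s * β s + deriv b s) z p q := by
    filter_upwards [eventually_pos hy] with z hz
    exact congrFun (congrFun (h.momentumMat_radial hz) p) q
  have hT := fun p q c : Fin 3 => (pd_congr (hev p q) c).trans (pd_radMat hτ hσ p q c)
  have hT0 := fun p q : Fin 3 => (hev p q).eq_of_nhds
  have hA : connCoeff β s * (2 * (1 - 2 * s * β s)) = deriv β s + 2 * β s ^ 2 :=
    div_mul_cancel₀ _ (mul_ne_zero two_ne_zero hp)
  simp only [divMomentum, hT, hT0, h.christoffel_radMetric hy, radMat_apply, ← hs]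
  have hS : 2 * s = y 0 ^ 2 + y 1 ^ 2 + y 2 ^ 2 := by rw [hs, halfSq_eq]; ring
  rw [hS] at hA ⊢
  generalize connCoeff β s = A at hA ⊢
  generalize β s = B at hA ⊢
  generalize deriv β s = B' at hA ⊢
  generalize deriv b s = C'
  generalize b s = C
  generalize b'' = C''
  fin_cases a
  · simp [Fin.sum_univ_three, Matrix.one_apply]
    linear_combination (-2 * (y 0 ^ 2 + y 1 ^ 2 + y 2 ^ 2) * C * y 0) * hA
  · simp [Fin.sum_univ_three, Matrix.one_apply]
    linear_combination (-2 * (y 0 ^ 2 + y 1 ^ 2 + y 2 ^ 2) * C * y 1) * hA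
  · simp [Fin.sum_univ_three, Matrix.one_apply]
    linear_combination (-2 * (y 0 ^ 2 + y 1 ^ 2 + y 2 ^ 2) * C * y 2) * hA

end IsProfile

section Decay

open Asymptotics

/-! ### The radial profiles -/

lemma deriv_smoothTransition_nonneg (x : ℝ) : 0 ≤ deriv Real.smoothTransition x :=
  Real.smoothTransition.monotone.deriv_nonneg

lemma deriv_smoothTransition_of_one_lt {x : ℝ} (hx : 1 < x) :
    deriv Real.smoothTransition x = 0 := by
  have : Real.smoothTransition =ᶠ[𝓝 x] fun _ => 1 := by
    filter_upwards [lt_mem_nhds hx] with t ht using Real.smoothTransition.one_of_one_le ht.le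
  rw [this.deriv_eq, deriv_const]

lemma smooth_shifted_transition (S s : ℝ) :
    ContDiffAt ℝ ∞ (fun s => Real.smoothTransition (s - S)) s :=
  (Real.smoothTransition.contDiff (n := ⊤)).contDiffAt.comp s (contDiffAt_id.sub contDiffAt_const)

/-- The profile of `β + b²`: it equals `c²` for `s ≤ S` and `K s^(-3/2)` for `s ≥ S + 1`. -/
def energyProfile (c K S s : ℝ) : ℝ :=
  c ^ 2 * (1 - Real.smoothTransition (s - S)) + K * Real.smoothTransition (s - S) / (s * √s)

lemma smooth_energyProfile (c K S : ℝ) {s : ℝ} (hs : 0 < s) :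
    ContDiffAt ℝ ∞ (energyProfile c K S) s :=
  (contDiffAt_const.mul (contDiffAt_const.sub (smooth_shifted_transition S s))).add
    ((contDiffAt_const.mul (smooth_shifted_transition S s)).div
      (contDiffAt_id.mul (Real.contDiffAt_sqrt hs.ne')) (by positivity))

lemma energyProfile_pos {c K S s : ℝ} (hc : 0 < c) (hK : 0 < K) (hs : 0 < s) :
    0 < energyProfile c K S s := by
  have h0 := Real.smoothTransition.nonneg (s - S)
  have h1 := Real.smoothTransition.le_one (s - S)
  rw [energyProfile]
  rcases h0.eq_or_lt with h | h
  · rw [← h]; simp; positivity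
  · have : 0 < K * Real.smoothTransition (s - S) / (s * √s) := by positivity
    have : 0 ≤ c ^ 2 * (1 - Real.smoothTransition (s - S)) :=
      mul_nonneg (sq_nonneg c) (by linarith)
    linarith

/-- `s^(3/2) (β + b²)` is nondecreasing. -/
lemma energyProfile_ineq {c S s : ℝ} (hs : 0 < s) :
    0 ≤ 6 * energyProfile c (c ^ 2 * ((S + 1) * √(S + 1))) S s +
      4 * s * deriv (energyProfile c (c ^ 2 * ((S + 1) * √(S + 1))) S) s := by
  set K := c ^ 2 * ((S + 1) * √(S + 1)) with hK
  have hs' : 0 < √s := Real.sqrt_pos.2 hs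
  have hss : √s * √s = s := Real.mul_self_sqrt hs.le
  set χ := Real.smoothTransition (s - S) with hχ
  set χ' := deriv Real.smoothTransition (s - S) with hχ'
  have hd : HasDerivAt (fun s => Real.smoothTransition (s - S)) χ' s := by
    have h := (Real.smoothTransition.contDiff (n := ⊤)).contDiffAt (x := s - S)
    have h1 := (h.differentiableAt (by simp)).hasDerivAt
    exact h1.comp_sub_const s S
  have hq : HasDerivAt (fun s => s * √s) (3 / 2 * √s) s := by
    refine ((hasDerivAt_id' s).fun_mul (Real.hasDerivAt_sqrt hs.ne')).congr_deriv ?_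
    field_simp
    linear_combination (-1) * hss
  have hw : HasDerivAt (energyProfile c K S)
      (c ^ 2 * (-χ') + (K * χ' * (s * √s) - K * χ * (3 / 2 * √s)) / (s * √s) ^ 2) s :=
    ((hd.const_sub 1).const_mul (c ^ 2)).fun_add ((hd.const_mul K).fun_div hq (by positivity))
  rw [hw.deriv]
  have hkey : 6 * energyProfile c K S s + 4 * s *
      (c ^ 2 * (-χ') + (K * χ' * (s * √s) - K * χ * (3 / 2 * √s)) / (s * √s) ^ 2) =
      6 * c ^ 2 * (1 - χ) + 4 / √s * (χ' * (K - c ^ 2 * (s * √s))) := by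
    rw [energyProfile, ← hχ]
    field_simp
    ring
  rw [hkey]
  have h1 := Real.smoothTransition.le_one (s - S)
  have h2 : 0 ≤ χ' * (K - c ^ 2 * (s * √s)) := by
    by_cases hsS : s ≤ S + 1
    · refine mul_nonneg (deriv_smoothTransition_nonneg _) ?_
      rw [hK, ← mul_sub]
      refine mul_nonneg (sq_nonneg c) (sub_nonneg.2 ?_)
      exact mul_le_mul hsS (Real.sqrt_le_sqrt hsS) hs'.le (hs.le.trans hsS)
    · rw [hχ', deriv_smoothTransition_of_one_lt (by linarith), zero_mul]
  have h3 : 0 ≤ 6 * c ^ 2 * (1 - χ) := mul_nonneg (by positivity) (by linarith)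
  have : 0 ≤ 4 / √s * (χ' * (K - c ^ 2 * (s * √s))) := mul_nonneg (by positivity) h2
  linarith

/-- Profiles that join a flat region with `p = c g` to a Schwarzschild region with `p = 0`, with
nonnegative energy density. In `β = w (1 - η²)` and `b = √w η`, the function `w = β + b²` goes from
`c²` to `K s^(-3/2)`, and then the cutoff `η` goes from `1` to `0`, at a radius large compared with
the mass. -/
lemma exists_profile {c S : ℝ} (hc : 0 < c) (hS : 0 < S) : ∃ (β b : ℝ → ℝ) (K T : ℝ),
    IsProfile β b ∧ (∀ s, 0 < s → 0 ≤ β s) ∧ (∀ s, 0 < s → s ≤ S → β s = 0 ∧ b s = c) ∧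
    (∀ s, 0 < s → 0 ≤ 6 * (β s + b s ^ 2) + 4 * s * (deriv β s + 2 * b s * deriv b s)) ∧
    ∀ s, T ≤ s → β s = K / (s * √s) ∧ b s = 0 := by
  -- with this `K` one has `c² ≤ K s^(-3/2)` as long as `s ≤ S + 1`
  set K := c ^ 2 * ((S + 1) * √(S + 1)) with hK
  have hK0 : 0 < K := by positivity
  -- `s > 4K²` guarantees `2sβ < 1`, so that the metric is nondegenerate where `β ≠ 0`
  set T := max (S + 1) (4 * K ^ 2 + 1) with hT
  set w := energyProfile c K S with hw
  set η : ℝ → ℝ := fun s => 1 - Real.smoothTransition (s - T) with hη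
  have hη0 (s) : 0 ≤ η s := sub_nonneg.2 (Real.smoothTransition.le_one _)
  have hη1 (s) : η s ≤ 1 := by
    have := Real.smoothTransition.nonneg (s - T)
    simp only [hη]; linarith
  have hηs (s) : ContDiffAt ℝ ∞ η s := contDiffAt_const.sub (smooth_shifted_transition T s)
  have hηT (s) (h : s ≤ T) : η s = 1 := by
    simp only [hη]; rw [Real.smoothTransition.zero_of_nonpos (by linarith), sub_zero]
  have hws (s) (h : 0 < s) : ContDiffAt ℝ ∞ w s := smooth_energyProfile c K S h
  have hw0 (s) (h : 0 < s) : 0 < w s := energyProfile_pos hc hK0 h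
  have hwK (s) (h : S + 1 ≤ s) : w s = K / (s * √s) := by
    simp only [hw, energyProfile]
    rw [Real.smoothTransition.one_of_one_le (by linarith)]; simp
  have hβs (s) (h : 0 < s) : ContDiffAt ℝ ∞ (fun s => w s * (1 - η s ^ 2)) s :=
    (hws s h).mul (contDiffAt_const.sub ((hηs s).pow 2))
  have hbs (s) (h : 0 < s) : ContDiffAt ℝ ∞ (fun s => √(w s) * η s) s :=
    ((hws s h).sqrt (hw0 s h).ne').mul (hηs s)
  have hβ0 (s) (h : 0 < s) : 0 ≤ w s * (1 - η s ^ 2) :=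
    mul_nonneg (hw0 s h).le (by nlinarith [hη0 s, hη1 s])
  refine ⟨fun s => w s * (1 - η s ^ 2), fun s => √(w s) * η s, K, T + 1, ⟨hβs, hbs, ?_⟩, hβ0,
    ?_, ?_, ?_⟩
  · intro s hs
    by_cases hsT : s ≤ T
    · simp [hηT s hsT]
    · push Not at hsT
      have h1 : w s * (1 - η s ^ 2) ≤ K / (s * √s) := by
        rw [← hwK s ((le_max_left _ _).trans hsT.le)]
        exact mul_le_of_le_one_right (hw0 s hs).le (by nlinarith [hη0 s])
      have hs' : 0 < √s := Real.sqrt_pos.2 hs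
      have h2 : 2 * K < √s := by
        apply Real.lt_sqrt_of_sq_lt
        have : 4 * K ^ 2 + 1 ≤ T := le_max_right _ _
        nlinarith
      have h3 : 2 * s * (K / (s * √s)) < 1 := by
        rw [show 2 * s * (K / (s * √s)) = 2 * K / √s by field_simp, div_lt_one hs']
        exact h2
      have h4 : 2 * s * (w s * (1 - η s ^ 2)) ≤ 2 * s * (K / (s * √s)) :=
        mul_le_mul_of_nonneg_left h1 (by positivity)
      linarith
  · intro s hs hsS
    have hsT : s ≤ T := by
      have : S + 1 ≤ T := le_max_left _ _
      linarith
    have hwc : w s = c ^ 2 := by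
      simp only [hw, energyProfile]
      rw [Real.smoothTransition.zero_of_nonpos (by linarith)]; simp
    simp only [hηT s hsT, hwc, Real.sqrt_sq hc.le]
    norm_num
  · intro s hs
    have hsum : (fun s => w s * (1 - η s ^ 2) + (√(w s) * η s) ^ 2) =ᶠ[𝓝 s] w := by
      filter_upwards [lt_mem_nhds hs] with t ht
      rw [mul_pow, Real.sq_sqrt (hw0 t ht).le]; ring
    have hd := ((hasDerivAt_of_smooth (hβs s hs)).fun_add
      ((hasDerivAt_of_smooth (hbs s hs)).fun_pow 2)).deriv
    have hval : w s * (1 - η s ^ 2) + (√(w s) * η s) ^ 2 = w s := hsum.eq_of_nhds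
    rw [hsum.deriv_eq] at hd
    have := energyProfile_ineq (c := c) (S := S) hs
    rw [← hK, ← hw, hd] at this
    beta_reduce
    rw [hval]
    simpa using this
  · intro s hs
    have hη : η s = 0 := by
      simp only [hη]
      rw [Real.smoothTransition.one_of_one_le (by linarith), sub_self]
    have : S + 1 ≤ T := le_max_left _ _
    simp only [hη, hwK s (by linarith)]
    norm_num

/-! ### Decay at infinity -/

/-- `f(s) = s^(-n/2) g(s^(-1/2))` for large `s`, with `g` analytic at `0`. Differentiating such a
function improves the decay by a factor `1/s`. -/
def IsSymbol (n : ℕ) (f : ℝ → ℝ) : Prop :=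
  ∃ g : ℝ → ℝ, AnalyticAt ℝ g 0 ∧ ∀ᶠ s in atTop, f s = (√s)⁻¹ ^ n * g (√s)⁻¹

lemma tendsto_inv_sqrt : Tendsto (fun s : ℝ => (√s)⁻¹) atTop (𝓝 0) :=
  tendsto_inv_atTop_zero.comp Real.tendsto_sqrt_atTop

lemma eventually_atTop_nhds {P : ℝ → Prop} (h : ∀ᶠ s in atTop, P s) :
    ∀ᶠ s in atTop, ∀ᶠ t in 𝓝 s, P t := by
  obtain ⟨A, hA⟩ := eventually_atTop.1 h
  filter_upwards [eventually_gt_atTop A] with s hs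
  filter_upwards [lt_mem_nhds hs] with t ht using hA t ht.le

lemma IsSymbol.deriv {n : ℕ} {f : ℝ → ℝ} (hf : IsSymbol n f) : IsSymbol (n + 2) (deriv f) := by
  obtain ⟨g, hg, hfg⟩ := hf
  refine ⟨fun u => -(1 / 2) * (n * g u + u * _root_.deriv g u), ?_, ?_⟩
  · exact analyticAt_const.mul ((analyticAt_const.mul hg).add (analyticAt_id.mul hg.deriv))
  · have hg' := tendsto_inv_sqrt.eventually hg.eventually_analyticAt
    filter_upwards [eventually_atTop_nhds hfg, hg', eventually_gt_atTop 0] with s hs hgs hs0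
    have hsq : 0 < √s := Real.sqrt_pos.2 hs0
    have hss : √s * √s = s := Real.mul_self_sqrt hs0.le
    have hu : HasDerivAt (fun s : ℝ => (√s)⁻¹) (-(1 / 2) * (√s)⁻¹ ^ 3) s := by
      refine ((Real.hasDerivAt_sqrt hs0.ne').fun_inv hsq.ne').congr_deriv ?_
      field_simp
    have hd := (hu.fun_pow n).fun_mul (hgs.differentiableAt.hasDerivAt.comp s hu)
    have heq : f =ᶠ[𝓝 s] fun s => (√s)⁻¹ ^ n * (g ∘ fun s => (√s)⁻¹) s := hs
    rw [heq.deriv_eq, hd.deriv]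
    rcases n with _ | n
    · simp; ring
    · simp only [Nat.add_sub_cancel, Function.comp]
      push_cast
      ring

lemma halfSq_tendsto : Tendsto halfSq (Bornology.cobounded E3) atTop := by
  unfold halfSq
  exact ((tendsto_pow_atTop two_ne_zero).comp tendsto_norm_cobounded_atTop).atTop_div_const
    two_pos

lemma IsSymbol.isBigO {n : ℕ} {f : ℝ → ℝ} (hf : IsSymbol n f) :
    (fun y => f (halfSq y)) =O[Bornology.cobounded E3] fun y => 1 / ‖y‖ ^ n := by
  obtain ⟨g, hg, hfg⟩ := hf
  have h1 : (fun s => g (√s)⁻¹) =O[atTop] fun _ => (1 : ℝ) :=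
    (hg.continuousAt.tendsto.comp tendsto_inv_sqrt).isBigO_one ℝ
  have h2 : f =O[atTop] fun s => (√s)⁻¹ ^ n := by
    refine (EventuallyEq.trans_isBigO (f₂ := fun s => (√s)⁻¹ ^ n * g (√s)⁻¹) hfg ?_)
    simpa using (isBigO_refl (fun s : ℝ => (√s)⁻¹ ^ n) atTop).mul h1
  refine (h2.comp_tendsto halfSq_tendsto).trans (IsBigO.of_bound (√2 ^ n) ?_)
  refine Eventually.of_forall fun y => ?_
  have : √(halfSq y) = ‖y‖ / √2 := by
    rw [halfSq, Real.sqrt_div (sq_nonneg _), Real.sqrt_sq (norm_nonneg _)]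
  simp only [Function.comp, this]
  rw [inv_div, div_pow, norm_div, norm_div, norm_pow, norm_pow, norm_norm, norm_one,
    Real.norm_of_nonneg (Real.sqrt_nonneg _), mul_one_div]

lemma isBigO_coord (a : Fin 3) :
    (fun y : E3 => y a) =O[Bornology.cobounded E3] fun y => ‖y‖ ^ 1 :=
  IsBigO.of_bound 1 (Eventually.of_forall fun y => by
    simpa using PiLp.norm_apply_le y a)

lemma isBigO_mul_decay {f P : E3 → ℝ} {n k : ℕ}
    (hf : f =O[Bornology.cobounded E3] fun y => 1 / ‖y‖ ^ (n + k))
    (hP : P =O[Bornology.cobounded E3] fun y => ‖y‖ ^ k) :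
    (fun y => f y * P y) =O[Bornology.cobounded E3] fun y => 1 / ‖y‖ ^ n := by
  refine (hf.mul hP).trans_eventuallyEq ?_
  filter_upwards [tendsto_norm_cobounded_atTop.eventually (eventually_gt_atTop (0 : ℝ))] with y hy
  rw [pow_add]; field_simp

lemma eventually_cobounded_nhds {P : E3 → Prop} (h : ∀ᶠ y in Bornology.cobounded E3, P y) :
    ∀ᶠ y in Bornology.cobounded E3, ∀ᶠ z in 𝓝 y, P z := by
  obtain ⟨A, -, hA⟩ := (Filter.hasBasis_cobounded_norm (E := E3)).eventually_iff.1 h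
  filter_upwards [tendsto_norm_cobounded_atTop.eventually (eventually_gt_atTop A)] with y hy
  filter_upwards [continuous_norm.continuousAt.eventually (lt_mem_nhds hy)] with z hz
  exact hA hz.le

lemma pd_eventuallyEq_cobounded {f g : E3 → ℝ} (h : f =ᶠ[Bornology.cobounded E3] g) (c : Fin 3) :
    pd c f =ᶠ[Bornology.cobounded E3] pd c g := by
  filter_upwards [eventually_cobounded_nhds h] with y hy using pd_congr hy c

lemma isBigO_one_matrix_mul {f : E3 → ℝ} {k : ℕ} (a b : Fin 3)
    (hf : f =O[Bornology.cobounded E3] fun y => ‖y‖ ^ k) :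
    (fun y => (1 : Matrix (Fin 3) (Fin 3) ℝ) a b * f y) =O[Bornology.cobounded E3]
      fun y => ‖y‖ ^ k := hf.const_mul_left _

lemma isBigO_coord_mul (a b : Fin 3) :
    (fun y : E3 => y a * y b) =O[Bornology.cobounded E3] fun y => ‖y‖ ^ 2 := by
  simpa [pow_two] using (isBigO_coord a).mul (isBigO_coord b)

lemma eventually_halfSq_pos : ∀ᶠ y in Bornology.cobounded E3, 0 < halfSq y :=
  halfSq_tendsto.eventually (eventually_gt_atTop 0)

/-- The metric `δ + F y yᵀ` is asymptotically flat if `F` is a symbol of order `3`. -/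
lemma radMat_decay {F : ℝ → ℝ} (hF : IsSymbol 3 F) (hs : ∀ s, 0 < s → ContDiffAt ℝ ∞ F s)
    {H : MatField} (hH : H =ᶠ[Bornology.cobounded E3] radMat (fun _ => 1) F) (a b : Fin 3) :
    ((fun y => H y a b - (1 : Matrix (Fin 3) (Fin 3) ℝ) a b) =O[Bornology.cobounded E3]
      fun y => 1 / ‖y‖) ∧
    (∀ c, (pd c fun y => H y a b) =O[Bornology.cobounded E3] fun y => 1 / ‖y‖ ^ 2) ∧
    (∀ c d, (pd d (pd c fun y => H y a b)) =O[Bornology.cobounded E3] fun y => 1 / ‖y‖ ^ 3) := by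
  have hH' : (fun y => H y a b) =ᶠ[Bornology.cobounded E3]
      fun y => radMat (fun _ => 1) F y a b := hH.mono fun y hy => by simp only [hy]
  have hd (a : Fin 3) (y : E3) : DifferentiableAt ℝ (fun z : E3 => z a) y :=
    differentiableAt_of_smooth (contDiffAt_coordinate a y)
  have h1 (c : Fin 3) : (pd c fun y => H y a b) =ᶠ[Bornology.cobounded E3]
      fun y => deriv F (halfSq y) * (y c * (y a * y b)) + F (halfSq y) *
        ((1 : Matrix (Fin 3) (Fin 3) ℝ) a c * y b + (1 : Matrix (Fin 3) (Fin 3) ℝ) b c * y a) := by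
    refine (pd_eventuallyEq_cobounded hH' c).trans ?_
    filter_upwards [eventually_halfSq_pos] with y hy
    rw [pd_radMat (hasDerivAt_const _ _) (hasDerivAt_of_smooth (hs _ hy))]
    ring
  have h2 (c d : Fin 3) : (pd d (pd c fun y => H y a b)) =ᶠ[Bornology.cobounded E3]
      fun y => (deriv (deriv F) (halfSq y) * (y d * (y c * (y a * y b))) + deriv F (halfSq y) *
        ((1 : Matrix (Fin 3) (Fin 3) ℝ) c d * (y a * y b) +
          ((1 : Matrix (Fin 3) (Fin 3) ℝ) a d * (y b * y c) +
           (1 : Matrix (Fin 3) (Fin 3) ℝ) b d * (y a * y c)))) + (deriv F (halfSq y) *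
        ((1 : Matrix (Fin 3) (Fin 3) ℝ) a c * (y b * y d) +
         (1 : Matrix (Fin 3) (Fin 3) ℝ) b c * (y a * y d)) + F (halfSq y) *
        ((1 : Matrix (Fin 3) (Fin 3) ℝ) a c * (1 : Matrix (Fin 3) (Fin 3) ℝ) b d +
         (1 : Matrix (Fin 3) (Fin 3) ℝ) b c * (1 : Matrix (Fin 3) (Fin 3) ℝ) a d)) := by
    refine (pd_eventuallyEq_cobounded (h1 c) d).trans ?_
    filter_upwards [eventually_halfSq_pos] with y hy
    have e0 := hasDerivAt_of_smooth (hs _ hy)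
    have e1 := hasDerivAt_of_smooth (deriv_smooth (hs _ hy))
    have e2 : DifferentiableAt ℝ halfSq y := differentiableAt_of_smooth halfSq_contDiff.contDiffAt
    have f0 : DifferentiableAt ℝ (fun z => F (halfSq z)) y := e0.differentiableAt.comp y e2
    have f1 : DifferentiableAt ℝ (fun z => deriv F (halfSq z)) y := e1.differentiableAt.comp y e2
    have m2 (p q : Fin 3) := (hd p y).fun_mul (hd q y)
    have l1 (p q : Fin 3) := (hd p y).const_mul ((1 : Matrix (Fin 3) (Fin 3) ℝ) q c)
    rw [pd_add (f1.fun_mul ((hd c y).fun_mul (m2 a b))) (f0.fun_mul ((l1 b a).fun_add (l1 a b))),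
      pd_mul f1 ((hd c y).fun_mul (m2 a b)), pd_mul (hd c y) (m2 a b), pd_mul (hd a y) (hd b y),
      pd_mul f0 ((l1 b a).fun_add (l1 a b)), pd_add (l1 b a) (l1 a b),
      pd_const_mul _ _ (hd b y), pd_const_mul _ _ (hd a y), pd_comp_halfSq e0, pd_comp_halfSq e1]
    simp only [pd_coord]
    ring
  have o3 (p q r : Fin 3) : (fun y : E3 => y p * (y q * y r)) =O[Bornology.cobounded E3]
      fun y => ‖y‖ ^ 3 := by
    refine ((isBigO_coord p).mul (isBigO_coord_mul q r)).congr_right fun y => by ring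
  have o4 (p q r t : Fin 3) : (fun y : E3 => y p * (y q * (y r * y t)))
      =O[Bornology.cobounded E3] fun y => ‖y‖ ^ 4 := by
    refine ((isBigO_coord p).mul (o3 q r t)).congr_right fun y => by ring
  have k0 : IsSymbol 5 (deriv F) := hF.deriv
  have k1 : IsSymbol 7 (deriv (deriv F)) := k0.deriv
  refine ⟨?_, fun c => ?_, fun c d => ?_⟩
  · have : (fun y => H y a b - (1 : Matrix (Fin 3) (Fin 3) ℝ) a b) =ᶠ[Bornology.cobounded E3]
        fun y => F (halfSq y) * (y a * y b) := by
      filter_upwards [hH'] with y hy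
      rw [hy, radMat_apply]; ring
    refine this.trans_isBigO ?_
    simpa using isBigO_mul_decay (n := 1) (k := 2) hF.isBigO (isBigO_coord_mul a b)
  · refine (h1 c).trans_isBigO (IsBigO.add ?_ ?_)
    · exact isBigO_mul_decay (n := 2) (k := 3) k0.isBigO (o3 c a b)
    · exact isBigO_mul_decay (n := 2) (k := 1) hF.isBigO
        ((isBigO_one_matrix_mul _ _ (isBigO_coord b)).add
          (isBigO_one_matrix_mul _ _ (isBigO_coord a)))
  · have o2 (p q r t : Fin 3) := isBigO_one_matrix_mul p q (isBigO_coord_mul r t)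
    refine (h2 c d).trans_isBigO (((?_ : IsBigO _ _ _).add ?_).add ((?_ : IsBigO _ _ _).add ?_))
    · exact isBigO_mul_decay (n := 3) (k := 4) k1.isBigO (o4 d c a b)
    · exact isBigO_mul_decay (n := 3) (k := 2) k0.isBigO ((o2 _ _ _ _).add ((o2 _ _ _ _).add (o2 _ _ _ _)))
    · exact isBigO_mul_decay (n := 3) (k := 2) k0.isBigO ((o2 _ _ _ _).add (o2 _ _ _ _))
    · exact isBigO_mul_decay (n := 3) (k := 0) hF.isBigO (by
        simp only [pow_zero]
        exact isBigO_const_const _ (one_ne_zero (α := ℝ)) _)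

/-- The coefficient of the Schwarzschild metric in these coordinates is a symbol of order `3`. -/
lemma isSymbol_metricCoeff {β : ℝ → ℝ} {K T : ℝ} (hβ : ∀ s, T ≤ s → β s = K / (s * √s)) :
    IsSymbol 3 (metricCoeff β) := by
  refine ⟨fun u => K / (1 - 2 * K * u), ?_, ?_⟩
  · exact analyticAt_const.div (analyticAt_const.sub (analyticAt_const.mul analyticAt_id)) (by simp)
  · filter_upwards [eventually_ge_atTop T, eventually_gt_atTop 0] with s hs hs0
    have hsq : 0 < √s := Real.sqrt_pos.2 hs0
    have hss : √s * √s = s := Real.mul_self_sqrt hs0.le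
    have e : 2 * s * (K / (s * √s)) = 2 * K * (√s)⁻¹ := by field_simp
    rw [metricCoeff, hβ s hs, e]
    have e2 : K / (s * √s) = (√s)⁻¹ ^ 3 * K := by
      rw [show (√s)⁻¹ ^ 3 * K = K / (√s * √s * √s) by field_simp, hss]
    rw [e2, mul_div_assoc]

end Decay

/-! ### Tensors on a manifold and their components -/

lemma eventually_transition {M : Type*} [TopologicalSpace M] {e e' : OpenPartialHomeomorph M E3}
    {y : E3} (hy : y ∈ e.target) (hy' : e.symm y ∈ e'.source) :
    ∀ᶠ z in 𝓝 y, z ∈ e.target ∧ e.symm z ∈ e'.source :=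
  (e.open_target.eventually_mem hy).and
    ((e.continuousAt_symm hy).eventually (e'.open_source.mem_nhds hy'))

variable {M : Type*} [TopologicalSpace M] [ChartedSpace E3 M]

/-- The value of a 2-tensor on two vectors of the model space, with which every tangent space is
identified. -/
def tensorEval (T : TwoTensor M) (x : M) (u v : E3) : ℝ := T x u v

/-- The derivative of the inverse of a chart, as an endomorphism of the model space. -/
def chartDeriv (e : OpenPartialHomeomorph M E3) (y : E3) : E3 →L[ℝ] E3 :=
  mfderiv (𝓡 3) (𝓡 3) e.symm y

lemma components_apply (e : OpenPartialHomeomorph M E3) (T : TwoTensor M) (y : E3) (a b : Fin 3) :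
    components e T y a b =
      tensorEval T (e.symm y) (chartDeriv e y (basisVec a)) (chartDeriv e y (basisVec b)) := rfl

lemma eq_sum_basisVec (v : E3) : v = ∑ m, v m • basisVec m := by
  ext i; simp [basisVec, Pi.single_apply]

lemma tensorEval_sum (T : TwoTensor M) (x : M) (L : E3 →L[ℝ] E3) (u v : E3) :
    tensorEval T x (L u) (L v) =
      ∑ a, ∑ b, u a * v b * tensorEval T x (L (basisVec a)) (L (basisVec b)) := by
  have h : ∀ (B : E3 →L[ℝ] E3 →L[ℝ] ℝ), B (L u) (L v) =
      ∑ a, ∑ b, u a * v b * B (L (basisVec a)) (L (basisVec b)) := fun B => by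
    conv_lhs => rw [eq_sum_basisVec u, eq_sum_basisVec v]
    simp only [map_sum, map_smul, _root_.sum_apply, _root_.smul_apply,
      smul_eq_mul, Finset.mul_sum]
    rw [Finset.sum_comm]
    exact Finset.sum_congr rfl fun a _ => Finset.sum_congr rfl fun b _ => by ring
  exact h (T x)

lemma tensorEval_chartDeriv (e : OpenPartialHomeomorph M E3) (T : TwoTensor M) (y u v : E3) :
    tensorEval T (e.symm y) (chartDeriv e y u) (chartDeriv e y v) =
      ∑ a, ∑ b, u a * v b * components e T y a b :=
  tensorEval_sum T _ _ u v

lemma components_isSymm (e : OpenPartialHomeomorph M E3) {T : TwoTensor M}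
    (hT : ∀ x v w, T x v w = T x w v) (y : E3) : (components e T y).IsSymm := by
  ext a b; exact hT _ _ _

lemma mdifferentiable_of_mem {e : OpenPartialHomeomorph M E3}
    (he : e ∈ IsManifold.maximalAtlas (𝓡 3) ∞ M) : e.MDifferentiable (𝓡 3) (𝓡 3) :=
  ⟨(contMDiffOn_of_mem_maximalAtlas he).mdifferentiableOn (by simp),
    (contMDiffOn_symm_of_mem_maximalAtlas he).mdifferentiableOn (by simp)⟩

variable {e e' : OpenPartialHomeomorph M E3}

lemma chartDeriv_injective (he : e ∈ IsManifold.maximalAtlas (𝓡 3) ∞ M) {y : E3}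
    (hy : y ∈ e.target) : Function.Injective (chartDeriv e y) :=
  (mdifferentiable_of_mem he).symm.mfderiv_injective hy

lemma transition_smooth (he : e ∈ IsManifold.maximalAtlas (𝓡 3) ∞ M)
    (he' : e' ∈ IsManifold.maximalAtlas (𝓡 3) ∞ M) {y : E3} (hy : y ∈ e.target)
    (hy' : e.symm y ∈ e'.source) : ContDiffAt ℝ ∞ (fun z => e' (e.symm z)) y := by
  rw [← contMDiffAt_iff_contDiffAt]
  exact (contMDiffAt_of_mem_maximalAtlas he' hy').comp y
    (contMDiffAt_symm_of_mem_maximalAtlas he hy)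

lemma chartDeriv_transition (he : e ∈ IsManifold.maximalAtlas (𝓡 3) ∞ M)
    (he' : e' ∈ IsManifold.maximalAtlas (𝓡 3) ∞ M) {y : E3} (hy : y ∈ e.target)
    (hy' : e.symm y ∈ e'.source) (v : E3) :
    chartDeriv e y v = chartDeriv e' (e' (e.symm y)) (fderiv ℝ (fun z => e' (e.symm z)) y v) := by
  have h1 : MDifferentiableAt (𝓡 3) (𝓡 3) e'.symm (e' (e.symm y)) :=
    (mdifferentiable_of_mem he').mdifferentiableAt_symm (e'.map_source hy')
  have h2 : MDifferentiableAt (𝓡 3) (𝓡 3) (fun z => e' (e.symm z)) y :=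
    ((transition_smooth he he' hy hy').differentiableAt (by simp)).mdifferentiableAt
  have hev : (fun z => e'.symm (e' (e.symm z))) =ᶠ[𝓝 y] e.symm := by
    filter_upwards [eventually_transition hy hy'] with z hz using e'.left_inv hz.2
  have h3 := mfderiv_comp (I := 𝓡 3) (I' := 𝓡 3) (I'' := 𝓡 3) y h1 h2
  have h4 : mfderiv (𝓡 3) (𝓡 3) e.symm y =
      mfderiv (𝓡 3) (𝓡 3) (e'.symm ∘ fun z => e' (e.symm z)) y := hev.symm.mfderiv_eq
  have h5 : mfderiv (𝓡 3) (𝓡 3) (fun z => e' (e.symm z)) y =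
      fderiv ℝ (fun z => e' (e.symm z)) y := mfderiv_eq_fderiv
  rw [h5] at h3
  have h6 := h4.trans h3
  exact congrArg (fun L : E3 →L[ℝ] E3 => L v) h6

/-- Components in two charts are related by the Jacobian of the transition map. -/
lemma components_transition (he : e ∈ IsManifold.maximalAtlas (𝓡 3) ∞ M)
    (he' : e' ∈ IsManifold.maximalAtlas (𝓡 3) ∞ M) (T : TwoTensor M) {y : E3} (hy : y ∈ e.target)
    (hy' : e.symm y ∈ e'.source) : components e T y =
      (jac (fun z => e' (e.symm z)) y)ᵀ * components e' T (e' (e.symm y)) *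
        jac (fun z => e' (e.symm z)) y := by
  have hd := (transition_smooth he he' hy hy').differentiableAt (by simp)
  ext a b
  have hx : e'.symm (e' (e.symm y)) = e.symm y := e'.left_inv hy'
  have hT : ∀ u v, tensorEval T (e.symm y) u v = tensorEval T (e'.symm (e' (e.symm y))) u v := by
    rw [hx]; exact fun _ _ => rfl
  rw [components_apply, chartDeriv_transition he he' hy hy', chartDeriv_transition he he' hy hy',
    hT, tensorEval_chartDeriv, Matrix.mul_assoc]
  simp only [Matrix.mul_apply, Matrix.transpose_apply, Finset.mul_sum, fderiv_coord hd]
  refine Finset.sum_congr rfl fun p _ => Finset.sum_congr rfl fun q _ => ?_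
  simp only [jac, pd, Matrix.of_apply]
  ring

lemma components_transition_eventually (he : e ∈ IsManifold.maximalAtlas (𝓡 3) ∞ M)
    (he' : e' ∈ IsManifold.maximalAtlas (𝓡 3) ∞ M) (T : TwoTensor M) {y : E3} (hy : y ∈ e.target)
    (hy' : e.symm y ∈ e'.source) : components e T =ᶠ[𝓝 y] fun z =>
      (jac (fun z => e' (e.symm z)) z)ᵀ * components e' T (e' (e.symm z)) *
        jac (fun z => e' (e.symm z)) z := by
  filter_upwards [eventually_transition hy hy'] with z hz
  exact components_transition he he' T hz.1 hz.2

lemma components_smooth_transition (he : e ∈ IsManifold.maximalAtlas (𝓡 3) ∞ M)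
    (he' : e' ∈ IsManifold.maximalAtlas (𝓡 3) ∞ M) (T : TwoTensor M) {x : M} (hx : x ∈ e.source)
    (hx' : x ∈ e'.source) (h : SmoothMat (components e' T) (e' x)) :
    SmoothMat (components e T) (e x) := by
  have hy : e x ∈ e.target := e.map_source hx
  have hy' : e.symm (e x) ∈ e'.source := by rwa [e.left_inv hx]
  have hs := transition_smooth he he' hy hy'
  have h' : SmoothMat (components e' T) (e' (e.symm (e x))) := by rwa [e.left_inv hx]
  exact (((smoothMat_jac hs).transpose.mul (h'.comp hs)).mul (smoothMat_jac hs)).congr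
    (components_transition_eventually he he' T hy hy')

variable [IsManifold (𝓡 3) ∞ M]

/-- Smoothness at `x` of the section of the bundle of bilinear forms given by a 2-tensor. -/
def SmoothTensorAt (T : TwoTensor M) (x : M) : Prop :=
  ContMDiffAt (𝓡 3) ((𝓡 3).prod 𝓘(ℝ, E3 →L[ℝ] E3 →L[ℝ] ℝ)) ∞
    (fun x : M => Bundle.TotalSpace.mk' (E3 →L[ℝ] E3 →L[ℝ] ℝ)
      (E := fun x : M => TangentSpace (𝓡 3) x →L[ℝ] TangentSpace (𝓡 3) x →L[ℝ] ℝ) x (T x)) x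

/-- The bilinear form on `ℝ³` with a given matrix. -/
def bilinOfMat (A : Matrix (Fin 3) (Fin 3) ℝ) : E3 →L[ℝ] E3 →L[ℝ] ℝ :=
  ∑ a, ∑ b, A a b • (EuclideanSpace.proj a : E3 →L[ℝ] ℝ).smulRight
    (EuclideanSpace.proj b : E3 →L[ℝ] ℝ)

lemma bilinOfMat_apply (A : Matrix (Fin 3) (Fin 3) ℝ) (u v : E3) :
    bilinOfMat A u v = ∑ a, ∑ b, u a * v b * A a b := by
  simp only [bilinOfMat, _root_.sum_apply, _root_.smul_apply,
    ContinuousLinearMap.smulRight_apply, EuclideanSpace.coe_proj, smul_eq_mul]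
  exact Finset.sum_congr rfl fun a _ => Finset.sum_congr rfl fun b _ => by ring

lemma bilinOfMat_basisVec (A : Matrix (Fin 3) (Fin 3) ℝ) (a b : Fin 3) :
    bilinOfMat A (basisVec a) (basisVec b) = A a b := by
  simp [bilinOfMat_apply, basisVec]

lemma contDiffAt_bilinOfMat {A : MatField} {y : E3} (hA : SmoothMat A y) :
    ContDiffAt ℝ ∞ (fun z => bilinOfMat (A z)) y := by
  refine ContDiffAt.sum fun a _ => ContDiffAt.sum fun b _ => ?_
  have h (C : E3 →L[ℝ] E3 →L[ℝ] ℝ) : (fun z => A z a b • C) =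
      (ContinuousLinearMap.id ℝ ℝ).smulRight C ∘ fun z => A z a b := rfl
  rw [h]
  exact (ContinuousLinearMap.contDiff _).contDiffAt.comp y (hA a b)

lemma eq_bilinOfMat (B : E3 →L[ℝ] E3 →L[ℝ] ℝ) :
    B = bilinOfMat (Matrix.of fun a b => B (basisVec a) (basisVec b)) := by
  ext u v
  rw [bilinOfMat_apply]
  conv_lhs => rw [eq_sum_basisVec u, eq_sum_basisVec v]
  simp only [map_sum, map_smul, _root_.sum_apply, _root_.smul_apply,
    smul_eq_mul, Finset.mul_sum, Matrix.of_apply]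
  rw [Finset.sum_comm]
  exact Finset.sum_congr rfl fun a _ => Finset.sum_congr rfl fun b _ => by ring

lemma symm_trivializationAt {x₀ x : M} (hx : x ∈ (chartAt E3 x₀).source) (v : E3) :
    (trivializationAt E3 (TangentSpace (𝓡 3)) x₀).symm x v =
      chartDeriv (chartAt E3 x₀) (chartAt E3 x₀ x) v := by
  have hx' : x ∈ (trivializationAt E3 (TangentSpace (𝓡 3) (M := M)) x₀).baseSet := by simpa using hx
  have h := TangentBundle.symmL_trivializationAt (I := 𝓡 3) hx
  have h2 := congrArg (fun L : E3 →L[ℝ] E3 => L v) h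
  simp only [ModelWithCorners.range_eq_univ, mfderivWithin_univ] at h2
  rw [← Bundle.Trivialization.symmL_apply (R := ℝ) _ hx']
  exact h2

/-- The coordinate expression of a tensor in the trivialization of the bundle of bilinear forms
is given by its components in the preferred chart. -/
lemma inCoordinates_eq_bilinOfMat (T : TwoTensor M) {x₀ x : M} (hx : x ∈ (chartAt E3 x₀).source) :
    ContinuousLinearMap.inCoordinates E3 (TangentSpace (𝓡 3) (M := M)) (E3 →L[ℝ] ℝ)
      (fun x : M => TangentSpace (𝓡 3) x →L[ℝ] ℝ) x₀ x x₀ x (T x) =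
      bilinOfMat (components (chartAt E3 x₀) T (chartAt E3 x₀ x)) := by
  rw [eq_bilinOfMat (ContinuousLinearMap.inCoordinates E3 (TangentSpace (𝓡 3) (M := M)) (E3 →L[ℝ] ℝ)
      (fun x : M => TangentSpace (𝓡 3) x →L[ℝ] ℝ) x₀ x x₀ x (T x))]
  congr 1
  ext a b
  have hx' : x ∈ (trivializationAt E3 (TangentSpace (𝓡 3) (M := M)) x₀).baseSet := by simpa using hx
  rw [Matrix.of_apply, inCoordinates_apply_eq₂ (E₃ := fun _ : M => ℝ) hx' hx' (Set.mem_univ _),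
    symm_trivializationAt hx, symm_trivializationAt hx, components_apply]
  have : (chartAt E3 x₀).symm (chartAt E3 x₀ x) = x := (chartAt E3 x₀).left_inv hx
  simp only [Bundle.Trivial.fiberBundle_trivializationAt', Bundle.Trivial.linearMapAt_trivialization,
    LinearMap.id_coe, id_eq]
  rw [this]
  rfl

lemma smoothTensorAt_iff_chartAt (T : TwoTensor M) (x : M) :
    SmoothTensorAt T x ↔ SmoothMat (components (chartAt E3 x) T) (chartAt E3 x x) := by
  have hx : x ∈ (chartAt E3 x).source := mem_chart_source E3 x
  have hmem : chartAt E3 x ∈ IsManifold.maximalAtlas (𝓡 3) ∞ M :=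
    IsManifold.chart_mem_maximalAtlas x
  rw [SmoothTensorAt, contMDiffAt_hom_bundle]
  have hev : (fun z : M => ContinuousLinearMap.inCoordinates E3 (TangentSpace (𝓡 3) (M := M))
      (E3 →L[ℝ] ℝ) (fun x : M => TangentSpace (𝓡 3) x →L[ℝ] ℝ) x z x z (T z)) =ᶠ[𝓝 x]
      fun z => bilinOfMat (components (chartAt E3 x) T (chartAt E3 x z)) := by
    filter_upwards [(chartAt E3 x).open_source.mem_nhds hx] with z hz
    exact inCoordinates_eq_bilinOfMat T hz
  constructor
  · rintro ⟨-, h⟩ a b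
    have h1 := (h.congr_of_eventuallyEq hev.symm)
    rw [← contMDiffAt_iff_contDiffAt]
    have hsymm : ContMDiffAt (𝓡 3) (𝓡 3) ∞ (chartAt E3 x).symm (chartAt E3 x x) :=
      contMDiffAt_symm_of_mem_maximalAtlas hmem ((chartAt E3 x).map_source hx)
    have h1' : ContMDiffAt (𝓡 3) 𝓘(ℝ, E3 →L[ℝ] E3 →L[ℝ] ℝ) ∞
        (fun z => bilinOfMat (components (chartAt E3 x) T (chartAt E3 x z)))
        ((chartAt E3 x).symm (chartAt E3 x x)) := by
      rw [(chartAt E3 x).left_inv hx]; exact h1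
    have h2 := h1'.comp (chartAt E3 x x) hsymm
    have h3 : ContDiffAt ℝ ∞ (fun y => bilinOfMat (components (chartAt E3 x) T y))
        (chartAt E3 x x) := by
      rw [← contMDiffAt_iff_contDiffAt]
      refine h2.congr_of_eventuallyEq ?_
      filter_upwards [(chartAt E3 x).open_target.mem_nhds ((chartAt E3 x).map_source hx)] with z hz
      simp only [Function.comp, (chartAt E3 x).right_inv hz]
    have h4 := (h3.clm_apply (contDiffAt_const (c := basisVec a))).clm_apply
      (contDiffAt_const (c := basisVec b))
    simp only [bilinOfMat_basisVec] at h4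
    exact contMDiffAt_iff_contDiffAt.2 h4
  · intro h
    refine ⟨contMDiffAt_id, ContMDiffAt.congr_of_eventuallyEq ?_ hev⟩
    have h3 : ContDiffAt ℝ ∞ (fun y => bilinOfMat (components (chartAt E3 x) T y))
        (chartAt E3 x x) :=
      contDiffAt_bilinOfMat h
    exact (contMDiffAt_iff_contDiffAt.2 h3).comp x (contMDiffAt_of_mem_maximalAtlas hmem hx)

/-- A 2-tensor is smooth at a point if and only if its components in a chart are. -/
lemma smoothTensorAt_iff (he : e ∈ IsManifold.maximalAtlas (𝓡 3) ∞ M) (T : TwoTensor M) {x : M}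
    (hx : x ∈ e.source) : SmoothTensorAt T x ↔ SmoothMat (components e T) (e x) := by
  have hmem : chartAt E3 x ∈ IsManifold.maximalAtlas (𝓡 3) ∞ M :=
    IsManifold.chart_mem_maximalAtlas x
  rw [smoothTensorAt_iff_chartAt]
  exact ⟨components_smooth_transition he hmem T hx (mem_chart_source E3 x),
    components_smooth_transition hmem he T (mem_chart_source E3 x) hx⟩

/-! ### Riemannian metrics as tensors -/

section Metric

variable {M : Type*} [TopologicalSpace M] [ChartedSpace E3 M] [IsManifold (𝓡 3) ∞ M]
  {e e' : OpenPartialHomeomorph M E3}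

/-- A 2-tensor which is a smooth Riemannian metric. -/
structure IsMetric (T : TwoTensor M) : Prop where
  symm : ∀ x v w, T x v w = T x w v
  pos : ∀ x v, v ≠ 0 → 0 < T x v v
  smooth : ∀ x, SmoothTensorAt T x

lemma exists_lower_bound (B : E3 →L[ℝ] E3 →L[ℝ] ℝ) (hB : ∀ v, v ≠ 0 → 0 < B v v) :
    ∃ m > 0, ∀ v, m * ‖v‖ ^ 2 ≤ B v v := by
  have hc : Continuous fun v => B v v := by fun_prop
  obtain ⟨v₀, hv₀, hmin⟩ := (isCompact_sphere (0 : E3) 1).exists_isMinOn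
    (NormedSpace.sphere_nonempty.2 zero_le_one) hc.continuousOn
  have hv₀' : v₀ ≠ 0 := by
    rintro rfl; simp at hv₀
  refine ⟨B v₀ v₀, hB v₀ hv₀', fun v => ?_⟩
  rcases eq_or_ne v 0 with rfl | hv
  · simp
  · have hn : 0 < ‖v‖ := norm_pos_iff.2 hv
    have h1 : (‖v‖⁻¹ • v) ∈ Metric.sphere (0 : E3) 1 := by
      simp [norm_smul, hn.ne']
    have h2 := hmin h1
    simp only [Set.mem_ofPred_eq, map_smul, _root_.smul_apply, smul_eq_mul] at h2
    have h3 : ‖v‖⁻¹ * (‖v‖⁻¹ * B v v) * ‖v‖ ^ 2 = B v v := by field_simp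
    rw [← h3]
    exact mul_le_mul_of_nonneg_right h2 (sq_nonneg _)

lemma isVonNBounded_of_pos (B : E3 →L[ℝ] E3 →L[ℝ] ℝ) (hB : ∀ v, v ≠ 0 → 0 < B v v) :
    Bornology.IsVonNBounded ℝ {v : E3 | B v v < 1} := by
  obtain ⟨m, hm, h⟩ := exists_lower_bound B hB
  rw [NormedSpace.isVonNBounded_iff, Metric.isBounded_iff_subset_closedBall 0]
  refine ⟨√(1 / m), fun v hv => ?_⟩
  rw [mem_closedBall_zero_iff]
  refine Real.le_sqrt_of_sq_le ?_
  rw [le_div_iff₀ hm, mul_comm]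
  exact (h v).trans (le_of_lt hv)

/-- The bundled Riemannian metric. -/
def IsMetric.toRiemannian {T : TwoTensor M} (h : IsMetric T) :
    Bundle.ContMDiffRiemannianMetric (𝓡 3) ∞ E3 (fun x : M => TangentSpace (𝓡 3) x) where
  inner := T
  symm := h.symm
  pos := h.pos
  isVonNBounded x := isVonNBounded_of_pos (T x) (h.pos x)
  contMDiff x := h.smooth x

lemma IsMetric.smooth_components {T : TwoTensor M} (h : IsMetric T)
    (he : e ∈ IsManifold.maximalAtlas (𝓡 3) ∞ M) {y : E3} (hy : y ∈ e.target) :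
    SmoothMat (components e T) y := by
  have := (smoothTensorAt_iff he T (e.map_target hy)).1 (h.smooth _)
  rwa [e.right_inv hy] at this

lemma IsMetric.det_components {T : TwoTensor M} (h : IsMetric T)
    (he : e ∈ IsManifold.maximalAtlas (𝓡 3) ∞ M) {y : E3} (hy : y ∈ e.target) :
    (components e T y).det ≠ 0 := by
  intro h0
  obtain ⟨v, hv, hv0⟩ := Matrix.exists_mulVec_eq_zero_iff.2 h0
  set w : E3 := WithLp.toLp 2 v with hw
  have hw0 : w ≠ 0 := by
    intro h; apply hv; ext i
    exact congrArg (fun z : E3 => z i) h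
  have hD : chartDeriv e y w ≠ 0 := by
    intro h; exact hw0 (chartDeriv_injective he hy (by rw [h, map_zero]))
  have h1 : 0 < tensorEval T (e.symm y) (chartDeriv e y w) (chartDeriv e y w) := h.pos _ _ hD
  rw [tensorEval_chartDeriv] at h1
  have h2 : ∑ a, ∑ b, w a * w b * components e T y a b = ∑ a, v a * (components e T y *ᵥ v) a := by
    simp only [Matrix.mulVec, dotProduct, Finset.mul_sum]
    exact Finset.sum_congr rfl fun a _ => Finset.sum_congr rfl fun b _ => by simp only [hw]; ring
  rw [h2, hv0] at h1
  simp at h1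

/-- The components of a metric in two charts are related by the transition map. -/
lemma IsMetric.isTransition {T : TwoTensor M} (h : IsMetric T)
    (he : e ∈ IsManifold.maximalAtlas (𝓡 3) ∞ M) (he' : e' ∈ IsManifold.maximalAtlas (𝓡 3) ∞ M)
    {y : E3} (hy : y ∈ e.target) (hy' : e.symm y ∈ e'.source) :
    IsTransition (fun z => e' (e.symm z)) (components e' T) (components e T) y where
  smooth := transition_smooth he he' hy hy'
  det_jac := by
    intro h0
    have h1 := h.det_components he hy
    rw [components_transition he he' T hy hy'] at h1
    simp [h0] at h1
  smooth_metric := h.smooth_components he' (e'.map_source hy')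
  det_metric := h.det_components he' (e'.map_source hy')
  symm := components_isSymm e' h.symm
  symm' := components_isSymm e h.symm
  pullback := components_transition_eventually he he' T hy hy'

lemma IsMetric.isTransition_eventually {T : TwoTensor M} (h : IsMetric T)
    (he : e ∈ IsManifold.maximalAtlas (𝓡 3) ∞ M) (he' : e' ∈ IsManifold.maximalAtlas (𝓡 3) ∞ M)
    {y : E3} (hy : y ∈ e.target) (hy' : e.symm y ∈ e'.source) : ∀ᶠ z in 𝓝 y,
    IsTransition (fun z => e' (e.symm z)) (components e' T) (components e T) z := by
  filter_upwards [eventually_transition hy hy'] with z hz using h.isTransition he he' hz.1 hz.2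

/-- The left-hand side `R - p_ab p^ab + p²` of the Hamiltonian constraint in a chart. -/
def hamDensity (G P : MatField) (y : E3) : ℝ :=
  scalarCurv G y - sqLocal G P y + trLocal G P y ^ 2

lemma hamDensity_components {T P : TwoTensor M} (h : IsMetric T)
    (hP : ∀ x v w, P x v w = P x w v) (he : e ∈ IsManifold.maximalAtlas (𝓡 3) ∞ M)
    (he' : e' ∈ IsManifold.maximalAtlas (𝓡 3) ∞ M) {x : M} (hx : x ∈ e.source)
    (hx' : x ∈ e'.source) : hamDensity (components e T) (components e P) (e x) =
      hamDensity (components e' T) (components e' P) (e' x) := by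
  have hy := e.map_source hx
  have hy' : e.symm (e x) ∈ e'.source := by rwa [e.left_inv hx]
  have hev := h.isTransition_eventually he he' hy hy'
  have h0 := h.isTransition he he' hy hy'
  have hs := components_isSymm e hP
  have hs' := components_isSymm e' hP
  have hp := components_transition he he' P hy hy'
  rw [hamDensity, hamDensity, IsTransition.scalarCurv_eq hev, h0.sqLocal_eq hs' hs hp,
    h0.trLocal_eq hs' hs hp, e.left_inv hx]

lemma divMomentum_components {T P : TwoTensor M} (h : IsMetric T)
    (hP : ∀ x v w, P x v w = P x w v) (hPs : ∀ x, SmoothTensorAt P x)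
    (he : e ∈ IsManifold.maximalAtlas (𝓡 3) ∞ M)
    (he' : e' ∈ IsManifold.maximalAtlas (𝓡 3) ∞ M) {x : M} (hx : x ∈ e.source)
    (hx' : x ∈ e'.source) (h0 : ∀ a, divMomentum (components e T) (components e P) a (e x) = 0)
    (a : Fin 3) : divMomentum (components e' T) (components e' P) a (e' x) = 0 := by
  have hy := e.map_source hx
  have hy' : e.symm (e x) ∈ e'.source := by rwa [e.left_inv hx]
  have hev := h.isTransition_eventually he he' hy hy'
  have hsm : SmoothMat (components e' P) (e' (e.symm (e x))) := by
    rw [e.left_inv hx]; exact (smoothTensorAt_iff he' P hx').1 (hPs x)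
  have := IsTransition.divMomentum_law (components_isSymm e' hP) (components_isSymm e hP) hsm hev
    (components_transition_eventually he he' P hy hy') a
  simp only [h0, mul_zero, Finset.sum_const_zero, e.left_inv hx] at this
  exact this

lemma scalarCurv_contDiffAt {G : MatField} {y : E3} (hG : SmoothMat G y) (hdet : (G y).det ≠ 0) :
    ContDiffAt ℝ ∞ (scalarCurv G) y := by
  have hc (k i j) : ContDiffAt ℝ ∞ (christoffel G k i j) y := connMat_smooth hG hdet i k j
  have hr (i j) : ContDiffAt ℝ ∞ (ricci G i j) y :=
    ContDiffAt.sum fun k _ => ((pd_contDiffAt (hc _ _ _) _).sub (pd_contDiffAt (hc _ _ _) _)).add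
      (ContDiffAt.sum fun l _ => ((hc _ _ _).mul (hc _ _ _)).sub ((hc _ _ _).mul (hc _ _ _)))
  exact ContDiffAt.sum fun i _ => ContDiffAt.sum fun j _ => (hG.inv hdet i j).mul (hr i j)

lemma hamDensity_contDiffAt {G P : MatField} {y : E3} (hG : SmoothMat G y) (hdet : (G y).det ≠ 0)
    (hP : SmoothMat P y) : ContDiffAt ℝ ∞ (hamDensity G P) y := by
  have hi := hG.inv hdet
  have htr : ContDiffAt ℝ ∞ (trLocal G P) y :=
    ContDiffAt.sum fun a _ => ContDiffAt.sum fun b _ => (hi a b).mul (hP a b)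
  have hsq : ContDiffAt ℝ ∞ (sqLocal G P) y :=
    ContDiffAt.sum fun a _ => ContDiffAt.sum fun b _ => (hP a b).mul
      (ContDiffAt.sum fun c _ => ContDiffAt.sum fun d _ => ((hi a c).mul (hi b d)).mul (hP c d))
  exact ((scalarCurv_contDiffAt hG hdet).sub hsq).add (htr.pow 2)

/-- The Hamiltonian density as a function on the manifold, computed at each point in the preferred
chart there. -/
def hamScalar (T P : TwoTensor M) (x : M) : ℝ :=
  hamDensity (components (chartAt E3 x) T) (components (chartAt E3 x) P) (chartAt E3 x x)

lemma hamScalar_eq {T P : TwoTensor M} (h : IsMetric T)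
    (hP : ∀ x v w, P x v w = P x w v) (he : e ∈ IsManifold.maximalAtlas (𝓡 3) ∞ M)
    {x : M} (hx : x ∈ e.source) :
    hamScalar T P x = hamDensity (components e T) (components e P) (e x) :=
  hamDensity_components h hP (IsManifold.chart_mem_maximalAtlas x) he (mem_chart_source E3 x) hx

lemma hamScalar_smooth {T P : TwoTensor M} (h : IsMetric T) (hP : ∀ x v w, P x v w = P x w v)
    (hPs : ∀ x, SmoothTensorAt P x) : ContMDiff (𝓡 3) 𝓘(ℝ, ℝ) ∞ (hamScalar T P) := by
  intro x
  have hx := mem_chart_source E3 x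
  have he : chartAt E3 x ∈ IsManifold.maximalAtlas (𝓡 3) ∞ M := IsManifold.chart_mem_maximalAtlas x
  have hev : hamScalar T P =ᶠ[𝓝 x] fun z => hamDensity (components (chartAt E3 x) T)
      (components (chartAt E3 x) P) (chartAt E3 x z) := by
    filter_upwards [(chartAt E3 x).open_source.mem_nhds hx] with z hz using hamScalar_eq h hP he hz
  refine ContMDiffAt.congr_of_eventuallyEq ?_ hev
  have hy := (chartAt E3 x).map_source hx
  exact (contMDiffAt_iff_contDiffAt.2 (hamDensity_contDiffAt (h.smooth_components he hy)
    (h.det_components he hy) ((smoothTensorAt_iff he P hx).1 (hPs x)))).comp x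
      (contMDiffAt_of_mem_maximalAtlas he hx)

end Metric

/-! ### Umbilic data -/

lemma trLocal_smul {G : MatField} {y : E3} (hG : ∀ z, (G z).IsSymm) (hdet : (G y).det ≠ 0) (c : ℝ) :
    trLocal G (fun z => c • G z) y = 3 * c := by
  rw [trLocal_eq_trace fun z => (hG z).smul c, Matrix.mul_smul,
    Matrix.nonsing_inv_mul _ (isUnit_iff_ne_zero.2 hdet)]
  simp [mul_comm]

lemma hamDensity_smul {G : MatField} {y : E3} (hG : ∀ z, (G z).IsSymm) (hdet : (G y).det ≠ 0)
    (c : ℝ) : hamDensity G (fun z => c • G z) y = scalarCurv G y + 6 * c ^ 2 := by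
  rw [hamDensity, trLocal_smul hG hdet, sqLocal_eq_trace hG fun z => (hG z).smul c, Matrix.mul_smul,
    Matrix.nonsing_inv_mul _ (isUnit_iff_ne_zero.2 hdet)]
  simp
  ring

lemma divMomentum_smul {G : MatField} {y : E3} (hG : ∀ z, (G z).IsSymm)
    (hs : SmoothMat G y) (hdet : (G y).det ≠ 0) (c : ℝ) (a : Fin 3) :
    divMomentum G (fun z => c • G z) a y = 0 := by
  have hev : momentumMat G (fun z => c • G z) =ᶠ[𝓝 y] fun z => (fun _ => -2 * c) z • (G z)⁻¹ := by
    filter_upwards [hs.det.continuousAt.eventually_ne hdet] with z hz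
    rw [momentumMat_eq hG fun z => (hG z).smul c, Matrix.mul_smul,
      Matrix.nonsing_inv_mul _ (isUnit_iff_ne_zero.2 hz), Matrix.smul_mul, Matrix.one_mul, ← sub_smul]
    congr 1
    simp
    ring
  have h0 (k : Fin 3) : covDeriv G (fun z => (fun _ : E3 => -2 * c) z • (G z)⁻¹) k y =
      (-2 * c) • covDeriv G (fun z => (G z)⁻¹) k y := by
    rw [covDeriv, pdMat_smul contDiffAt_const (hs.inv hdet), covDeriv]
    simp only [smul_add, Matrix.mul_smul, Matrix.smul_mul]
    simp [pd]
  rw [divMomentum_eq]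
  refine Finset.sum_eq_zero fun b _ => ?_
  rw [covDeriv_congr (EventuallyEq.refl _ G) hev, h0, covDeriv_metric_inv hG hs hdet, smul_zero]
  rfl

/-! ### Tensors supported in the ends -/

section Pull

variable {M : Type*} [TopologicalSpace M] [ChartedSpace E3 M]

/-- The derivative of a chart, as an endomorphism of the model space. -/
def chartMap (e : OpenPartialHomeomorph M E3) (x : M) : E3 →L[ℝ] E3 := mfderiv (𝓡 3) (𝓡 3) e x

open Classical in
/-- The 2-tensor with components `Q` in the chart `e`, extended by zero outside of the domain of
`e`. -/
def pullTensor (e : OpenPartialHomeomorph M E3) (Q : MatField) : TwoTensor M := fun x =>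
  if x ∈ e.source then
    ((bilinOfMat (Q (e x))).bilinearComp (chartMap e x) (chartMap e x) : E3 →L[ℝ] E3 →L[ℝ] ℝ)
  else 0

lemma pullTensor_apply {e : OpenPartialHomeomorph M E3} (Q : MatField) {x : M} (hx : x ∈ e.source)
    (v w : TangentSpace (𝓡 3) x) : pullTensor e Q x v w =
      bilinOfMat (Q (e x)) (chartMap e x v) (chartMap e x w) := by
  exact congrArg (fun B : E3 →L[ℝ] E3 →L[ℝ] ℝ => B v w) (if_pos hx)

lemma pullTensor_of_notMem {e : OpenPartialHomeomorph M E3} (Q : MatField) {x : M}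
    (hx : x ∉ e.source) : pullTensor e Q x = 0 := if_neg hx

lemma bilinOfMat_symm {A : Matrix (Fin 3) (Fin 3) ℝ} (hA : A.IsSymm) (u v : E3) :
    bilinOfMat A u v = bilinOfMat A v u := by
  rw [bilinOfMat_apply, bilinOfMat_apply, Finset.sum_comm]
  exact Finset.sum_congr rfl fun a _ => Finset.sum_congr rfl fun b _ => by
    rw [hA.apply a b]; ring

lemma pullTensor_symm (e : OpenPartialHomeomorph M E3) {Q : MatField} (hQ : ∀ y, (Q y).IsSymm)
    (x : M) (v w : TangentSpace (𝓡 3) x) : pullTensor e Q x v w = pullTensor e Q x w v := by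
  by_cases hx : x ∈ e.source
  · rw [pullTensor_apply _ hx, pullTensor_apply _ hx]; exact bilinOfMat_symm (hQ _) _ _
  · rw [pullTensor_of_notMem _ hx]; rfl

lemma bilinOfMat_one (v : E3) : bilinOfMat 1 v v = ‖v‖ ^ 2 := by
  rw [bilinOfMat_apply, EuclideanSpace.norm_sq_eq]
  simp [Matrix.one_apply, sq]

lemma chartMap_ne_zero {e : OpenPartialHomeomorph M E3}
    (he : e ∈ IsManifold.maximalAtlas (𝓡 3) ∞ M) {x : M} (hx : x ∈ e.source)
    {v : TangentSpace (𝓡 3) x} (hv : v ≠ 0) : chartMap e x v ≠ 0 := fun h =>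
  hv ((mdifferentiable_of_mem he).mfderiv_injective hx (h.trans (map_zero _).symm))

variable {e : OpenPartialHomeomorph M E3}

lemma components_pullTensor (he : e ∈ IsManifold.maximalAtlas (𝓡 3) ∞ M) (Q : MatField) {y : E3}
    (hy : y ∈ e.target) : components e (pullTensor e Q) y = Q y := by
  ext a b
  have hx := e.map_target hy
  have h (c : Fin 3) : chartMap e (e.symm y) (coordVec e c y) = basisVec c :=
    congrArg (fun L : E3 →L[ℝ] E3 => L (basisVec c)) ((mdifferentiable_of_mem he).comp_symm_deriv hy)
  change pullTensor e Q (e.symm y) (coordVec e a y) (coordVec e b y) = _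
  rw [pullTensor_apply _ hx]
  rw [h a, h b, bilinOfMat_basisVec, e.right_inv hy]

variable [IsManifold (𝓡 3) ∞ M]

lemma pullTensor_smooth (he : e ∈ IsManifold.maximalAtlas (𝓡 3) ∞ M) {Q : MatField} {x : M}
    (hx : x ∈ e.source) (hQ : SmoothMat Q (e x)) : SmoothTensorAt (pullTensor e Q) x := by
  rw [smoothTensorAt_iff he _ hx]
  refine hQ.congr ?_
  filter_upwards [e.open_target.mem_nhds (e.map_source hx)] with y hy
  exact components_pullTensor he Q hy

lemma SmoothTensorAt.congr {T T' : TwoTensor M} {x : M} (h : SmoothTensorAt T x)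
    (hT : ∀ᶠ z in 𝓝 x, T' z = T z) : SmoothTensorAt T' x := by
  refine ContMDiffAt.congr_of_eventuallyEq h ?_
  filter_upwards [hT] with z hz
  rw [hz]

lemma SmoothTensorAt.add {T P : TwoTensor M} {x : M} (hT : SmoothTensorAt T x)
    (hP : SmoothTensorAt P x) : SmoothTensorAt (T + P) x := by
  rw [smoothTensorAt_iff_chartAt] at *
  exact hT.add hP

lemma SmoothTensorAt.smul {T : TwoTensor M} {x : M} (hT : SmoothTensorAt T x) (c : ℝ) :
    SmoothTensorAt (c • T) x := by
  rw [smoothTensorAt_iff_chartAt] at *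
  exact SmoothMat.smul (f := fun _ => c) contDiffAt_const hT

lemma smoothTensorAt_zero (x : M) : SmoothTensorAt (0 : TwoTensor M) x := by
  rw [smoothTensorAt_iff_chartAt]
  exact fun a b => contDiffAt_const (c := (0 : ℝ))

end Pull

namespace AsymptoticEnds

variable {M : Type*} [TopologicalSpace M] [ChartedSpace E3 M]
  (E : AsymptoticEnds M)

/-- The part `|y|²/2 ≥ S` of the `i`-th end. -/
def endSet (i : Fin E.n) (S : ℝ) : Set M := {x | x ∈ (E.chart i).source ∧ S ≤ halfSq (E.chart i x)}

variable {E}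

lemma mem_target {i : Fin E.n} {y : E3} : y ∈ (E.chart i).target ↔ E.radius i < ‖y‖ := by
  rw [E.target_eq]; simp

lemma halfSq_pos_of_mem {i : Fin E.n} {x : M} (hx : x ∈ (E.chart i).source) :
    0 < halfSq (E.chart i x) := by
  have := mem_target.1 ((E.chart i).map_source hx)
  have h2 := E.radius_pos i
  unfold halfSq
  have : 0 < ‖E.chart i x‖ := h2.trans this
  positivity

lemma eq_of_mem_source {i j : Fin E.n} {x : M} (hi : x ∈ (E.chart i).source)
    (hj : x ∈ (E.chart j).source) : i = j := by
  by_contra h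
  exact Set.disjoint_left.1 (E.disjoint h) hi hj

lemma mem_target_of_le {i : Fin E.n} {S : ℝ} (hS : E.radius i ^ 2 / 2 < S) {y : E3}
    (hy : S ≤ halfSq y) : y ∈ (E.chart i).target := by
  rw [mem_target]
  unfold halfSq at hy
  exact lt_of_pow_lt_pow_left₀ 2 (norm_nonneg _) (by linarith)

/-- Far parts of the ends are closed: the points of a compact set lying in such a part are those of
a compact annulus. -/
lemma isClosed_endSet [T2Space M] {i : Fin E.n} {S : ℝ} (hS : E.radius i ^ 2 / 2 < S) :
    IsClosed (E.endSet i S) := by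
  have : LocallyCompactSpace M := ChartedSpace.locallyCompactSpace E3 M
  refine isClosed_of_closure_subset fun x hx => ?_
  obtain ⟨K, hK, hxK⟩ := exists_compact_mem_nhds x
  obtain ⟨r, hr⟩ := E.bounded_on_compact i K hK
  set A : Set E3 := {y | S ≤ halfSq y} ∩ Metric.closedBall 0 r
  have hA : IsCompact A := (isCompact_closedBall (0 : E3) r).inter_left
    (isClosed_le continuous_const halfSq_contDiff.continuous)
  have hAt : A ⊆ (E.chart i).target := fun y hy => mem_target_of_le hS hy.1
  have hAc : IsCompact ((E.chart i).symm '' A) :=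
    hA.image_of_continuousOn ((E.chart i).continuousOn_symm.mono hAt)
  have hsub : E.endSet i S ∩ K ⊆ (E.chart i).symm '' A := fun z hz =>
    ⟨E.chart i z, ⟨hz.1.2, by simpa using hr z hz.2 hz.1.1⟩, (E.chart i).left_inv hz.1.1⟩
  have hx' : x ∈ closure (E.endSet i S ∩ K) := by
    rw [mem_closure_iff_nhds] at hx ⊢
    intro t ht
    obtain ⟨z, hz1, hz2⟩ := hx (t ∩ K) (inter_mem ht hxK)
    exact ⟨z, hz1.1, hz2, hz1.2⟩
  obtain ⟨y, hy, rfl⟩ := hAc.isClosed.closure_subset_iff.2 hsub hx'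
  refine ⟨(E.chart i).map_target (hAt hy), ?_⟩
  rw [(E.chart i).right_inv (hAt hy)]
  exact hy.1

lemma isClosed_iUnion_endSet [T2Space M] {S : ℝ} (hS : ∀ i, E.radius i ^ 2 / 2 < S) :
    IsClosed (⋃ i, E.endSet i S) := isClosed_iUnion_of_finite fun i => isClosed_endSet (hS i)

variable (E) in
/-- The tensor with components `Q` on each end, extended by zero. -/
def endTensor (Q : MatField) : TwoTensor M := ∑ i, pullTensor (E.chart i) Q

lemma endTensor_apply (Q : MatField) (x : M) :
    E.endTensor Q x = ∑ i, pullTensor (E.chart i) Q x := Finset.sum_apply _ _ _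

lemma endTensor_of_mem (Q : MatField) {i : Fin E.n} {x : M} (hx : x ∈ (E.chart i).source) :
    E.endTensor Q x = pullTensor (E.chart i) Q x := by
  rw [endTensor_apply]
  refine Finset.sum_eq_single i (fun j _ hj => ?_) (by simp)
  exact pullTensor_of_notMem _ fun h => hj (eq_of_mem_source h hx)

lemma endTensor_of_notMem (Q : MatField) {x : M} (hx : ∀ i, x ∉ (E.chart i).source) :
    E.endTensor Q x = 0 := by
  rw [endTensor_apply]
  exact Finset.sum_eq_zero fun i _ => pullTensor_of_notMem _ (hx i)

lemma endTensor_symm {Q : MatField} (hQ : ∀ y, (Q y).IsSymm) (x : M)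
    (v w : TangentSpace (𝓡 3) x) : E.endTensor Q x v w = E.endTensor Q x w v := by
  by_cases h : ∃ i, x ∈ (E.chart i).source
  · obtain ⟨i, hi⟩ := h
    rw [endTensor_of_mem Q hi, pullTensor_symm _ hQ]
  · push Not at h
    rw [endTensor_of_notMem Q h]; rfl

lemma endTensor_eq_zero {S : ℝ} {Q : MatField}
    (hQ : ∀ y, 0 < halfSq y → halfSq y < S → Q y = 0) {x : M}
    (hx : ∀ i, x ∉ E.endSet i S) : E.endTensor Q x = 0 := by
  by_cases h : ∃ i, x ∈ (E.chart i).source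
  · obtain ⟨i, hi⟩ := h
    have h0 : Q (E.chart i x) = 0 :=
      hQ _ (halfSq_pos_of_mem hi) (not_le.1 fun h => hx i ⟨hi, h⟩)
    rw [endTensor_of_mem Q hi]
    ext v w
    rw [pullTensor_apply _ hi, h0, bilinOfMat_apply]
    simp
  · push Not at h
    exact endTensor_of_notMem Q h

lemma endTensor_smooth [T2Space M] [IsManifold (𝓡 3) ∞ M] {S : ℝ}
    (hS : ∀ i, E.radius i ^ 2 / 2 < S) {Q : MatField}
    (hQs : ∀ y, 0 < halfSq y → SmoothMat Q y)
    (hQ : ∀ y, 0 < halfSq y → halfSq y < S → Q y = 0) (x : M) :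
    SmoothTensorAt (E.endTensor Q) x := by
  by_cases h : ∃ i, x ∈ (E.chart i).source
  · obtain ⟨i, hi⟩ := h
    refine (pullTensor_smooth (E.chart_mem i) hi (hQs _ (halfSq_pos_of_mem hi))).congr ?_
    filter_upwards [(E.chart i).open_source.mem_nhds hi] with z hz using endTensor_of_mem Q hz
  · push Not at h
    refine (smoothTensorAt_zero x).congr ?_
    have hx : x ∉ ⋃ i, E.endSet i S := by
      simp only [Set.mem_iUnion, not_exists]
      exact fun i hi => h i hi.1
    filter_upwards [(isClosed_iUnion_endSet hS).isOpen_compl.mem_nhds hx] with z hz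
    refine endTensor_eq_zero hQ ?_
    simpa using hz

lemma components_endTensor (Q : MatField) {i : Fin E.n} {y : E3} (hy : y ∈ (E.chart i).target) :
    components (E.chart i) (E.endTensor Q) y = Q y := by
  rw [← components_pullTensor (E.chart_mem i) Q hy]
  ext a b
  rw [components_apply, components_apply, tensorEval, tensorEval,
    endTensor_of_mem Q ((E.chart i).map_target hy)]

set_option synthInstance.maxHeartbeats 200000 in
set_option maxHeartbeats 1000000 in
/-- Local flat metrics, glued by a partition of unity, give a metric which is flat far out in each
end. -/
lemma exists_flat_metric [T2Space M] [IsManifold (𝓡 3) ∞ M] [SecondCountableTopology M] {S : ℝ}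
    (hS : ∀ i, E.radius i ^ 2 / 2 < S) : ∃ T : TwoTensor M, IsMetric T ∧
      ∀ i y, S ≤ halfSq y → components (E.chart i) T y = 1 := by
  have : LocallyCompactSpace M := ChartedSpace.locallyCompactSpace E3 M
  let t : ∀ x : M, Set (TangentSpace (𝓡 3) x →L[ℝ] TangentSpace (𝓡 3) x →L[ℝ] ℝ) := fun x =>
    {B | (∀ v w, B v w = B w v) ∧ (∀ v, v ≠ 0 → 0 < B v v) ∧
      ∀ i, x ∈ E.endSet i S → ∀ v w, B v w = pullTensor (E.chart i) (fun _ => 1) x v w}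
  have hconv : ∀ x, Convex ℝ (t x) := by
    rintro x B ⟨h1, h2, h3⟩ B' ⟨h1', h2', h3'⟩ a b ha hb hab
    refine ⟨fun v w => ?_, fun v hv => ?_, fun i hi v w => ?_⟩
    · simp [h1 v w, h1' v w]
    · have hB := h2 v hv
      have hB' := h2' v hv
      simp only [_root_.add_apply, _root_.smul_apply, smul_eq_mul]
      rcases ha.eq_or_lt with rfl | ha
      · rw [zero_add] at hab
        subst hab; simpa using hB'
      · exact add_pos_of_pos_of_nonneg (mul_pos ha hB) (mul_nonneg hb hB'.le)
    · simp only [_root_.add_apply, _root_.smul_apply, smul_eq_mul, h3 i hi, h3' i hi, ← add_mul,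
        hab, one_mul]
  have hpos {e : OpenPartialHomeomorph M E3} (he : e ∈ IsManifold.maximalAtlas (𝓡 3) ∞ M) {x : M}
      (hx : x ∈ e.source) (v : TangentSpace (𝓡 3) x) (hv : v ≠ 0) :
      0 < pullTensor e (fun _ => 1) x v v := by
    rw [pullTensor_apply _ hx]
    rw [bilinOfMat_one]
    have := norm_pos_iff.2 (chartMap_ne_zero he hx hv)
    positivity
  have hsymm (e : OpenPartialHomeomorph M E3) (x : M) (v w : TangentSpace (𝓡 3) x) :
      pullTensor e (fun _ => 1) x v w = pullTensor e (fun _ => 1) x w v :=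
    pullTensor_symm e (fun _ => Matrix.isSymm_one) x v w
  have hsmooth {e : OpenPartialHomeomorph M E3} (he : e ∈ IsManifold.maximalAtlas (𝓡 3) ∞ M)
      {x : M} (hx : x ∈ e.source) : SmoothTensorAt (pullTensor e (fun _ => 1)) x :=
    pullTensor_smooth he hx fun a b => contDiffAt_const
  obtain ⟨s, hs⟩ := exists_contMDiffSection_forall_mem_convex_of_local (I := 𝓡 3)
    (n := (⊤ : ℕ∞)) (F_fiber := E3 →L[ℝ] E3 →L[ℝ] ℝ)
    (V := fun x : M => TangentSpace (𝓡 3) x →L[ℝ] TangentSpace (𝓡 3) x →L[ℝ] ℝ) t hconv (by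
      intro x₀
      by_cases h : ∃ i, x₀ ∈ (E.chart i).source
      · obtain ⟨i, hi⟩ := h
        refine ⟨(E.chart i).source, (E.chart i).open_source.mem_nhds hi,
          pullTensor (E.chart i) fun _ => 1,
          fun x hx => (hsmooth (E.chart_mem i) hx).contMDiffWithinAt,
          fun x hx => ⟨hsymm _ x, hpos (E.chart_mem i) hx, fun j hj v w => ?_⟩⟩
        rw [eq_of_mem_source hx hj.1]
      · push Not at h
        have he : chartAt E3 x₀ ∈ IsManifold.maximalAtlas (𝓡 3) ∞ M :=
          IsManifold.chart_mem_maximalAtlas x₀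
        have hx₀ : x₀ ∉ ⋃ i, E.endSet i S := by
          simp only [Set.mem_iUnion, not_exists]
          exact fun i hi => h i hi.1
        refine ⟨(chartAt E3 x₀).source ∩ (⋃ i, E.endSet i S)ᶜ,
          inter_mem ((chartAt E3 x₀).open_source.mem_nhds (mem_chart_source E3 x₀))
            ((isClosed_iUnion_endSet hS).isOpen_compl.mem_nhds hx₀),
          pullTensor (chartAt E3 x₀) fun _ => 1,
          fun x hx => (hsmooth he hx.1).contMDiffWithinAt,
          fun x hx => ⟨hsymm _ x, hpos he hx.1, fun j hj v w => ?_⟩⟩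
        exact absurd (Set.mem_iUnion.2 ⟨j, hj⟩) hx.2)
  refine ⟨fun x => s x, ⟨fun x => (hs x).1, fun x => (hs x).2.1, fun x => s.contMDiff x⟩,
    fun i y hy => ?_⟩
  have hyt := mem_target_of_le (hS i) hy
  have hmem : (E.chart i).symm y ∈ E.endSet i S := by
    refine ⟨(E.chart i).map_target hyt, ?_⟩
    rwa [(E.chart i).right_inv hyt]
  rw [← components_pullTensor (E.chart_mem i) (fun _ => 1) hyt]
  ext a b
  exact (hs _).2.2 i hmem _ _

end AsymptoticEnds

/-! ### Geodesics in coordinates -/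

/-- The flow of a `C¹` vector field exists for a uniform time, inside a prescribed neighbourhood,
from all points close to a given one. -/
lemma exists_local_flow {X : Type*} [NormedAddCommGroup X] [NormedSpace ℝ X] [CompleteSpace X]
    {F : X → X} {z₀ : X} (hF : ContDiffAt ℝ 1 F z₀) {V : Set X} (hV : V ∈ 𝓝 z₀) :
    ∃ r > (0 : ℝ), ∃ ε > (0 : ℝ), ∀ z ∈ Metric.closedBall z₀ r, ∀ t₀ : ℝ, ∃ α : ℝ → X, α t₀ = z ∧
      ∀ t ∈ Set.Ioo (t₀ - ε) (t₀ + ε), α t ∈ V ∧ HasDerivAt α (F (α t)) t := by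
  obtain ⟨ε, hε, a, r, L, K, hr, h⟩ := IsPicardLindelof.of_contDiffAt_one hF
  obtain ⟨α, hα, hc⟩ := (h 0).exists_forall_mem_closedBall_eq_hasDerivWithinAt_continuousOn
  have hmem : Metric.closedBall z₀ (r : ℝ) ×ˢ Set.Icc (0 - ε) (0 + ε) ∈ 𝓝 (z₀, (0 : ℝ)) :=
    prod_mem_nhds (Metric.closedBall_mem_nhds _ hr) (Icc_mem_nhds (by linarith) (by linarith))
  have hc0 : ContinuousAt α (z₀, 0) := hc.continuousAt hmem
  have h0 : α (z₀, 0) = z₀ := (hα z₀ (Metric.mem_closedBall_self hr.le)).1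
  have hV' : ∀ᶠ p in 𝓝 (z₀, (0 : ℝ)), α p ∈ V ∧
      p ∈ Metric.closedBall z₀ (r : ℝ) ×ˢ Set.Icc (0 - ε) (0 + ε) :=
    (hc0.eventually (by rwa [h0])).and hmem
  obtain ⟨δ, hδ, hball⟩ := Metric.eventually_nhds_iff_ball.1 hV'
  refine ⟨δ / 2, by positivity, min δ ε, lt_min hδ hε, fun z hz t₀ => ?_⟩
  have hzt : ∀ t ∈ Set.Ioo (-min δ ε) (min δ ε), (z, t) ∈ Metric.ball (z₀, (0 : ℝ)) δ := by
    intro t ht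
    rw [← ball_prod_same]
    refine ⟨Metric.closedBall_subset_ball (by linarith) hz, ?_⟩
    rw [Metric.mem_ball, Real.dist_eq, sub_zero, abs_lt]
    exact ⟨by linarith [ht.1, min_le_left δ ε], by linarith [ht.2, min_le_left δ ε]⟩
  have hzr : z ∈ Metric.closedBall z₀ (r : ℝ) :=
    (hball _ (hzt 0 ⟨by simp [hδ, hε], by simp [hδ, hε]⟩)).2.1
  refine ⟨fun t => α (z, t - t₀), by simp [(hα z hzr).1], fun t ht => ?_⟩
  have ht' : t - t₀ ∈ Set.Ioo (-min δ ε) (min δ ε) := ⟨by linarith [ht.1], by linarith [ht.2]⟩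
  refine ⟨(hball _ (hzt _ ht')).1, ?_⟩
  have hI : Set.Icc (0 - ε) (0 + ε) ∈ 𝓝 (t - t₀) :=
    Icc_mem_nhds (by linarith [ht'.1, min_le_right δ ε]) (by linarith [ht'.2, min_le_right δ ε])
  exact (((hα z hzr).2 _ (mem_of_mem_nhds hI)).hasDerivAt hI).comp_sub_const t t₀

/-- Solutions of an autonomous equation with smooth right-hand side are smooth. -/
lemma contDiffAt_of_ode {X : Type*} [NormedAddCommGroup X] [NormedSpace ℝ X] [CompleteSpace X]
    {F : X → X} {z : ℝ → X} {t : ℝ} (hF : ContDiffAt ℝ ∞ F (z t))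
    (hz : ∀ᶠ s in 𝓝 t, HasDerivAt z (F (z s)) s) : ContDiffAt ℝ ∞ z t := by
  rw [contDiffAt_infty]
  intro n
  obtain ⟨u, hu, hFu⟩ := (hF.of_le (m := (n : WithTop ℕ∞)) (by exact_mod_cast le_top)).contDiffOn
    le_rfl (by simp)
  have hu' : u ∈ 𝓝 (z t) := by simpa using hu
  have hev := hz.and (hz.self_of_nhds.continuousAt.eventually hu')
  obtain ⟨δ, hδ, hball⟩ := Metric.eventually_nhds_iff_ball.1 hev
  have hsub : ∀ s ∈ Set.Icc (t - δ / 2) (t + δ / 2), s ∈ Metric.ball t δ := fun s hs => by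
    rw [Metric.mem_ball, Real.dist_eq, abs_lt]
    exact ⟨by linarith [hs.1], by linarith [hs.2]⟩
  have := ODE.contDiffOn_enat_Icc_of_hasDerivWithinAt (f := fun _ => F) (α := z) (u := u)
    (n := (n : ℕ∞)) (tmin := t - δ / 2) (tmax := t + δ / 2)
    (hFu.comp contDiff_snd.contDiffOn fun p hp => hp.2)
    (fun s hs => (hball s (hsub s hs)).1.hasDerivWithinAt) (fun s hs => (hball s (hsub s hs)).2)
  exact this.contDiffAt (Icc_mem_nhds (by linarith) (by linarith))

lemma hasDerivAt_coord_iff {y : ℝ → E3} {v : E3} {t : ℝ} :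
    HasDerivAt y v t ↔ ∀ k, HasDerivAt (fun s => y s k) (v k) t := by
  rw [← hasDerivWithinAt_univ, hasDerivWithinAt_iff_hasFDerivWithinAt, hasFDerivWithinAt_euclidean]
  refine forall_congr' fun k => ?_
  rw [← hasDerivWithinAt_univ, hasDerivWithinAt_iff_hasFDerivWithinAt]
  refine iff_of_eq (congrArg (fun L => HasFDerivWithinAt _ L Set.univ t) ?_)
  ext; simp

/-- The acceleration `-Γ^k_ij v^i v^j` of a geodesic. -/
def spray (G : MatField) (y v : E3) : E3 :=
  WithLp.toLp 2 fun k => -∑ i, ∑ j, christoffel G k i j y * v i * v j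

lemma spray_apply (G : MatField) (y v : E3) (k : Fin 3) :
    spray G y v k = -∑ i, ∑ j, christoffel G k i j y * v i * v j := rfl

/-- The geodesic equation as a vector field on phase space. -/
def sprayField (G : MatField) (z : E3 × E3) : E3 × E3 := (z.2, spray G z.1 z.2)

lemma contDiffAt_sprayField {G : MatField} {z : E3 × E3} (hG : SmoothMat G z.1)
    (hdet : (G z.1).det ≠ 0) : ContDiffAt ℝ ∞ (sprayField G) z := by
  refine contDiffAt_snd.prodMk (contDiffAt_euclidean.2 fun k => ?_)
  refine ContDiffAt.neg (ContDiffAt.sum fun i _ => ContDiffAt.sum fun j _ => ?_)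
  have h1 : ContDiffAt ℝ ∞ (christoffel G k i j) z.1 := connMat_smooth hG hdet i k j
  exact ((h1.comp z contDiffAt_fst).mul ((contDiffAt_coordinate i z.2).comp z contDiffAt_snd)).mul
    ((contDiffAt_coordinate j z.2).comp z contDiffAt_snd)

/-- The curve `y` satisfies the geodesic equation of the metric `G` near the time `t`. -/
def SolvesAt (G : MatField) (y : ℝ → E3) (t : ℝ) : Prop :=
  ∀ᶠ s in 𝓝 t, HasDerivAt y (deriv y s) s ∧ HasDerivAt (deriv y) (spray G (y s) (deriv y s)) s

namespace SolvesAt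

variable {G H : MatField} {y y' : ℝ → E3} {t : ℝ}

lemma congr (h : SolvesAt G y t) (hy : y' =ᶠ[𝓝 t] y) : SolvesAt G y' t := by
  filter_upwards [h, hy.eventuallyEq_nhds] with s hs hys
  rw [hys.deriv_eq, hys.eq_of_nhds]
  exact ⟨hs.1.congr_of_eventuallyEq hys, hs.2.congr_of_eventuallyEq hys.deriv⟩

lemma hasDerivAt (h : SolvesAt G y t) : HasDerivAt y (deriv y t) t := h.self_of_nhds.1

lemma hasDerivAt_deriv (h : SolvesAt G y t) :
    HasDerivAt (deriv y) (spray G (y t) (deriv y t)) t := h.self_of_nhds.2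

lemma hasDerivAt_phase (h : SolvesAt G y t) : ∀ᶠ s in 𝓝 t,
    HasDerivAt (fun s => (y s, deriv y s)) (sprayField G (y s, deriv y s)) s := by
  filter_upwards [h] with s hs
  exact hs.1.prodMk hs.2

lemma of_phase {z : ℝ → E3 × E3} (h : ∀ᶠ s in 𝓝 t, HasDerivAt z (sprayField G (z s)) s) :
    SolvesAt G (fun s => (z s).1) t := by
  have h1 : ∀ᶠ s in 𝓝 t, HasDerivAt (fun s => (z s).1) (z s).2 s := h.mono fun s hs => by
    exact (hasFDerivAt_fst.comp_hasDerivAt s hs :)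
  filter_upwards [h, h1, h1.eventually_nhds] with s hs h1s h2s
  have hd : deriv (fun s => (z s).1) =ᶠ[𝓝 s] fun s => (z s).2 := h2s.mono fun s hs => hs.deriv
  rw [h1s.deriv]
  refine ⟨h1s, HasDerivAt.congr_of_eventuallyEq ?_ hd⟩
  exact (hasFDerivAt_snd.comp_hasDerivAt s hs :)

lemma contDiffAt (h : SolvesAt G y t) (hG : SmoothMat G (y t)) (hdet : (G (y t)).det ≠ 0) :
    ContDiffAt ℝ ∞ y t :=
  (contDiffAt_of_ode (z := fun s => (y s, deriv y s))
    (contDiffAt_sprayField (z := (y t, deriv y t)) hG hdet) h.hasDerivAt_phase).fst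

/-- Two geodesics with the same initial position and velocity agree. -/
lemma unique (h : SolvesAt G y t) (h' : SolvesAt G y' t) (hG : SmoothMat G (y t))
    (hdet : (G (y t)).det ≠ 0) (h0 : y t = y' t) (h1 : deriv y t = deriv y' t) : y =ᶠ[𝓝 t] y' := by
  obtain ⟨K, s, hs, hL⟩ := ((contDiffAt_sprayField (z := (y t, deriv y t)) hG hdet).of_le
    (m := 1) (by simp)).exists_lipschitzOnWith
  have hmem {x : ℝ → E3} (hx : SolvesAt G x t) (hs : s ∈ 𝓝 (x t, deriv x t)) :
      ∀ᶠ r in 𝓝 t, HasDerivAt (fun r => (x r, deriv x r)) (sprayField G (x r, deriv x r)) r ∧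
        (x r, deriv x r) ∈ s :=
    hx.hasDerivAt_phase.and
      (hx.hasDerivAt_phase.self_of_nhds.continuousAt.eventually (by exact hs))
  have := ODE_solution_unique_of_eventually (v := fun _ => sprayField G) (s := fun _ => s)
    (Eventually.of_forall fun _ => hL) (hmem h hs) (hmem h' (by rwa [← h0, ← h1]))
    (by simp only [h0, h1])
  exact this.mono fun r hr => congrArg Prod.fst hr

/-- The index computation behind `SolvesAt.transition`: with `A` and `B` the Christoffel symbols in
the two coordinate systems, the second derivatives of the coordinate change have been eliminated by
`IsTransition.connMat_law`. -/
lemma transition_identity (J : Fin 3 → Fin 3 → ℝ) (A B : Fin 3 → Fin 3 → Fin 3 → ℝ) (v : Fin 3 → ℝ)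
    (k : Fin 3) : (∑ j, ((∑ i, v i * ((∑ m, J k m * A m i j) -
        ∑ m, (∑ a, J a i * B k a m) * J m j)) * v j + J k j * -∑ i, ∑ l, A j i l * v i * v l)) =
      -∑ i, ∑ j, B k i j * (∑ l, J i l * v l) * ∑ l, J j l * v l := by
  simp only [Fin.sum_univ_three]
  ring

/-- The index computation behind `SolvesAt.hasDerivAt_speed`: with `A` the Christoffel symbols, the
derivatives of the metric `g` have been eliminated by metric compatibility. -/
lemma speed_identity (A : Fin 3 → Fin 3 → Fin 3 → ℝ) (g : Fin 3 → Fin 3 → ℝ) (v : Fin 3 → ℝ) :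
    (∑ a, ∑ b, (((-∑ i, ∑ j, A a i j * v i * v j) * v b + v a * -∑ i, ∑ j, A b i j * v i * v j) *
      g a b + v a * v b * ∑ i, v i * ((∑ m, A m i a * g m b) + ∑ m, g a m * A m i b))) = 0 := by
  obtain ⟨S, hS⟩ : ∃ S : Fin 3 → ℝ, ∀ a, S a = ∑ i, ∑ j, A a i j * v i * v j := ⟨_, fun _ => rfl⟩
  have h1 (a b : Fin 3) : v a * v b * ∑ i, v i * ((∑ m, A m i a * g m b) + ∑ m, g a m * A m i b) =
      (∑ m, (∑ i, A m i a * v i * v a) * (v b * g m b)) +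
        ∑ m, (∑ i, A m i b * v i * v b) * (v a * g a m) := by
    simp only [Fin.sum_univ_three]; ring
  have h2 : ∑ a, ∑ b, ∑ m, (∑ i, A m i a * v i * v a) * (v b * g m b) =
      ∑ m, ∑ b, S m * (v b * g m b) := by
    simp only [hS, Fin.sum_univ_three]; ring
  have h3 : ∑ a, ∑ b, ∑ m, (∑ i, A m i b * v i * v b) * (v a * g a m) =
      ∑ a, ∑ m, S m * (v a * g a m) := by
    simp only [hS, Fin.sum_univ_three]; ring
  simp only [← hS, h1]
  simp only [Finset.sum_add_distrib, h2, h3]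
  simp only [Fin.sum_univ_three]
  ring

/-- The geodesic equation is preserved by changes of coordinates. -/
lemma transition {φ : E3 → E3} (h : SolvesAt H y t)
    (hφ : ∀ᶠ z in 𝓝 (y t), IsTransition φ G H z) : SolvesAt G (fun s => φ (y s)) t := by
  have hφ' := h.hasDerivAt.continuousAt.eventually hφ
  have h1 : ∀ᶠ s in 𝓝 t, HasDerivAt (fun s => φ (y s)) (fderiv ℝ φ (y s) (deriv y s)) s := by
    filter_upwards [h, hφ'] with s hs hφs
    exact (hφs.smooth.differentiableAt (by simp)).hasFDerivAt.comp_hasDerivAt s hs.1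
  filter_upwards [h, hφ', h1, h1.eventually_nhds, hφ'.eventually_nhds] with s hs hφs h1s h2s h3s
  refine ⟨h1s.differentiableAt.hasDerivAt, ?_⟩
  have hJ {r : ℝ} (hr : IsTransition φ G H (y r)) (k : Fin 3) :
      fderiv ℝ φ (y r) (deriv y r) k = ∑ j, jac φ (y r) k j * deriv y r j := by
    rw [fderiv_coord (hr.smooth.differentiableAt (by simp)), fderiv_eq_sum_pd]
    exact Finset.sum_congr rfl fun j _ => mul_comm (deriv y r j) _
  rw [h1s.deriv]
  refine hasDerivAt_coord_iff.2 fun k => ?_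
  have hd : (fun r => deriv (fun s => φ (y s)) r k) =ᶠ[𝓝 s]
      fun r => ∑ j, jac φ (y r) k j * deriv y r j := by
    filter_upwards [h2s, h3s] with r hr hr'
    rw [hr.deriv, hJ hr']
  refine HasDerivAt.congr_of_eventuallyEq ?_ hd
  have hvj (j : Fin 3) : HasDerivAt (fun r => deriv y r j) (spray H (y s) (deriv y s) j) s :=
    hasDerivAt_coord_iff.1 hs.2 j
  have hJd (j : Fin 3) : HasDerivAt (fun r => jac φ (y r) k j)
      (∑ i, deriv y s i * pd i (fun z => jac φ z k j) (y s)) s := by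
    have hsm := smoothMat_jac hφs.smooth k j
    rw [← fderiv_eq_sum_pd]
    exact (differentiableAt_of_smooth hsm).hasFDerivAt.comp_hasDerivAt s hs.1
  have hsum := HasDerivAt.fun_sum fun j (_ : j ∈ Finset.univ) => (hJd j).mul (hvj j)
  refine hsum.congr_deriv ?_
  have law (i c : Fin 3) : pd i (fun z => jac φ z k c) (y s) =
      (∑ j, jac φ (y s) k j * christoffel H j i c (y s)) -
        ∑ m, (∑ a, jac φ (y s) a i * christoffel G k a m (φ (y s))) * jac φ (y s) m c := by
    have := congrFun (congrFun (hφs.connMat_law i) k) c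
    simp only [Matrix.mul_apply, Matrix.add_apply, IsTransition.pullConn, Matrix.sum_apply,
      Matrix.smul_apply,
      smul_eq_mul] at this
    rw [eq_sub_iff_add_eq]
    exact this.symm
  simp only [law, spray_apply, hJ hφs]
  exact transition_identity (fun k j => jac φ (y s) k j) (fun k i j => christoffel H k i j (y s))
    (fun k i j => christoffel G k i j (φ (y s))) (fun j => deriv y s j) k

/-- The squared speed of a geodesic is constant. -/
lemma hasDerivAt_speed (h : SolvesAt G y t) (hG : SmoothMat G (y t)) (hdet : (G (y t)).det ≠ 0)
    (hsymm : ∀ z, (G z).IsSymm) :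
    HasDerivAt (fun s => bilinOfMat (G (y s)) (deriv y s) (deriv y s)) 0 t := by
  have hv (j : Fin 3) : HasDerivAt (fun r => deriv y r j) (spray G (y t) (deriv y t) j) t :=
    hasDerivAt_coord_iff.1 h.hasDerivAt_deriv j
  have hGd (a b : Fin 3) : HasDerivAt (fun r => G (y r) a b)
      (∑ i, deriv y t i * pd i (fun z => G z a b) (y t)) t := by
    rw [← fderiv_eq_sum_pd]
    exact (differentiableAt_of_smooth (hG a b)).hasFDerivAt.comp_hasDerivAt t h.hasDerivAt
  have hsum := HasDerivAt.fun_sum fun a (_ : a ∈ Finset.univ) =>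
    HasDerivAt.fun_sum fun b (_ : b ∈ Finset.univ) => ((hv a).mul (hv b)).mul (hGd a b)
  simp only [bilinOfMat_apply]
  refine hsum.congr_deriv ?_
  have law (i a b : Fin 3) : pd i (fun z => G z a b) (y t) =
      (∑ m, christoffel G m i a (y t) * G (y t) m b) +
        ∑ m, G (y t) a m * christoffel G m i b (y t) :=
    congrFun (congrFun (pdMat_metric hsymm hdet i) a) b
  simp only [law, spray_apply, Pi.mul_apply]
  exact speed_identity (fun k i j => christoffel G k i j (y t)) (fun a b => G (y t) a b)
    (fun j => deriv y t j)

end SolvesAt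

/-! ### Geodesics on a manifold -/

section Geodesic

variable {M : Type*} [TopologicalSpace M] [ChartedSpace E3 M]

/-- The velocity of a curve, in the model space with which every tangent space is identified. -/
def vel (γ : ℝ → M) (t : ℝ) : E3 := (mfderiv 𝓘(ℝ, ℝ) (𝓡 3) γ t : ℝ →L[ℝ] E3) 1

/-- The curve `γ` satisfies the geodesic equation near the time `t`. -/
def GeodesicAt (T : TwoTensor M) (γ : ℝ → M) (t : ℝ) : Prop :=
  ContinuousAt γ t ∧
    SolvesAt (components (chartAt E3 (γ t)) T) (fun s => chartAt E3 (γ t) (γ s)) t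

lemma GeodesicAt.congr {T : TwoTensor M} {γ γ' : ℝ → M} {t : ℝ} (h : GeodesicAt T γ t)
    (hγ : γ' =ᶠ[𝓝 t] γ) : GeodesicAt T γ' t := by
  refine ⟨h.1.congr hγ.symm, ?_⟩
  rw [hγ.eq_of_nhds]
  exact h.2.congr (hγ.mono fun s hs => by simp only [hs])

variable {T : TwoTensor M} {e e' : OpenPartialHomeomorph M E3} {γ η : ℝ → M} {t : ℝ}

lemma chartMap_vel (he : e ∈ IsManifold.maximalAtlas (𝓡 3) ∞ M) (ht : γ t ∈ e.source)
    (hγ : ContMDiffAt 𝓘(ℝ, ℝ) (𝓡 3) ∞ γ t) :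
    chartMap e (γ t) (vel γ t) = deriv (fun s => e (γ s)) t := by
  have h1 := mfderiv_comp t ((mdifferentiable_of_mem he).mdifferentiableAt ht)
    (hγ.mdifferentiableAt (by simp))
  have h2 : mfderiv 𝓘(ℝ, ℝ) (𝓡 3) (e ∘ γ) t = fderiv ℝ (e ∘ γ) t := mfderiv_eq_fderiv
  rw [h2] at h1
  have h3 : fderiv ℝ (e ∘ γ) t 1 = chartMap e (γ t) (vel γ t) :=
    congrArg (fun L : ℝ →L[ℝ] E3 => L 1) h1
  rw [← h3, fderiv_apply_one_eq_deriv]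
  rfl

lemma chartMap_injective (he : e ∈ IsManifold.maximalAtlas (𝓡 3) ∞ M) {x : M}
    (hx : x ∈ e.source) : Function.Injective (chartMap e x) :=
  (mdifferentiable_of_mem he).mfderiv_injective hx

lemma tensorEval_eq_bilinOfMat (he : e ∈ IsManifold.maximalAtlas (𝓡 3) ∞ M) {x : M}
    (hx : x ∈ e.source) (w : E3) : tensorEval T x w w =
      bilinOfMat (components e T (e x)) (chartMap e x w) (chartMap e x w) := by
  have h : chartDeriv e (e x) (chartMap e x w) = w :=
    congrArg (fun L : E3 →L[ℝ] E3 => L w) ((mdifferentiable_of_mem he).symm_comp_deriv hx)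
  rw [bilinOfMat_apply, ← tensorEval_chartDeriv, h, e.left_inv hx]

/-- The squared speed of a curve. -/
def speedSq (T : TwoTensor M) (γ : ℝ → M) (t : ℝ) : ℝ := tensorEval T (γ t) (vel γ t) (vel γ t)

lemma speedSq_eq (he : e ∈ IsManifold.maximalAtlas (𝓡 3) ∞ M) (ht : γ t ∈ e.source)
    (hγ : ContMDiffAt 𝓘(ℝ, ℝ) (𝓡 3) ∞ γ t) : speedSq T γ t =
      bilinOfMat (components e T (e (γ t))) (deriv (fun s => e (γ s)) t)
        (deriv (fun s => e (γ s)) t) := by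
  rw [speedSq, tensorEval_eq_bilinOfMat he ht, chartMap_vel he ht hγ]

variable [IsManifold (𝓡 3) ∞ M]

lemma solvesAt_of_solvesAt (hT : IsMetric T) (he : e ∈ IsManifold.maximalAtlas (𝓡 3) ∞ M)
    (he' : e' ∈ IsManifold.maximalAtlas (𝓡 3) ∞ M) (hc : ContinuousAt γ t)
    (ht : γ t ∈ e.source) (ht' : γ t ∈ e'.source)
    (h : SolvesAt (components e T) (fun s => e (γ s)) t) :
    SolvesAt (components e' T) (fun s => e' (γ s)) t := by
  have hy' : e.symm (e (γ t)) ∈ e'.source := by rwa [e.left_inv ht]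
  refine (h.transition (G := components e' T) (φ := fun z => e' (e.symm z))
    (hT.isTransition_eventually he he' (e.map_source ht) hy')).congr ?_
  filter_upwards [hc.eventually (e.open_source.mem_nhds ht)] with s hs
  rw [e.left_inv hs]

lemma geodesicAt_iff (hT : IsMetric T) (he : e ∈ IsManifold.maximalAtlas (𝓡 3) ∞ M)
    (hc : ContinuousAt γ t) (ht : γ t ∈ e.source) :
    GeodesicAt T γ t ↔ SolvesAt (components e T) (fun s => e (γ s)) t :=
  have hm : chartAt E3 (γ t) ∈ IsManifold.maximalAtlas (𝓡 3) ∞ M :=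
    IsManifold.chart_mem_maximalAtlas (γ t)
  ⟨fun h => solvesAt_of_solvesAt hT hm he hc (mem_chart_source E3 _) ht h.2,
    fun h => ⟨hc, solvesAt_of_solvesAt hT he hm hc ht (mem_chart_source E3 _) h⟩⟩

lemma GeodesicAt.solvesAt (h : GeodesicAt T γ t) (hT : IsMetric T)
    (he : e ∈ IsManifold.maximalAtlas (𝓡 3) ∞ M) (ht : γ t ∈ e.source) :
    SolvesAt (components e T) (fun s => e (γ s)) t := (geodesicAt_iff hT he h.1 ht).1 h

lemma GeodesicAt.contMDiffAt (h : GeodesicAt T γ t) (hT : IsMetric T) :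
    ContMDiffAt 𝓘(ℝ, ℝ) (𝓡 3) ∞ γ t := by
  have he : chartAt E3 (γ t) ∈ IsManifold.maximalAtlas (𝓡 3) ∞ M :=
    IsManifold.chart_mem_maximalAtlas (γ t)
  have ht := mem_chart_source E3 (γ t)
  have hy := (chartAt E3 (γ t)).map_source ht
  have h1 : ContMDiffAt 𝓘(ℝ, ℝ) (𝓡 3) ∞ (fun s => chartAt E3 (γ t) (γ s)) t :=
    contMDiffAt_iff_contDiffAt.2
      (h.2.contDiffAt (hT.smooth_components he hy) (hT.det_components he hy))
  refine ((contMDiffAt_symm_of_mem_maximalAtlas he hy).comp t h1).congr_of_eventuallyEq ?_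
  filter_upwards [h.1.eventually ((chartAt E3 (γ t)).open_source.mem_nhds ht)] with s hs
  exact ((chartAt E3 (γ t)).left_inv hs).symm

lemma hasDerivAt_speedSq (hT : IsMetric T) (h : ∀ᶠ s in 𝓝 t, GeodesicAt T γ s) :
    HasDerivAt (speedSq T γ) 0 t := by
  have he : chartAt E3 (γ t) ∈ IsManifold.maximalAtlas (𝓡 3) ∞ M :=
    IsManifold.chart_mem_maximalAtlas (γ t)
  have ht := mem_chart_source E3 (γ t)
  have hy := (chartAt E3 (γ t)).map_source ht
  have h0 := h.self_of_nhds
  refine (h0.2.hasDerivAt_speed (hT.smooth_components he hy) (hT.det_components he hy)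
    (components_isSymm _ hT.symm)).congr_of_eventuallyEq ?_
  filter_upwards [h, h0.1.eventually ((chartAt E3 (γ t)).open_source.mem_nhds ht)] with s hs hs'
  exact speedSq_eq he hs' (hs.contMDiffAt hT)

lemma speedSq_const (hT : IsMetric T) {s : Set ℝ} (hs : IsOpen s) (hs' : IsPreconnected s)
    (h : ∀ t ∈ s, GeodesicAt T γ t) {t t' : ℝ} (ht : t ∈ s) (ht' : t' ∈ s) :
    speedSq T γ t = speedSq T γ t' := by
  have hd : ∀ r ∈ s, HasDerivAt (speedSq T γ) 0 r := fun r hr =>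
    hasDerivAt_speedSq hT (Filter.mem_of_superset (hs.mem_nhds hr) h)
  exact hs.is_const_of_deriv_eq_zero hs' (fun r hr => (hd r hr).differentiableAt.differentiableWithinAt)
    (fun r hr => (hd r hr).deriv) ht ht'

lemma GeodesicAt.eventuallyEq (hT : IsMetric T) (h : GeodesicAt T γ t) (h' : GeodesicAt T η t)
    (h0 : γ t = η t) (he : e ∈ IsManifold.maximalAtlas (𝓡 3) ∞ M) (ht : γ t ∈ e.source)
    (h1 : deriv (fun s => e (γ s)) t = deriv (fun s => e (η s)) t) : γ =ᶠ[𝓝 t] η := by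
  have ht' : η t ∈ e.source := h0 ▸ ht
  have hy := e.map_source ht
  have := (h.solvesAt hT he ht).unique (h'.solvesAt hT he ht') (hT.smooth_components he hy)
    (hT.det_components he hy) (by rw [h0]) h1
  filter_upwards [this, h.1.eventually (e.open_source.mem_nhds ht),
    h'.1.eventually (e.open_source.mem_nhds ht')] with s hs h2 h3
  exact e.injOn h2 h3 hs

lemma GeodesicAt.eventuallyEq_of_vel (hT : IsMetric T) (h : GeodesicAt T γ t)
    (h' : GeodesicAt T η t) (h0 : γ t = η t) (h1 : vel γ t = vel η t) : γ =ᶠ[𝓝 t] η := by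
  have he : chartAt E3 (γ t) ∈ IsManifold.maximalAtlas (𝓡 3) ∞ M :=
    IsManifold.chart_mem_maximalAtlas (γ t)
  have ht := mem_chart_source E3 (γ t)
  have ht' : η t ∈ (chartAt E3 (γ t)).source := h0 ▸ ht
  refine h.eventuallyEq hT h' h0 he ht ?_
  rw [← chartMap_vel he ht (h.contMDiffAt hT), ← chartMap_vel he ht' (h'.contMDiffAt hT), h0, h1]

/-- Two geodesics which agree near one time agree as long as both are defined. -/
lemma eqOn_of_geodesicAt [T2Space M] (hT : IsMetric T) {s : Set ℝ} (hs : IsPreconnected s)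
    (h : ∀ t ∈ s, GeodesicAt T γ t) (h' : ∀ t ∈ s, GeodesicAt T η t) {t₀ : ℝ} (ht₀ : t₀ ∈ s)
    (h0 : γ =ᶠ[𝓝 t₀] η) : ∀ t ∈ s, γ =ᶠ[𝓝 t] η := by
  refine hs.subset_of_closure_inter_subset (u := {t | γ =ᶠ[𝓝 t] η})
    isOpen_setOfPred_eventually_nhds ⟨t₀, ht₀, h0⟩ ?_
  rintro t ⟨ht, hts⟩
  have hfreq : ∃ᶠ r in 𝓝 t, γ =ᶠ[𝓝 r] η := mem_closure_iff_frequently.1 ht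
  have he : chartAt E3 (γ t) ∈ IsManifold.maximalAtlas (𝓡 3) ∞ M :=
    IsManifold.chart_mem_maximalAtlas (γ t)
  have hsrc := mem_chart_source E3 (γ t)
  have hγη : γ t = η t := tendsto_nhds_unique_of_frequently_eq (h t hts).1 (h' t hts).1
    (hfreq.mono fun r hr => hr.eq_of_nhds)
  have hsrc' : η t ∈ (chartAt E3 (γ t)).source := hγη ▸ hsrc
  refine (h t hts).eventuallyEq hT (h' t hts) hγη he hsrc ?_
  refine tendsto_nhds_unique_of_frequently_eq
    ((h t hts).solvesAt hT he hsrc).hasDerivAt_deriv.continuousAt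
    ((h' t hts).solvesAt hT he hsrc').hasDerivAt_deriv.continuousAt (hfreq.mono fun r hr => ?_)
  exact EventuallyEq.deriv_eq (hr.mono fun q hq => by simp only [hq])

lemma ioo_inter_isPreconnected (a b c d : ℝ) : IsPreconnected (Set.Ioo a b ∩ Set.Ioo c d) := by
  rw [Set.Ioo_inter_Ioo]; exact isPreconnected_Ioo

open Classical in
/-- Two geodesics on overlapping intervals which agree near one time have a common extension. -/
lemma exists_geodesic_union [T2Space M] (hT : IsMetric T) {a b c d t₀ : ℝ}
    (h : ∀ t ∈ Set.Ioo a b, GeodesicAt T γ t) (h' : ∀ t ∈ Set.Ioo c d, GeodesicAt T η t)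
    (ht₀ : t₀ ∈ Set.Ioo a b ∩ Set.Ioo c d) (h0 : γ =ᶠ[𝓝 t₀] η) :
    ∃ ζ : ℝ → M, (∀ t ∈ Set.Ioo a b ∪ Set.Ioo c d, GeodesicAt T ζ t) ∧
      ∀ t ∈ Set.Ioo a b, ζ =ᶠ[𝓝 t] γ := by
  have heq := eqOn_of_geodesicAt hT (ioo_inter_isPreconnected a b c d) (fun t ht => h t ht.1)
    (fun t ht => h' t ht.2) ht₀ h0
  set ζ : ℝ → M := fun t => if t ∈ Set.Ioo a b then γ t else η t
  have h1 : ∀ t ∈ Set.Ioo a b, ζ =ᶠ[𝓝 t] γ := fun t ht => by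
    filter_upwards [isOpen_Ioo.mem_nhds ht] with s hs using if_pos hs
  have h2 : ∀ t ∈ Set.Ioo c d, ζ =ᶠ[𝓝 t] η := fun t ht => by
    filter_upwards [isOpen_Ioo.mem_nhds ht] with s hs
    by_cases hs' : s ∈ Set.Ioo a b
    · exact (if_pos hs').trans (heq s ⟨hs', hs⟩).eq_of_nhds
    · exact if_neg hs'
  refine ⟨ζ, ?_, h1⟩
  rintro t (ht | ht)
  · exact (h t ht).congr (h1 t ht)
  · exact (h' t ht).congr (h2 t ht)

lemma bilinOfMat_sub_le (A B : Matrix (Fin 3) (Fin 3) ℝ) (v : E3) :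
    bilinOfMat B v v - bilinOfMat A v v ≤ (∑ a, ∑ b, |A a b - B a b|) * ‖v‖ ^ 2 := by
  simp only [bilinOfMat_apply, ← Finset.sum_sub_distrib, Finset.sum_mul]
  refine Finset.sum_le_sum fun a _ => Finset.sum_le_sum fun b _ => ?_
  have ha : |v a| ≤ ‖v‖ := PiLp.norm_apply_le v a
  have hb : |v b| ≤ ‖v‖ := PiLp.norm_apply_le v b
  calc v a * v b * B a b - v a * v b * A a b = -(A a b - B a b) * (v a * v b) := by ring
    _ ≤ |-(A a b - B a b) * (v a * v b)| := le_abs_self _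
    _ = |A a b - B a b| * (|v a| * |v b|) := by rw [abs_mul, abs_neg, abs_mul]
    _ ≤ |A a b - B a b| * (‖v‖ * ‖v‖) := by gcongr
    _ = |A a b - B a b| * ‖v‖ ^ 2 := by ring

/-- Geodesics with bounded initial speed starting near a given point exist for a uniform time. -/
lemma exists_local_geodesic (hT : IsMetric T) (x₀ : M) (C : ℝ) : ∃ U ∈ 𝓝 x₀, ∃ ε > (0 : ℝ),
    ∀ x ∈ U, ∀ w : E3, tensorEval T x w w ≤ C → ∀ t₀ : ℝ, ∃ γ : ℝ → M, γ t₀ = x ∧ vel γ t₀ = w ∧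
      ∀ t ∈ Set.Ioo (t₀ - ε) (t₀ + ε), GeodesicAt T γ t := by
  set e := chartAt E3 x₀ with hee
  have he : e ∈ IsManifold.maximalAtlas (𝓡 3) ∞ M := IsManifold.chart_mem_maximalAtlas x₀
  have hx₀ : x₀ ∈ e.source := mem_chart_source E3 x₀
  have hy := e.map_source hx₀
  set G := components e T
  have hG : SmoothMat G (e x₀) := hT.smooth_components he hy
  have hdet : (G (e x₀)).det ≠ 0 := hT.det_components he hy
  obtain ⟨r, hr, ε, hε, hflow⟩ := exists_local_flow (z₀ := (e x₀, (0 : E3)))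
    ((contDiffAt_sprayField (z := (e x₀, (0 : E3))) hG hdet).of_le (by simp))
    (V := e.target ×ˢ Set.univ) (prod_mem_nhds (e.open_target.mem_nhds hy) univ_mem)
  -- a lower bound for the metric near `x₀`
  have hpos : ∀ v, v ≠ 0 → 0 < bilinOfMat (G (e x₀)) v v := fun v hv => by
    rw [bilinOfMat_apply, ← tensorEval_chartDeriv]
    exact hT.pos _ _ fun h => hv (chartDeriv_injective he hy (h.trans (map_zero _).symm))
  obtain ⟨m, hm, hlow⟩ := exists_lower_bound _ hpos
  set D : M → ℝ := fun x => ∑ a, ∑ b, |G (e x) a b - G (e x₀) a b| with hD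
  have hcont : ContinuousAt D x₀ := by
    have h (a b : Fin 3) : ContinuousAt (fun x => G (e x) a b) x₀ :=
      ContinuousAt.comp (f := e) (g := fun y => G y a b) (hG a b).continuousAt (e.continuousAt hx₀)
    exact tendsto_finsetSum _ fun a _ => tendsto_finsetSum _ fun b _ =>
      ((h a b).sub continuousAt_const).abs
  have hev : ∀ᶠ x in 𝓝 x₀, x ∈ e.source ∧ e x ∈ Metric.closedBall (e x₀) r ∧ D x < m / 2 := by
    refine Eventually.and (e.open_source.mem_nhds hx₀)
      (((e.continuousAt hx₀).eventually (Metric.closedBall_mem_nhds _ hr)).and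
        (hcont.eventually (gt_mem_nhds ?_)))
    simpa [hD] using hm
  -- the speed bound in coordinates, and the rescaling of time which makes it small
  set B : ℝ := √(2 * |C| / m) + 1 with hB
  have hBpos : 0 < B := by positivity
  set l : ℝ := r / B
  have hl : 0 < l := by positivity
  refine ⟨_, hev, ε * l, by positivity, fun x hx w hw t₀ => ?_⟩
  obtain ⟨hxs, hxr, hxG⟩ := hx
  set v := chartMap e x w with hv
  have hvB : ‖v‖ ≤ B := by
    have h1 : bilinOfMat (G (e x)) v v ≤ C := by
      rw [← tensorEval_eq_bilinOfMat he hxs]; exact hw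
    have h2 := bilinOfMat_sub_le (G (e x)) (G (e x₀)) v
    have h3 := hlow v
    have h4 : D x * ‖v‖ ^ 2 ≤ m / 2 * ‖v‖ ^ 2 := by gcongr
    have h5 : ‖v‖ ^ 2 ≤ 2 * |C| / m := by
      rw [le_div_iff₀ hm]
      nlinarith [le_abs_self C]
    exact (Real.le_sqrt_of_sq_le h5).trans (by linarith)
  have hz : (e x, l • v) ∈ Metric.closedBall (e x₀, (0 : E3)) r := by
    rw [← closedBall_prod_same]
    refine ⟨hxr, ?_⟩
    rw [mem_closedBall_zero_iff, norm_smul, Real.norm_of_nonneg hl.le]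
    calc l * ‖v‖ ≤ l * B := by gcongr
      _ = r := div_mul_cancel₀ _ hBpos.ne'
  obtain ⟨α, hα0, hα⟩ := hflow _ hz (t₀ / l)
  set z : ℝ → E3 × E3 := fun t => ((α (t / l)).1, l⁻¹ • (α (t / l)).2) with hzdef
  have htl {t : ℝ} (ht : t ∈ Set.Ioo (t₀ - ε * l) (t₀ + ε * l)) :
      t / l ∈ Set.Ioo (t₀ / l - ε) (t₀ / l + ε) := by
    constructor
    · rw [lt_div_iff₀ hl, sub_mul, div_mul_cancel₀ _ hl.ne']; exact ht.1
    · rw [div_lt_iff₀ hl, add_mul, div_mul_cancel₀ _ hl.ne']; exact ht.2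
  have hzd : ∀ t ∈ Set.Ioo (t₀ - ε * l) (t₀ + ε * l), HasDerivAt z (sprayField G (z t)) t := by
    intro t ht
    have h1 := (hα _ (htl ht)).2
    have h2 : HasDerivAt (fun t : ℝ => t / l) (1 / l) t := (hasDerivAt_id t).div_const l
    have h3 : HasDerivAt (fun t => α (t / l)) ((1 / l) • sprayField G (α (t / l))) t :=
      h1.scomp t h2
    have h4 : HasDerivAt (fun t => (α (t / l)).1) ((1 / l) • (α (t / l)).2) t :=
      (hasFDerivAt_fst.comp_hasDerivAt t h3 :)
    have h5 : HasDerivAt (fun t => (α (t / l)).2)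
        ((1 / l) • spray G (α (t / l)).1 (α (t / l)).2) t :=
      (hasFDerivAt_snd.comp_hasDerivAt t h3 :)
    refine (h4.prodMk (h5.const_smul l⁻¹)).congr_deriv ?_
    simp only [sprayField, hzdef, one_div, Prod.mk.injEq, true_and]
    -- the spray is homogeneous of degree two in the velocity
    ext k
    simp only [spray_apply, PiLp.smul_apply, smul_eq_mul, mul_neg, Finset.mul_sum]
    congr 1
    exact Finset.sum_congr rfl fun i _ => Finset.sum_congr rfl fun j _ => by ring
  have hz0 : z t₀ = (e x, v) := by
    simp only [hzdef, hα0, smul_smul, inv_mul_cancel₀ hl.ne', one_smul]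
  have hzt : ∀ t ∈ Set.Ioo (t₀ - ε * l) (t₀ + ε * l), (z t).1 ∈ e.target := fun t ht =>
    (hα _ (htl ht)).1.1
  have ht₀ : t₀ ∈ Set.Ioo (t₀ - ε * l) (t₀ + ε * l) := by
    have : 0 < ε * l := by positivity
    exact ⟨by linarith, by linarith⟩
  set γ : ℝ → M := fun t => e.symm (z t).1
  have hγe : ∀ t ∈ Set.Ioo (t₀ - ε * l) (t₀ + ε * l), e (γ t) = (z t).1 := fun t ht =>
    e.right_inv (hzt t ht)
  have hγgeo : ∀ t ∈ Set.Ioo (t₀ - ε * l) (t₀ + ε * l), GeodesicAt T γ t := by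
    intro t ht
    have hc : ContinuousAt (fun t => (z t).1) t := (hzd t ht).continuousAt.fst
    have hcγ : ContinuousAt γ t :=
      ContinuousAt.comp (f := fun t => (z t).1) (g := e.symm) (e.continuousAt_symm (hzt t ht)) hc
    rw [geodesicAt_iff hT he hcγ (e.map_target (hzt t ht))]
    have hnhds := isOpen_Ioo.mem_nhds ht
    exact (SolvesAt.of_phase (z := z) (Filter.mem_of_superset hnhds hzd)).congr
      (Filter.mem_of_superset hnhds hγe)
  have hγ0 : γ t₀ = x := by
    simp only [γ, hz0]; exact e.left_inv hxs
  refine ⟨γ, hγ0, ?_, hγgeo⟩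
  refine chartMap_injective he hxs ?_
  have h1 := chartMap_vel he (γ := γ) (t := t₀) (by rwa [hγ0]) ((hγgeo t₀ ht₀).contMDiffAt hT)
  rw [hγ0] at h1
  rw [h1]
  have h2 : (fun s => e (γ s)) =ᶠ[𝓝 t₀] fun s => (z s).1 :=
    Filter.mem_of_superset (isOpen_Ioo.mem_nhds ht₀) hγe
  have h3 : HasDerivAt (fun s => (z s).1) (z t₀).2 t₀ :=
    (hasFDerivAt_fst.comp_hasDerivAt t₀ (hzd t₀ ht₀) :)
  rw [h2.deriv_eq, h3.deriv, hz0]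

/-- Geodesics with bounded initial speed starting in a compact set exist for a uniform time. -/
lemma exists_uniform_geodesic (hT : IsMetric T) {K : Set M} (hK : IsCompact K) (C : ℝ) :
    ∃ ε > (0 : ℝ), ∀ x ∈ K, ∀ w : E3, tensorEval T x w w ≤ C → ∀ t₀ : ℝ, ∃ γ : ℝ → M,
      γ t₀ = x ∧ vel γ t₀ = w ∧ ∀ t ∈ Set.Ioo (t₀ - ε) (t₀ + ε), GeodesicAt T γ t := by
  refine hK.induction_on (p := fun K => ∃ ε > (0 : ℝ), ∀ x ∈ K, ∀ w : E3, tensorEval T x w w ≤ C →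
    ∀ t₀ : ℝ, ∃ γ : ℝ → M, γ t₀ = x ∧ vel γ t₀ = w ∧
      ∀ t ∈ Set.Ioo (t₀ - ε) (t₀ + ε), GeodesicAt T γ t) ⟨1, one_pos, by simp⟩ ?_ ?_ ?_
  · rintro s s' hs ⟨ε, hε, h⟩
    exact ⟨ε, hε, fun x hx => h x (hs hx)⟩
  · rintro s s' ⟨ε, hε, h⟩ ⟨ε', hε', h'⟩
    refine ⟨min ε ε', lt_min hε hε', ?_⟩
    have hmono (t₀ : ℝ) : Set.Ioo (t₀ - min ε ε') (t₀ + min ε ε') ⊆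
        Set.Ioo (t₀ - ε) (t₀ + ε) ∩ Set.Ioo (t₀ - ε') (t₀ + ε') := fun t ht =>
      ⟨⟨by linarith [ht.1, min_le_left ε ε'], by linarith [ht.2, min_le_left ε ε']⟩,
        ⟨by linarith [ht.1, min_le_right ε ε'], by linarith [ht.2, min_le_right ε ε']⟩⟩
    rintro x (hx | hx) w hw t₀
    · obtain ⟨γ, h0, h1, h2⟩ := h x hx w hw t₀
      exact ⟨γ, h0, h1, fun t ht => h2 t (hmono t₀ ht).1⟩
    · obtain ⟨γ, h0, h1, h2⟩ := h' x hx w hw t₀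
      exact ⟨γ, h0, h1, fun t ht => h2 t (hmono t₀ ht).2⟩
  · intro x _
    obtain ⟨U, hU, ε, hε, h⟩ := exists_local_geodesic hT x C
    exact ⟨U, mem_nhdsWithin_of_mem_nhds hU, ε, hε, h⟩

end Geodesic

/-! ### Geodesic completeness -/

section Complete

variable {M : Type*} [TopologicalSpace M] [ChartedSpace E3 M] {T : TwoTensor M} {γ η : ℝ → M}

lemma vel_congr {t : ℝ} (h : γ =ᶠ[𝓝 t] η) : vel γ t = vel η t :=
  congrArg (fun L : ℝ →L[ℝ] E3 => L 1) h.mfderiv_eq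

lemma speedSq_congr {t : ℝ} (h : γ =ᶠ[𝓝 t] η) : speedSq T γ t = speedSq T η t := by
  rw [speedSq, speedSq, vel_congr h, h.eq_of_nhds]

lemma GeodesicAt.geodesic_eq {t : ℝ} (h : GeodesicAt T γ t) (k : Fin 3) :
    deriv (deriv fun s => (chartAt E3 (γ t) (γ s)) k) t
      + ∑ i, ∑ j, christoffel (components (chartAt E3 (γ t)) T) k i j (chartAt E3 (γ t) (γ t))
          * deriv (fun s => (chartAt E3 (γ t) (γ s)) i) t
          * deriv (fun s => (chartAt E3 (γ t) (γ s)) j) t = 0 := by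
  have h1 (i : Fin 3) : deriv (fun s => (chartAt E3 (γ t) (γ s)) i) =ᶠ[𝓝 t]
      fun s => deriv (fun r => chartAt E3 (γ t) (γ r)) s i := by
    filter_upwards [h.2] with s hs
    exact (hasDerivAt_coord_iff.1 hs.1 i).deriv
  rw [(h1 k).deriv_eq, (hasDerivAt_coord_iff.1 h.2.hasDerivAt_deriv k).deriv, spray_apply]
  simp only [(h1 _).eq_of_nhds]
  exact neg_add_cancel _

variable [IsManifold (𝓡 3) ∞ M]

/-- A geodesic on an interval, which at the time `t₁` lies in the set `K` where the local existence
time is at least `ε`, extends to the times within `ε` of `t₁`. -/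
lemma exists_extension [T2Space M] (hT : IsMetric T) {K : Set M} {C ε : ℝ} (hε : 0 < ε)
    (hloc : ∀ x ∈ K, ∀ w : E3, tensorEval T x w w ≤ C → ∀ t₀ : ℝ, ∃ γ : ℝ → M, γ t₀ = x ∧
      vel γ t₀ = w ∧ ∀ t ∈ Set.Ioo (t₀ - ε) (t₀ + ε), GeodesicAt T γ t)
    {a b t₁ : ℝ} (hγ : ∀ t ∈ Set.Ioo a b, GeodesicAt T γ t) (ht₁ : t₁ ∈ Set.Ioo a b)
    (hK : γ t₁ ∈ K) (hC : speedSq T γ t₁ ≤ C) : ∃ ζ : ℝ → M,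
      (∀ t ∈ Set.Ioo a b ∪ Set.Ioo (t₁ - ε) (t₁ + ε), GeodesicAt T ζ t) ∧
        ∀ t ∈ Set.Ioo a b, ζ =ᶠ[𝓝 t] γ := by
  obtain ⟨η, h0, h1, h2⟩ := hloc _ hK _ hC t₁
  have ht₁' : t₁ ∈ Set.Ioo (t₁ - ε) (t₁ + ε) := ⟨by linarith, by linarith⟩
  exact exists_geodesic_union hT hγ h2 ⟨ht₁, ht₁'⟩
    ((hγ t₁ ht₁).eventuallyEq_of_vel hT (h2 t₁ ht₁') h0.symm h1.symm)

/-- If a proper function grows at a bounded rate along unit speed geodesics, then geodesics extend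
to arbitrarily long time intervals. -/
lemma exists_long_geodesic [T2Space M] (hT : IsMetric T) {f : M → ℝ}
    (hf : ∀ B, ∃ K, IsCompact K ∧ ∀ x, f x ≤ B → x ∈ K) {c : ℝ}
    (hd : ∀ (γ : ℝ → M) (t : ℝ), GeodesicAt T γ t →
      ∃ d, HasDerivAt (fun s => f (γ s)) d t ∧ |d| ≤ c * √(speedSq T γ t))
    (x : M) (w : E3) {N : ℝ} (hN : 0 < N) : ∃ γ : ℝ → M, γ 0 = x ∧ vel γ 0 = w ∧
      ∀ t ∈ Set.Ioo (-N) N, GeodesicAt T γ t := by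
  set C := tensorEval T x w w with hC
  set B := f x + |c * √C| * N with hB
  obtain ⟨K, hK, hfK⟩ := hf B
  obtain ⟨ε, hε, hloc⟩ := exists_uniform_geodesic hT hK C
  have hxK : x ∈ K := hfK x (by rw [hB]; linarith [mul_nonneg (abs_nonneg (c * √C)) hN.le])
  have bound {γ : ℝ → M} (h0 : γ 0 = x) (h1 : vel γ 0 = w) {r : ℝ} (hr : r ≤ N)
      (hγ : ∀ t ∈ Set.Ioo (-r) r, GeodesicAt T γ t) {t : ℝ} (ht : t ∈ Set.Ioo (-r) r) :
      γ t ∈ K ∧ speedSq T γ t = C := by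
    have hr0 : (0 : ℝ) ∈ Set.Ioo (-r) r := ⟨by linarith [ht.1, ht.2], by linarith [ht.1, ht.2]⟩
    have hs : ∀ t ∈ Set.Ioo (-r) r, speedSq T γ t = C := fun t ht => by
      rw [speedSq_const hT isOpen_Ioo isPreconnected_Ioo hγ ht hr0, speedSq, h0, h1]
    refine ⟨hfK _ ?_, hs t ht⟩
    choose! d hd1 hd2 using fun t ht => hd γ t (hγ t ht)
    have hle := Convex.norm_image_sub_le_of_norm_hasDerivWithin_le (f := fun s => f (γ s)) (f' := d)
      (C := |c * √C|) (fun s hs' => (hd1 s hs').hasDerivWithinAt)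
      (fun s hs' => by
        have := hd2 s hs'
        rw [hs s hs'] at this
        exact this.trans (le_abs_self _)) (convex_Ioo (-r) r) hr0 ht
    simp only [h0, Real.norm_eq_abs, sub_zero] at hle
    have ht' : |t| ≤ N := (abs_lt.2 ht).le.trans hr
    have := (le_abs_self _).trans (hle.trans (mul_le_mul_of_nonneg_left ht' (abs_nonneg _)))
    linarith
  have main : ∀ k : ℕ, ∃ γ : ℝ → M, γ 0 = x ∧ vel γ 0 = w ∧
      ∀ t ∈ Set.Ioo (-min ((k + 1) * (ε / 2)) N) (min ((k + 1) * (ε / 2)) N),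
        GeodesicAt T γ t := by
    intro k
    induction k with
    | zero =>
      obtain ⟨γ, h0, h1, h2⟩ := hloc x hxK w le_rfl 0
      refine ⟨γ, h0, h1, fun t ht => h2 t ?_⟩
      have := min_le_left (((0 : ℕ) + 1) * (ε / 2)) N
      simp only [Nat.cast_zero, zero_add, one_mul] at this ht
      exact ⟨by linarith [ht.1], by linarith [ht.2]⟩
    | succ k ih =>
      obtain ⟨γ, h0, h1, h2⟩ := ih
      set r := min ((k + 1) * (ε / 2)) N with hr
      have hr0 : 0 < r := lt_min (by positivity) hN
      have hrN : r ≤ N := min_le_right _ _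
      have hr' : min (((k + 1 : ℕ) + 1) * (ε / 2)) N ≤ r + ε / 2 := by
        rw [hr, ← min_add_add_right]
        refine min_le_min (by push_cast; linarith) (by linarith)
      -- restart the geodesic close to both ends of its interval
      set τ := r - min (ε / 2) r / 2 with hτ
      have hmin : 0 < min (ε / 2) r := lt_min (by positivity) hr0
      have hmin1 := min_le_left (ε / 2) r
      have hmin2 := min_le_right (ε / 2) r
      have hτ1 : τ ∈ Set.Ioo (-r) r := ⟨by linarith, by linarith⟩
      have hτ2 : -τ ∈ Set.Ioo (-r) r := ⟨by linarith, by linarith⟩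
      have hb1 := bound h0 h1 hrN h2 hτ1
      have hb2 := bound h0 h1 hrN h2 hτ2
      obtain ⟨ζ, hζ, hζγ⟩ := exists_extension hT hε hloc h2 hτ1 hb1.1 hb1.2.le
      have hζ' : ∀ t ∈ Set.Ioo (-r) (r + ε / 2), GeodesicAt T ζ t := fun t ht => by
        refine hζ t ?_
        rcases lt_or_ge t r with h | h
        · exact Or.inl ⟨ht.1, h⟩
        · exact Or.inr ⟨by linarith, by linarith [ht.2]⟩
      obtain ⟨ξ, hξ, hξζ⟩ := exists_extension hT hε hloc hζ'
        (t₁ := -τ) ⟨hτ2.1, by linarith [hτ2.2]⟩ (by rw [(hζγ _ hτ2).eq_of_nhds]; exact hb2.1)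
        (by rw [speedSq_congr (hζγ _ hτ2)]; exact hb2.2.le)
      have h00 : (0 : ℝ) ∈ Set.Ioo (-r) r := ⟨by linarith, hr0⟩
      have hξγ : ξ =ᶠ[𝓝 0] γ := (hξζ 0 ⟨h00.1, by linarith⟩).trans (hζγ 0 h00)
      refine ⟨ξ, by rw [hξγ.eq_of_nhds, h0], by rw [vel_congr hξγ, h1], fun t ht => hξ t ?_⟩
      rcases lt_or_ge (-r) t with h | h
      · exact Or.inl ⟨h, by linarith [ht.2]⟩
      · exact Or.inr ⟨by linarith [ht.1], by linarith⟩
  obtain ⟨k, hk⟩ := exists_nat_gt (N / (ε / 2))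
  obtain ⟨γ, h0, h1, h2⟩ := main k
  have hkN : N ≤ (k + 1) * (ε / 2) := by
    rw [div_lt_iff₀ (by positivity)] at hk
    linarith
  rw [min_eq_right hkN] at h2
  exact ⟨γ, h0, h1, h2⟩

/-- A Riemannian manifold with a proper function which grows at a bounded rate along unit speed
geodesics is geodesically complete. -/
theorem geodesicallyComplete_of_proper [T2Space M] (hT : IsMetric T) {f : M → ℝ}
    (hf : ∀ B, ∃ K, IsCompact K ∧ ∀ x, f x ≤ B → x ∈ K) {c : ℝ}
    (hd : ∀ (γ : ℝ → M) (t : ℝ), GeodesicAt T γ t →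
      ∃ d, HasDerivAt (fun s => f (γ s)) d t ∧ |d| ≤ c * √(speedSq T γ t)) :
    GeodesicallyComplete T := by
  rintro ⟨x, w⟩
  choose g hg0 hg1 hg2 using fun n : ℕ =>
    exists_long_geodesic hT hf hd x w (N := n + 1) (by positivity)
  have h0mem (n : ℕ) : (0 : ℝ) ∈ Set.Ioo (-(n + 1 : ℝ)) (n + 1) :=
    ⟨by linarith [n.cast_nonneg (α := ℝ)], by positivity⟩
  have hcons (m n : ℕ) (t : ℝ) (hm : |t| < m + 1) (hn : |t| < n + 1) : g m t = g n t :=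
    (eqOn_of_geodesicAt hT (ioo_inter_isPreconnected _ _ _ _) (fun t ht => hg2 m t ht.1)
      (fun t ht => hg2 n t ht.2) (t₀ := 0) ⟨h0mem m, h0mem n⟩
      ((hg2 m 0 (h0mem m)).eventuallyEq_of_vel hT (hg2 n 0 (h0mem n))
        (by rw [hg0, hg0]) (by rw [hg1, hg1])) t ⟨abs_lt.1 hm, abs_lt.1 hn⟩).eq_of_nhds
  set γ : ℝ → M := fun t => g ⌈|t|⌉₊ t
  have hγ (n : ℕ) (t : ℝ) (ht : |t| < n + 1) : γ =ᶠ[𝓝 t] g n := by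
    filter_upwards [(continuous_abs.continuousAt (x := t)).eventually (gt_mem_nhds ht)] with s hs
    exact hcons _ n s ((Nat.le_ceil _).trans_lt (lt_add_one _)) hs
  have hgeo (t : ℝ) : GeodesicAt T γ t := by
    have ht : |t| < (⌈|t|⌉₊ : ℝ) + 1 := (Nat.le_ceil _).trans_lt (lt_add_one _)
    exact (hg2 _ t (abs_lt.1 ht)).congr (hγ _ t ht)
  refine ⟨γ, ⟨fun t => (hgeo t).contMDiffAt hT, fun t k => (hgeo t).geodesic_eq k⟩, ?_⟩
  have hγ0 := hγ 0 0 (by simp)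
  have hx : γ 0 = x := hγ0.eq_of_nhds.trans (hg0 0)
  have hw : vel γ 0 = w := (vel_congr hγ0).trans (hg1 0)
  clear_value γ
  subst hx
  exact congrArg (fun v : TangentSpace (𝓡 3) (γ 0) => (⟨γ 0, v⟩ : TangentBundle (𝓡 3) M)) hw

end Complete

/-! ### Metrics dominating the flat metric on the ends are complete -/

/-- A `C¹` function of `s = |y|²/2` which vanishes for `s ≤ S` and is proper on the end, with
bounded gradient. -/
def growthFun (S s : ℝ) : ℝ := Real.log (1 + max 0 (s - S) ^ 2)

lemma hasDerivAt_max_sq (u : ℝ) : HasDerivAt (fun u : ℝ => max 0 u ^ 2) (2 * max 0 u) u := by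
  rcases lt_trichotomy u 0 with h | rfl | h
  · rw [max_eq_left h.le, mul_zero]
    refine (hasDerivAt_const u (0 : ℝ)).congr_of_eventuallyEq ?_
    filter_upwards [gt_mem_nhds h] with v hv
    rw [max_eq_left (le_of_lt hv)]; simp
  · have h : (fun u : ℝ => max 0 u ^ 2) =O[𝓝 0] fun u => ‖u - 0‖ ^ 2 := by
      refine Asymptotics.IsBigO.of_bound 1 (Eventually.of_forall fun u => ?_)
      rw [sub_zero, one_mul, norm_pow, norm_pow, norm_norm]
      refine pow_le_pow_left₀ (norm_nonneg _) ?_ 2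
      rw [Real.norm_eq_abs, Real.norm_eq_abs, abs_of_nonneg (le_max_left 0 u)]
      exact max_le (abs_nonneg _) (le_abs_self _)
    have h2 : HasFDerivAt (fun u : ℝ => max 0 u ^ 2) (0 : ℝ →L[ℝ] ℝ) 0 := h.hasFDerivAt one_lt_two
    refine h2.hasDerivAt.congr_deriv ?_
    simp
  · rw [max_eq_right h.le]
    have h2 : HasDerivAt (fun u : ℝ => u ^ 2) (2 * u) u := by simpa using hasDerivAt_pow 2 u
    refine h2.congr_of_eventuallyEq ?_
    filter_upwards [lt_mem_nhds h] with v hv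
    rw [max_eq_right (le_of_lt hv)]

lemma hasDerivAt_growthFun (S s : ℝ) : HasDerivAt (growthFun S)
    (2 * max 0 (s - S) / (1 + max 0 (s - S) ^ 2)) s :=
  (((hasDerivAt_max_sq (s - S)).comp_sub_const s S).const_add 1).log (by positivity)

lemma growthFun_deriv_bound {S s : ℝ} (hS : 0 ≤ S) (hs : S ≤ s) :
    2 * max 0 (s - S) / (1 + max 0 (s - S) ^ 2) * √(2 * s) ≤ √(8 + 8 * S) := by
  obtain ⟨u, hu, rfl⟩ : ∃ u, 0 ≤ u ∧ s = u + S := ⟨s - S, by linarith, by ring⟩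
  rw [add_sub_cancel_right, max_eq_right hu]
  refine Real.le_sqrt_of_sq_le ?_
  rw [mul_pow, Real.sq_sqrt (by positivity), div_pow, div_mul_eq_mul_div,
    div_le_iff₀ (by positivity)]
  nlinarith [mul_nonneg hS (sq_nonneg u), mul_nonneg hS (sq_nonneg (u ^ 2)),
    mul_nonneg (mul_self_nonneg u) hu, sq_nonneg (u ^ 2 - u), sq_nonneg (u - 1), sq_nonneg u,
    sq_nonneg (u ^ 2)]

lemma le_of_growthFun_le {S s B : ℝ} (h : growthFun S s ≤ B) : s ≤ S + Real.exp B := by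
  have h1 : 1 + max 0 (s - S) ^ 2 ≤ Real.exp B := by
    rwa [growthFun, Real.log_le_iff_le_exp (by positivity)] at h
  have h2 := le_max_right 0 (s - S)
  nlinarith [sq_nonneg (max 0 (s - S) - 1)]

namespace AsymptoticEnds

variable {M : Type*} [TopologicalSpace M] [ChartedSpace E3 M] (E : AsymptoticEnds M)

open Classical in
/-- A proper function on the manifold: `growthFun S` on each end, and zero elsewhere. -/
def growth (S : ℝ) (x : M) : ℝ :=
  ∑ i, if x ∈ (E.chart i).source then growthFun S (halfSq (E.chart i x)) else 0

variable {E}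

lemma growth_of_mem (S : ℝ) {i : Fin E.n} {x : M} (hx : x ∈ (E.chart i).source) :
    E.growth S x = growthFun S (halfSq (E.chart i x)) := by
  rw [growth, Finset.sum_eq_single i (fun j _ hj => if_neg fun h => hj (eq_of_mem_source h hx))
    (by simp), if_pos hx]

lemma growth_eq_zero {S : ℝ} {x : M} (hx : ∀ i, x ∉ E.endSet i S) : E.growth S x = 0 := by
  refine Finset.sum_eq_zero fun i _ => ?_
  split_ifs with h
  · have : halfSq (E.chart i x) < S := not_le.1 fun h' => hx i ⟨h, h'⟩
    rw [growthFun, max_eq_left (by linarith)]; simp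
  · rfl

lemma exists_isCompact_growth (S B : ℝ) :
    ∃ K, IsCompact K ∧ ∀ x : M, E.growth S x ≤ B → x ∈ K := by
  refine ⟨_, E.isCompact_truncation √(2 * (S + Real.exp B)), fun x hx => ?_⟩
  by_cases hc : x ∈ E.core
  · exact Or.inl hc
  · have hc' : x ∈ E.coreᶜ := hc
    rw [E.compl_core, Set.mem_iUnion] at hc'
    obtain ⟨i, hi⟩ := hc'
    rw [growth_of_mem S hi] at hx
    have := le_of_growthFun_le hx
    refine Or.inr (Set.mem_iUnion.2 ⟨i, hi, Real.le_sqrt_of_sq_le ?_⟩)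
    unfold halfSq at this
    linarith

/-- A metric which dominates the flat metric far out in each end is geodesically complete. -/
lemma geodesicallyComplete_of_le [T2Space M] [IsManifold (𝓡 3) ∞ M] {S : ℝ} (hS0 : 0 ≤ S)
    (hS : ∀ i, E.radius i ^ 2 / 2 < S) {T : TwoTensor M} (hT : IsMetric T)
    (hle : ∀ i y v, S ≤ halfSq y → ‖v‖ ^ 2 ≤ bilinOfMat (components (E.chart i) T y) v v) :
    GeodesicallyComplete T := by
  refine geodesicallyComplete_of_proper hT (f := E.growth S) (exists_isCompact_growth S)
    (c := √(8 + 8 * S)) fun γ t h => ?_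
  by_cases hx : ∃ i, γ t ∈ (E.chart i).source
  · obtain ⟨i, hi⟩ := hx
    set y : ℝ → E3 := fun s => E.chart i (γ s) with hy
    have hsol := h.solvesAt hT (E.chart_mem i) hi
    have hd : HasDerivAt (fun s => halfSq (y s)) (inner ℝ (y t) (deriv y t)) t := by
      refine (hsol.hasDerivAt.norm_sq.div_const 2).congr_deriv ?_
      rw [mul_div_cancel_left₀ _ two_ne_zero]
    have hd2 := (hasDerivAt_growthFun S (halfSq (y t))).comp t hd
    have hev : (fun s => E.growth S (γ s)) =ᶠ[𝓝 t] growthFun S ∘ fun s => halfSq (y s) := by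
      filter_upwards [h.1.eventually ((E.chart i).open_source.mem_nhds hi)] with s hs
      exact growth_of_mem S hs
    refine ⟨_, hd2.congr_of_eventuallyEq hev, ?_⟩
    rcases lt_or_ge (halfSq (y t)) S with hlt | hge
    · rw [max_eq_left (by linarith)]
      simp only [mul_zero, zero_div, zero_mul, abs_zero]
      positivity
    · have hv : ‖deriv y t‖ ≤ √(speedSq T γ t) := by
        refine Real.le_sqrt_of_sq_le ?_
        rw [speedSq_eq (E.chart_mem i) hi (h.contMDiffAt hT)]
        exact hle i _ _ hge
      have hyn : ‖y t‖ = √(2 * halfSq (y t)) := by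
        rw [halfSq, mul_div_cancel₀ _ two_ne_zero, Real.sqrt_sq (norm_nonneg _)]
      have hpos : 0 ≤ 2 * max 0 (halfSq (y t) - S) / (1 + max 0 (halfSq (y t) - S) ^ 2) := by
        positivity
      rw [abs_mul, abs_of_nonneg hpos]
      calc _ ≤ 2 * max 0 (halfSq (y t) - S) / (1 + max 0 (halfSq (y t) - S) ^ 2) *
            (‖y t‖ * ‖deriv y t‖) := by gcongr; exact abs_real_inner_le_norm _ _
        _ = 2 * max 0 (halfSq (y t) - S) / (1 + max 0 (halfSq (y t) - S) ^ 2) *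
            √(2 * halfSq (y t)) * ‖deriv y t‖ := by rw [hyn]; ring
        _ ≤ _ := by gcongr; exact growthFun_deriv_bound hS0 hge
  · push Not at hx
    refine ⟨0, (hasDerivAt_const t (0 : ℝ)).congr_of_eventuallyEq ?_, by simp; positivity⟩
    have hmem : γ t ∉ ⋃ i, E.endSet i S := by
      simp only [Set.mem_iUnion, not_exists]
      exact fun i hi => hx i hi.1
    filter_upwards [h.1.eventually ((isClosed_iUnion_endSet hS).isOpen_compl.mem_nhds hmem)]
      with s hs
    exact growth_eq_zero (by simpa using hs)

end AsymptoticEnds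

/-! ### Initial data from radial profiles -/

lemma scalarCurv_congr {G H : MatField} {y : E3} (h : G =ᶠ[𝓝 y] H) :
    scalarCurv G y = scalarCurv H y := by
  have hc (k i j) : christoffel G k i j =ᶠ[𝓝 y] christoffel H k i j :=
    h.eventuallyEq_nhds.mono fun z hz => christoffel_congr hz k i j
  have hp (l k i j) := pd_congr (hc k i j) l
  have he (k i j) := (hc k i j).eq_of_nhds
  simp only [scalarCurv, ricci, hp, he, h.eq_of_nhds]

lemma hamDensity_congr {G H P Q : MatField} {y : E3} (h : G =ᶠ[𝓝 y] H) (hP : P =ᶠ[𝓝 y] Q) :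
    hamDensity G P y = hamDensity H Q y := by
  simp only [hamDensity, scalarCurv_congr h, sqLocal, trLocal, raised, h.eq_of_nhds, hP.eq_of_nhds]

lemma divMomentum_congr {G H P Q : MatField} {y : E3} (h : G =ᶠ[𝓝 y] H) (hP : P =ᶠ[𝓝 y] Q)
    (a : Fin 3) : divMomentum G P a y = divMomentum H Q a y := by
  have hm : momentumMat G P =ᶠ[𝓝 y] momentumMat H Q := by
    filter_upwards [h, hP] with z hz hz'
    ext a b
    simp only [momentumMat, momentumTensor, raised, trLocal, Matrix.of_apply, hz, hz']
  rw [divMomentum_eq, divMomentum_eq]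
  exact Finset.sum_congr rfl fun b _ => by rw [covDeriv_congr h hm]

lemma bilinOfMat_radMat (F : ℝ → ℝ) (y v : E3) : bilinOfMat (radMat (fun _ => 0) F y) v v =
    F (halfSq y) * (∑ a, y a * v a) ^ 2 := by
  rw [bilinOfMat_apply, sq, Finset.sum_mul_sum, Finset.mul_sum]
  refine Finset.sum_congr rfl fun a _ => ?_
  rw [Finset.mul_sum]
  exact Finset.sum_congr rfl fun b _ => by rw [radMat_apply]; ring

lemma radMetric_eq (β : ℝ → ℝ) (y : E3) :
    radMetric β y = 1 + radMat (fun _ => 0) (metricCoeff β) y := by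
  ext a b; simp [radMetric, radMat_apply]

lemma norm_sq_le_radMetric {β b : ℝ → ℝ} (h : IsProfile β b) (hβ : ∀ s, 0 < s → 0 ≤ β s) {y : E3}
    (hy : 0 < halfSq y) (v : E3) : ‖v‖ ^ 2 ≤ bilinOfMat (radMetric β y) v v := by
  have h1 : bilinOfMat (radMetric β y) v v =
      bilinOfMat 1 v v + bilinOfMat (radMat (fun _ => 0) (metricCoeff β) y) v v := by
    simp only [bilinOfMat_apply, radMetric_eq, Matrix.add_apply, mul_add, Finset.sum_add_distrib]
  rw [h1, bilinOfMat_one, bilinOfMat_radMat]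
  have : 0 ≤ metricCoeff β (halfSq y) := div_nonneg (hβ _ hy) (h.pos _ hy).le
  linarith [mul_nonneg this (sq_nonneg (∑ a, y a * v a))]

namespace AsymptoticEnds

variable {M : Type*} [TopologicalSpace M] [ChartedSpace E3 M]

/-- The metric which is `T₁` in the interior and is changed to `radMetric β` on the ends. As `T₁` is
flat where `β ≠ 0`, the change is `radMetric β - δ`. -/
def glueMetric (E : AsymptoticEnds M) (T₁ : TwoTensor M) (β : ℝ → ℝ) : TwoTensor M :=
  T₁ + E.endTensor (radMat (fun _ => 0) (metricCoeff β))

/-- The tensor which is `c` times the metric in the interior and is changed to `radTensor β b` on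
the ends. -/
def glueTensor (E : AsymptoticEnds M) (T₁ : TwoTensor M) (β b : ℝ → ℝ) (c : ℝ) : TwoTensor M :=
  c • E.glueMetric T₁ β + E.endTensor fun y => radTensor β b y - c • radMetric β y

section Glue

variable {E : AsymptoticEnds M} {T₁ : TwoTensor M} {β b : ℝ → ℝ} {c S₀ S₁ : ℝ}

lemma components_glueMetric {i : Fin E.n} (hflat : ∀ y, S₀ ≤ halfSq y →
    components (E.chart i) T₁ y = 1) (hS₀ : E.radius i ^ 2 / 2 < S₀) {y : E3} (hy : S₀ ≤ halfSq y) :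
    components (E.chart i) (E.glueMetric T₁ β) y = radMetric β y := by
  have h : components (E.chart i) (E.glueMetric T₁ β) y = components (E.chart i) T₁ y +
      components (E.chart i) (E.endTensor (radMat (fun _ => 0) (metricCoeff β))) y := rfl
  rw [h, hflat y hy, components_endTensor _ (mem_target_of_le hS₀ hy), radMetric_eq]

lemma components_glueTensor {i : Fin E.n} (hflat : ∀ y, S₀ ≤ halfSq y →
    components (E.chart i) T₁ y = 1) (hS₀ : E.radius i ^ 2 / 2 < S₀) {y : E3} (hy : S₀ ≤ halfSq y) :
    components (E.chart i) (E.glueTensor T₁ β b c) y = radTensor β b y := by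
  have h : components (E.chart i) (E.glueTensor T₁ β b c) y =
      c • components (E.chart i) (E.glueMetric T₁ β) y +
      components (E.chart i) (E.endTensor fun y => radTensor β b y - c • radMetric β y) y := rfl
  rw [h, components_glueMetric hflat hS₀ hy, components_endTensor _ (mem_target_of_le hS₀ hy),
    add_sub_cancel]

lemma radMat_metricCoeff_eq_zero (hβ : ∀ s, 0 < s → s ≤ S₁ → β s = 0 ∧ b s = c) {y : E3}
    (hy : 0 < halfSq y) (hy' : halfSq y < S₁) : radMat (fun _ => 0) (metricCoeff β) y = 0 := by
  ext a d
  rw [radMat_apply, metricCoeff, (hβ _ hy hy'.le).1]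
  simp

lemma radTensor_sub_eq_zero (hβ : ∀ s, 0 < s → s ≤ S₁ → β s = 0 ∧ b s = c) {y : E3}
    (hy : 0 < halfSq y) (hy' : halfSq y < S₁) : radTensor β b y - c • radMetric β y = 0 := by
  have hd : deriv b (halfSq y) = 0 := by
    have : b =ᶠ[𝓝 (halfSq y)] fun _ => c := by
      filter_upwards [Ioo_mem_nhds hy hy'] with s hs using (hβ s hs.1 hs.2.le).2
    rw [this.deriv_eq, deriv_const]
  rw [radMetric_eq, radMat_metricCoeff_eq_zero hβ hy hy', radTensor]
  ext a d
  rw [Matrix.sub_apply, radMat_apply, hd, (hβ _ hy hy'.le).1, (hβ _ hy hy'.le).2]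
  simp

lemma glueTensor_symm (hT₁ : ∀ x v w, T₁ x v w = T₁ x w v) (x : M) (v w : TangentSpace (𝓡 3) x) :
    E.glueTensor T₁ β b c x v w = E.glueTensor T₁ β b c x w v := by
  have hm (v w : TangentSpace (𝓡 3) x) : E.glueMetric T₁ β x v w = E.glueMetric T₁ β x w v :=
    congrArg₂ (· + ·) (hT₁ x v w) (endTensor_symm (fun y => radMat_isSymm _ _ y) x v w)
  exact congrArg₂ (· + ·) (congrArg (c * ·) (hm v w)) (endTensor_symm
    (fun y => (radTensor_isSymm β b y).sub ((radMetric_isSymm β y).smul c)) x v w)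

variable [T2Space M]

/-- Away from the far parts of the ends the metric is `T₁` and the tensor is `c T₁`. -/
lemma glue_interior (hS₁ : ∀ i, E.radius i ^ 2 / 2 < S₁)
    (hβ : ∀ s, 0 < s → s ≤ S₁ → β s = 0 ∧ b s = c) {x : M} (hx : ∀ i, x ∉ E.endSet i S₁)
    (e : OpenPartialHomeomorph M E3) (hxe : x ∈ e.source) :
    components e (E.glueMetric T₁ β) =ᶠ[𝓝 (e x)] components e T₁ ∧
      components e (E.glueTensor T₁ β b c) =ᶠ[𝓝 (e x)] fun z => c • components e T₁ z := by
  have hmem : e.symm (e x) ∈ (⋃ i, E.endSet i S₁)ᶜ := by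
    rw [e.left_inv hxe]; simpa using hx
  have hev : ∀ᶠ z in 𝓝 (e x), ∀ i, e.symm z ∉ E.endSet i S₁ := by
    filter_upwards [(e.continuousAt_symm (e.map_source hxe)).eventually
      ((isClosed_iUnion_endSet hS₁).isOpen_compl.mem_nhds hmem)] with z hz
    simpa using hz
  have h1 : ∀ z, (∀ i, e.symm z ∉ E.endSet i S₁) →
      E.glueMetric T₁ β (e.symm z) = T₁ (e.symm z) := fun z hz => by
    rw [glueMetric, Pi.add_apply,
      endTensor_eq_zero (fun y hy hy' => radMat_metricCoeff_eq_zero hβ hy hy') hz]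
    exact add_zero (M := E3 →L[ℝ] E3 →L[ℝ] ℝ) _
  have h2 : ∀ z, (∀ i, e.symm z ∉ E.endSet i S₁) →
      E.glueTensor T₁ β b c (e.symm z) = c • T₁ (e.symm z) := fun z hz => by
    rw [glueTensor, Pi.add_apply, Pi.smul_apply, h1 z hz,
      endTensor_eq_zero (fun y hy hy' => radTensor_sub_eq_zero hβ hy hy') hz]
    exact add_zero (M := E3 →L[ℝ] E3 →L[ℝ] ℝ) _
  constructor
  · filter_upwards [hev] with z hz
    ext p q
    rw [components_apply, components_apply, tensorEval, tensorEval, h1 z hz]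
  · filter_upwards [hev] with z hz
    ext p q
    rw [Matrix.smul_apply, components_apply, components_apply, tensorEval, tensorEval, h2 z hz]
    rfl

variable [IsManifold (𝓡 3) ∞ M]

lemma isMetric_glueMetric (hT₁ : IsMetric T₁) (hS₁ : ∀ i, E.radius i ^ 2 / 2 < S₁)
    (hp : IsProfile β b) (hβ0 : ∀ s, 0 < s → 0 ≤ β s)
    (hβ : ∀ s, 0 < s → s ≤ S₁ → β s = 0 ∧ b s = c) : IsMetric (E.glueMetric T₁ β) where
  symm x v w := congrArg₂ (· + ·) (hT₁.symm x v w)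
    (endTensor_symm (fun y => radMat_isSymm _ _ y) x v w)
  pos x v hv := by
    have hQ : 0 ≤ E.endTensor (radMat (fun _ => 0) (metricCoeff β)) x v v := by
      by_cases h : ∃ i, x ∈ (E.chart i).source
      · obtain ⟨i, hi⟩ := h
        have hy := halfSq_pos_of_mem hi
        rw [endTensor_of_mem _ hi, pullTensor_apply _ hi, bilinOfMat_radMat]
        exact mul_nonneg (div_nonneg (hβ0 _ hy) (hp.pos _ hy).le) (sq_nonneg _)
      · push Not at h
        rw [endTensor_of_notMem _ h]
        exact le_rfl
    exact add_pos_of_pos_of_nonneg (hT₁.pos x v hv) hQ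
  smooth x := (hT₁.smooth x).add (endTensor_smooth hS₁
    (fun y hy => radMat_smooth contDiffAt_const (hp.smooth_coeff hy))
    (fun y hy hy' => radMat_metricCoeff_eq_zero hβ hy hy') x)

lemma glueTensor_smooth (hT₁ : IsMetric T₁) (hS₁ : ∀ i, E.radius i ^ 2 / 2 < S₁)
    (hp : IsProfile β b) (hβ0 : ∀ s, 0 < s → 0 ≤ β s)
    (hβ : ∀ s, 0 < s → s ≤ S₁ → β s = 0 ∧ b s = c) (x : M) :
    SmoothTensorAt (E.glueTensor T₁ β b c) x := by
  refine (((isMetric_glueMetric hT₁ hS₁ hp hβ0 hβ).smooth x).smul c).add (endTensor_smooth hS₁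
    (fun y hy => ?_) (fun y hy hy' => radTensor_sub_eq_zero hβ hy hy') x)
  intro a d
  exact (hp.smooth_radTensor hy a d).sub (contDiffAt_const.mul (hp.smooth_radMetric hy a d))

end Glue

/-- On a compact set the scalar curvature of a metric is at least `-6c²` for some `c > 0`. -/
lemma exists_curvature_bound [IsManifold (𝓡 3) ∞ M] {T : TwoTensor M} (hT : IsMetric T) {K : Set M}
    (hK : IsCompact K) : ∃ c : ℝ, 0 < c ∧ ∀ x ∈ K,
      0 ≤ scalarCurv (components (chartAt E3 x) T) (chartAt E3 x x) + 6 * c ^ 2 := by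
  have h0 (x : M) : hamScalar T 0 x = scalarCurv (components (chartAt E3 x) T) (chartAt E3 x x) := by
    have : components (chartAt E3 x) (0 : TwoTensor M) = 0 := by ext; rfl
    simp [hamScalar, hamDensity, this, sqLocal, trLocal]
  have hc : Continuous (hamScalar T 0) :=
    (hamScalar_smooth hT (fun _ _ _ => rfl) smoothTensorAt_zero).continuous
  obtain ⟨m, hm⟩ := (hK.image hc).bddBelow
  refine ⟨|m| + 1, by positivity, fun x hx => ?_⟩
  have := hm ⟨x, hx, rfl⟩
  rw [h0] at this
  nlinarith [neg_abs_le m, abs_nonneg m]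

end AsymptoticEnds

/-! ### Existence of initial data -/

section Data

variable {M : Type*} [TopologicalSpace M] [ChartedSpace E3 M] [IsManifold (𝓡 3) ∞ M]

/-- Data with vanishing momentum density, given by a metric and a symmetric tensor. -/
def IsMetric.toInitialData {T P : TwoTensor M} (hT : IsMetric T) (hP : ∀ x v w, P x v w = P x w v)
    (hPs : ∀ x, SmoothTensorAt P x)
    (hdiv : ∀ x a, divMomentum (components (chartAt E3 x) T) (components (chartAt E3 x) P) a
      (chartAt E3 x x) = 0) : InitialDataSet M where
  g := hT.toRiemannian
  p := P
  p_symm := hP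
  p_smooth x := hPs x
  ρ x := hamScalar T P x / (16 * Real.pi)
  ρ_smooth := by
    have h : ContDiff ℝ ∞ fun s : ℝ => s / (16 * Real.pi) := contDiff_id.div_const _
    exact h.contMDiff.comp (hamScalar_smooth hT hP hPs)
  J _ := 0
  J_smooth := Bundle.contMDiff_zeroSection ℝ (TangentSpace (𝓡 3) (M := M))
  hamiltonian x := by
    rw [mul_div_cancel₀ _ (by positivity)]
    rfl
  momentum x a := by
    have h : vecComponent (chartAt E3 x) x 0 a = 0 := by
      unfold vecComponent
      rw [map_zero]
      rfl
    rw [h, mul_zero]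
    exact hdiv x a

lemma isBigO_of_eventually_zero {f : E3 → ℝ} (h : f =ᶠ[Bornology.cobounded E3] fun _ => 0)
    (g : E3 → ℝ) : f =O[Bornology.cobounded E3] g :=
  h.trans_isBigO (Asymptotics.isBigO_zero _ _)

lemma pd_zero (c : Fin 3) : pd c (fun _ => 0) = fun _ => 0 := by
  funext y; simp [pd]

end Data

/-- Existence of asymptotically flat initial data with vanishing momentum density. -/
theorem exists_initialData {M : Type*} [TopologicalSpace M] [T2Space M] [SecondCountableTopology M]
    [ChartedSpace E3 M] [IsManifold (𝓡 3) ∞ M] (E : AsymptoticEnds M) :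
    ∃ D : InitialDataSet M,
      D.PhysicallyReasonable ∧ D.IsAsymptoticallyFlat E ∧
        (∀ x, D.J x = 0) ∧ (∀ x, 0 ≤ D.ρ x) := by
  -- `S₀` is beyond all the balls, and the data are flat and umbilic on `S₀ ≤ |y|²/2 ≤ S₀ + 1`
  set S₀ : ℝ := 1 + ∑ i, E.radius i ^ 2 / 2 with hS₀def
  have hS₀ : ∀ i, E.radius i ^ 2 / 2 < S₀ := fun i => by
    have := Finset.single_le_sum (f := fun i => E.radius i ^ 2 / 2) (fun j _ => by positivity)
      (Finset.mem_univ i)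
    linarith
  have hS₀pos : 0 < S₀ := by positivity
  have hS₁ : ∀ i, E.radius i ^ 2 / 2 < S₀ + 1 := fun i => by linarith [hS₀ i]
  obtain ⟨T₁, hT₁, hflat⟩ := AsymptoticEnds.exists_flat_metric hS₀
  obtain ⟨c, hc, hcurv⟩ :=
    AsymptoticEnds.exists_curvature_bound hT₁ (E.isCompact_truncation √(2 * S₀))
  obtain ⟨β, b, K, R, hp, hβ0, hβ, hham, hdecay⟩ := exists_profile hc (S := S₀ + 1) (by positivity)
  set T := E.glueMetric T₁ β
  set P := E.glueTensor T₁ β b c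
  have hT : IsMetric T := AsymptoticEnds.isMetric_glueMetric hT₁ hS₁ hp hβ0 hβ
  have hP : ∀ x v w, P x v w = P x w v := AsymptoticEnds.glueTensor_symm hT₁.symm
  have hPs : ∀ x, SmoothTensorAt P x := AsymptoticEnds.glueTensor_smooth hT₁ hS₁ hp hβ0 hβ
  have hTend (i y) (hy : S₀ ≤ halfSq y) : components (E.chart i) T y = radMetric β y :=
    AsymptoticEnds.components_glueMetric (hflat i) (hS₀ i) hy
  have hPend (i y) (hy : S₀ ≤ halfSq y) : components (E.chart i) P y = radTensor β b y :=
    AsymptoticEnds.components_glueTensor (hflat i) (hS₀ i) hy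
  have key (x : M) : 0 ≤ hamScalar T P x ∧ ∀ a, divMomentum (components (chartAt E3 x) T)
      (components (chartAt E3 x) P) a (chartAt E3 x x) = 0 := by
    have he : chartAt E3 x ∈ IsManifold.maximalAtlas (𝓡 3) ∞ M :=
      IsManifold.chart_mem_maximalAtlas x
    have hx := mem_chart_source E3 x
    by_cases h : ∃ i, x ∈ (E.chart i).source ∧ S₀ < halfSq (E.chart i x)
    -- on the ends the data are radial, and elsewhere they are umbilic
    · obtain ⟨i, hi, hs⟩ := h
      have hev := halfSq_contDiff.continuous.continuousAt.eventually (lt_mem_nhds hs)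
      have hT' : components (E.chart i) T =ᶠ[𝓝 (E.chart i x)] radMetric β :=
        hev.mono fun z hz => hTend i z hz.le
      have hP' : components (E.chart i) P =ᶠ[𝓝 (E.chart i x)] radTensor β b :=
        hev.mono fun z hz => hPend i z hz.le
      have hy := hS₀pos.trans hs
      constructor
      · rw [hamScalar_eq hT hP (E.chart_mem i) hi, hamDensity_congr hT' hP', hamDensity,
          hp.hamiltonian_radial hy]
        exact hham _ hy
      · refine divMomentum_components hT hP hPs (E.chart_mem i) he hi hx fun a => ?_
        rw [divMomentum_congr hT' hP', hp.divMomentum_radial hy]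
    · push Not at h
      have hint : ∀ i, x ∉ E.endSet i (S₀ + 1) := fun i hi => by
        linarith [h i hi.1, hi.2]
      obtain ⟨hT', hP'⟩ := AsymptoticEnds.glue_interior hS₁ hβ hint (chartAt E3 x) hx
      have hsymm := components_isSymm (chartAt E3 x) hT₁.symm
      have hy := (chartAt E3 x).map_source hx
      have hdet := hT₁.det_components he hy
      constructor
      · rw [hamScalar, hamDensity_congr hT' hP', hamDensity_smul hsymm hdet]
        refine hcurv x ?_
        by_cases hcore : x ∈ E.core
        · exact Or.inl hcore
        · have hc' : x ∈ E.coreᶜ := hcore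
          rw [E.compl_core, Set.mem_iUnion] at hc'
          obtain ⟨i, hi⟩ := hc'
          refine Or.inr (Set.mem_iUnion.2 ⟨i, hi, Real.le_sqrt_of_sq_le ?_⟩)
          have := h i hi
          unfold halfSq at this
          linarith
      · intro a
        rw [divMomentum_congr hT' hP', divMomentum_smul hsymm (hT₁.smooth_components he hy) hdet]
  have hρ (x : M) : 0 ≤ hamScalar T P x / (16 * Real.pi) := div_nonneg (key x).1 (by positivity)
  refine ⟨hT.toInitialData hP hPs fun x => (key x).2, ⟨?_, fun x => ?_⟩, fun i a d => ?_,
    fun x => rfl, hρ⟩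
  · refine AsymptoticEnds.geodesicallyComplete_of_le hS₀pos.le hS₀ hT fun i y v hy => ?_
    refine le_of_le_of_eq ?_ (congrArg (fun A => bilinOfMat A v v) (hTend i y hy).symm)
    exact norm_sq_le_radMetric hp hβ0 (hS₀pos.trans_le hy) v
  · have h : (hT.toRiemannian.inner x) (0 : TangentSpace (𝓡 3) x) 0 = 0 := by simp
    exact (congrArg Real.sqrt h).trans_le (Real.sqrt_zero.trans_le (hρ x))
  · obtain ⟨h1, h2, h3⟩ := radMat_decay (isSymbol_metricCoeff fun s hs => (hdecay s hs).1)
      (fun s hs => hp.smooth_coeff hs) (H := components (E.chart i) T)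
      ((halfSq_tendsto.eventually (eventually_ge_atTop S₀)).mono fun y hy => hTend i y hy) a d
    have h4 : (fun y => components (E.chart i) P y a d) =ᶠ[Bornology.cobounded E3] fun _ => 0 := by
      filter_upwards [halfSq_tendsto.eventually (eventually_ge_atTop S₀),
        halfSq_tendsto.eventually (eventually_gt_atTop R)] with y hy hyR
      have hb : b =ᶠ[𝓝 (halfSq y)] fun _ => 0 := by
        filter_upwards [lt_mem_nhds hyR] with s hs using (hdecay s (le_of_lt hs)).2
      rw [hPend i y hy, radTensor, radMat_apply, hb.deriv_eq, hb.eq_of_nhds]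
      simp
    refine ⟨h1, h2, h3, isBigO_of_eventually_zero h4 _, fun c => ?_⟩
    refine isBigO_of_eventually_zero ((pd_eventuallyEq_cobounded h4 c).trans ?_) _
    rw [pd_zero]

end GRData

end

theorem theorem5 {M : Type*} [TopologicalSpace M] [T2Space M] [SecondCountableTopology M]
    [ChartedSpace GRData.E3 M] [IsManifold (𝓡 3) ∞ M] (E : GRData.AsymptoticEnds M) :
    ∃ D : GRData.InitialDataSet M,
      D.PhysicallyReasonable ∧ D.IsAsymptoticallyFlat E ∧
        (∀ x, D.J x = 0) ∧ (∀ x, 0 ≤ D.ρ x) :=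
  GRData.exists_initialData E
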